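/- Let $n\ge 1$ be an integer, $0<s<\min\{1,n/2\}$ and $0<\alpha\le 1$. For $t>0$ and $f:\mathbb{R}^n\to\mathbb{R}$ let $e^{t\Delta}f(x)=\int_{\mathbb{R}^n}\frac{1}{(4\pi t)^{n/2}}e^{-|x-z|^2/(4t)}f(z)\,dz$ be the heat semigroup. Notation. For an integer $k\ge 0$ and $0<\beta\le 1$, $C^{k,\beta}(\mathbb{R}^n)$ is the space of $C^k$ functions $u:\mathbb{R}^n\to\mathbb{R}$ with finite norm $$\|u\|_{C^{k,\beta}}=\|u\|_{C^k}+\max_{|\gamma|=k}\sup_{x\ne y}\frac{|D^\gamma u(x)-D^\gamma u(y)|}{|x-y|^\beta},\qquad \|u\|_{C^k}=\sum_{j=0}^{k}\max_{|\gamma|=j}\|D^\gamma u\|_{L^\infty(\mathbb{R}^n)}.$$ For an integer $k\ge1$, the Zygmund space $\Lambda_*^k$ is the space of $C^{k-1}$ functions $u$ with finite norm $$\|u\|_{\Lambda_*^k}=\|u\|_{C^{k-1}}+\max_{|\gamma|=k-1}[D^\gamma u]_{\Lambda_*},\qquad [w]_{\Lambda_*}=\sup_{x,h\in\mathbb{R}^n,\,h\neq0}\frac{|w(x+h)+w(x-h)-2w(x)|}{|h|}.$$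 (For $k=1$ continuity is automatic for bounded $u$ with $[u]_{\Lambda_*}<\infty$.) A bounded classical solution to $(-\Delta)^sv=f$ in $\mathbb{R}^n$ is a bounded function $v:\mathbb{R}^n\to\mathbb{R}$ such that every point of $\mathbb{R}^n$ has a neighborhood on which, for some $\varepsilon>0$, $v$ is of class $C^{0,2s+\varepsilon}$ with $2s+\varepsilon\le1$ (if $s<1/2$), or of class $C^{1,2s+\varepsilon-1}$ with $2s+\varepsilon-1\le1$ (if $s\ge1/2$), and such that for every $x\in\mathbb{R}^n$ $$(-\Delta)^sv(x):=c_{n,s}\lim_{\varepsilon\to0^+}\int_{|x-z|>\varepsilon}\frac{v(x)-v(z)}{|x-z|^{n+2s}}\,dz=f(x),\qquad c_{n,s}=\frac{4^s\,\Gamma(n/2+s)}{|\Gamma(-s)|\,\pi^{n/2}}.$$ Theorem (Schauder–Zygmund estimates). There is a constant $C>0$, depending only on $n$, $s$ and $\alpha$, such that the following holds for every $f\in C^{0,\alpha}(\mathbb{R}^n)$ with compact support. The integral $$u(x)=(-\Delta)^{-s}f(x)=\frac{1}{\Gamma(s)}\int_0^\infty e^{t\Delta}f(x)\,\frac{dt}{t^{1-s}}$$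 converges absolutely for every $x\in\mathbb{R}^n$, and: (i) If $\alpha+2s<1$ then $u\in C^{0,\alpha+2s}(\mathbb{R}^n)$ and $\|u\|_{C^{0,\alpha+2s}}\le C\big(\|u\|_{L^\infty}+\|f\|_{C^{0,\alpha}}\big)$. (ii) If $1<\alpha+2s<2$ then $u\in C^{1,\alpha+2s-1}(\mathbb{R}^n)$ and $\|u\|_{C^{1,\alpha+2s-1}}\le C\big(\|u\|_{L^\infty}+\|f\|_{C^{0,\alpha}}\big)$. (iii) If $2<\alpha+2s<3$ then $u\in C^{2,\alpha+2s-2}(\mathbb{R}^n)$ and $\|u\|_{C^{2,\alpha+2s-2}}\le C\big(\|u\|_{L^\infty}+\|f\|_{C^{0,\alpha}}\big)$. (iv) If $\alpha+2s=k$ with $k\in\{1,2\}$ then $u\in\Lambda_*^k$ and $\|u\|_{\Lambda_*^k}\le C\big(\|u\|_{L^\infty}+\|f\|_{C^{0,\alpha}}\big)$. Moreover, $u$ is the unique bounded classical solution to $(-\Delta)^su=f$ in $\mathbb{R}^n$ that vanishes at infinity, i.e. with $u(x)\to0$ as $|x|\to\infty$. -/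

import Mathlib

open MeasureTheory Filter Set
open scoped ENNReal NNReal Topology

/-- The Gauss--Weierstrass kernel `G_t(x) = (4πt)^{-n/2} e^{-|x|²/(4t)}` on `ℝⁿ`. -/
noncomputable def heatKernel {n : ℕ} (t : ℝ) (x : EuclideanSpace ℝ (Fin n)) : ℝ :=
  1 / (4 * Real.pi * t) ^ ((n : ℝ) / 2) * Real.exp (-‖x‖ ^ 2 / (4 * t))

/-- The heat semigroup `e^{tΔ} f(x) = ∫ G_t(x - z) f(z) dz`. -/
noncomputable def heatSemigroup {n : ℕ} (t : ℝ) (f : EuclideanSpace ℝ (Fin n) → ℝ)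
    (x : EuclideanSpace ℝ (Fin n)) : ℝ :=
  ∫ z, heatKernel t (x - z) * f z

/-- The negative power `(-Δ)^{-s} f(x) = Γ(s)⁻¹ ∫₀^∞ e^{tΔ} f(x) dt / t^{1-s}`. -/
noncomputable def negPowLaplacian {n : ℕ} (s : ℝ) (f : EuclideanSpace ℝ (Fin n) → ℝ)
    (x : EuclideanSpace ℝ (Fin n)) : ℝ :=
  1 / Real.Gamma s * ∫ t in Ioi (0 : ℝ), heatSemigroup t f x / t ^ (1 - s)

/-- The partial derivative `∂_{γ 0} ⋯ ∂_{γ (k-1)} u`. As `γ` runs through all `k`-tuples of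
coordinates, these are, for `u` of class `C^k`, exactly the `D^γ u` with multi-indices of order
`k` (possibly repeated). -/
noncomputable def partialD {n k : ℕ} (γ : Fin k → Fin n) (u : EuclideanSpace ℝ (Fin n) → ℝ)
    (x : EuclideanSpace ℝ (Fin n)) : ℝ :=
  iteratedFDeriv ℝ k u x (fun j => EuclideanSpace.single (γ j) (1 : ℝ))

/-- The norm `‖u‖_{C^k} = ∑_{j ≤ k} max_{|γ| = j} ‖D^γ u‖_{L^∞}`, as an extended number;
meaningful for `u` of class `C^k`. -/
noncomputable def ckNorm {n : ℕ} (k : ℕ) (u : EuclideanSpace ℝ (Fin n) → ℝ) : ℝ≥0∞ :=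
  ∑ j ∈ Finset.range (k + 1), ⨆ γ : Fin j → Fin n, eLpNorm (partialD γ u) ∞ volume

/-- The Hölder norm `‖u‖_{C^{k,β}} = ‖u‖_{C^k} + max_{|γ| = k} [D^γ u]_{C^β}`, as an extended
number; meaningful for `u` of class `C^k` and `0 < β`. -/
noncomputable def holderNorm {n : ℕ} (k : ℕ) (β : ℝ) (u : EuclideanSpace ℝ (Fin n) → ℝ) :
    ℝ≥0∞ :=
  ckNorm k u + ⨆ γ : Fin k → Fin n, eHolderNorm β.toNNReal (partialD γ u)

/-- The Hölder space `C^{k,β}(ℝⁿ)`. -/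
def MemHolderSpace {n : ℕ} (k : ℕ) (β : ℝ) (u : EuclideanSpace ℝ (Fin n) → ℝ) : Prop :=
  ContDiff ℝ k u ∧ holderNorm k β u < ∞

/-- The Zygmund seminorm `sup_{x,h} |u(x+h) + u(x-h) - 2u(x)| / |h|` (the term with `h = 0` is
`0`). -/
noncomputable def zygmundSeminorm {n : ℕ} (u : EuclideanSpace ℝ (Fin n) → ℝ) : ℝ≥0∞ :=
  ⨆ (x : EuclideanSpace ℝ (Fin n)) (h : EuclideanSpace ℝ (Fin n)),
    ‖u (x + h) + u (x - h) - 2 * u x‖ₑ / ‖h‖ₑ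

/-- The Zygmund norm `‖u‖_{Λ_*^k} = ‖u‖_{C^{k-1}} + max_{|γ| = k-1} [D^γ u]_{Λ_*}`, for `1 ≤ k`.
For `k = 1` this is `‖u‖_{L^∞} + [u]_{Λ_*}`. -/
noncomputable def zygmundNorm {n : ℕ} (k : ℕ) (u : EuclideanSpace ℝ (Fin n) → ℝ) : ℝ≥0∞ :=
  ckNorm (k - 1) u + ⨆ γ : Fin (k - 1) → Fin n, zygmundSeminorm (partialD γ u)

/-- The Zygmund space `Λ_*^k(ℝⁿ)`, for `1 ≤ k`. For `k = 1` the continuity required here is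
automatic: a bounded function with finite Zygmund seminorm is continuous. -/
def MemZygmundSpace {n : ℕ} (k : ℕ) (u : EuclideanSpace ℝ (Fin n) → ℝ) : Prop :=
  ContDiff ℝ (k - 1 : ℕ) u ∧ zygmundNorm k u < ∞

/-- The constant `c_{n,s} = 4^s Γ(n/2 + s) / (|Γ(-s)| π^{n/2})`. -/
noncomputable def fracLaplacianConst (n : ℕ) (s : ℝ) : ℝ :=
  4 ^ s * Real.Gamma ((n : ℝ) / 2 + s) / (|Real.Gamma (-s)| * Real.pi ^ ((n : ℝ) / 2))

/-- `(-Δ)^s v(x)` exists and equals `L`, by the pointwise formula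
`(-Δ)^s v(x) = c_{n,s} P.V. ∫ (v(x) - v(z)) / |x - z|^{n+2s} dz`. -/
def HasFracLaplacianAt {n : ℕ} (s : ℝ) (v : EuclideanSpace ℝ (Fin n) → ℝ) (L : ℝ)
    (x : EuclideanSpace ℝ (Fin n)) : Prop :=
  Tendsto (fun ε : ℝ => fracLaplacianConst n s *
      ∫ z in {z | ε < ‖x - z‖}, (v x - v z) / ‖x - z‖ ^ ((n : ℝ) + 2 * s))
    (𝓝[>] 0) (𝓝 L)

/-- `v` is of class `C^k` and near `x` its derivatives of order `k` are Hölder continuous with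
exponent `β`: the local class `C^{k,β}` near `x`. -/
def IsHolderNear {n : ℕ} (k : ℕ) (β : ℝ) (v : EuclideanSpace ℝ (Fin n) → ℝ)
    (x : EuclideanSpace ℝ (Fin n)) : Prop :=
  ∃ U ∈ 𝓝 x, ContDiffOn ℝ k v U ∧
    ∀ γ : Fin k → Fin n, ∃ C : ℝ≥0, HolderOnWith C β.toNNReal (partialD γ v) U

/-- Bounded classical solutions of `(-Δ)^s v = f` in `ℝⁿ` that vanish at infinity: near each point
`v` has the regularity that makes the pointwise formula for `(-Δ)^s v` meaningful, namely
`C^{0,2s+ε}` with `2s + ε ≤ 1` if `s < 1/2`, and `C^{1,2s+ε-1}` with `2s + ε - 1 ≤ 1` if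
`1/2 ≤ s`, for some `ε > 0`; and the equation holds at every point. -/
structure IsBddClassicalSolution {n : ℕ} (s : ℝ) (f v : EuclideanSpace ℝ (Fin n) → ℝ) : Prop where
  bounded : ∃ M : ℝ, ∀ x, |v x| ≤ M
  regular : ∀ x, ∃ ε > 0,
    (s < 1 / 2 ∧ 2 * s + ε ≤ 1 ∧ IsHolderNear 0 (2 * s + ε) v x) ∨
    (1 / 2 ≤ s ∧ 2 * s + ε - 1 ≤ 1 ∧ IsHolderNear 1 (2 * s + ε - 1) v x)
  equation : ∀ x, HasFracLaplacianAt s v (f x) x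
  vanishes : Tendsto v (cocompact (EuclideanSpace ℝ (Fin n))) (𝓝 0)

/-! Everything is read off the time integral u = Γ(s)⁻¹ ∫ t^(s-1) e^{tΔ}f dt. Derivatives of the
heat kernel have mean zero, so in D^k e^{tΔ}f(x) with k ≥ 1 one may replace f(z) by f(z) - f(x);
parabolic scaling then gives |D^k e^{tΔ}f| ≤ C H t^((α-k)/2), where H bounds f and its Hölder
seminorm (`exists_norm_iteratedFDeriv_heatSemigroup_le_of_holder`). Hence D^k u may be computed
under the integral sign while k < α + 2s. To compare D^k u at x and y, cut the time integral at t =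
|x-y|². Early times use the size of the difference directly; late times spend one more derivative
through the mean value inequality. Both pieces are multiples of |x-y|^(α+2s-k) when α + 2s < k + 1.
If α + 2s = k + 1, the late majorant diverges logarithmically; second differences spend two
derivatives instead and converge for α + 2s < k + 2, which is where the Zygmund space comes from.

Decay at large times comes from ‖f‖_{L¹} and s < n/2. It depends on the support of f, so it serves
only for convergence and finiteness and must not enter C. Lower order derivatives are therefore
bounded by interpolation between sup |u| and second differences of the top derivatives, absorbing a
supremum known only to be finite (`norm_iteratedFDeriv_le_of_second_diff`).

For the equation, |y|^(-n-2s) is a multiple of ∫ τ^(-1-s) G_τ(y) dτ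
(`integral_rpow_mul_heatKernel`), so (-Δ)^s u(x) is a multiple of ∫ τ^(-1-s) (u - e^{τΔ}u)(x) dτ.
With φ(t) = e^{tΔ}f(x), the difference u - e^{τΔ}u is an increment of the Weyl fractional integral
of φ, and the integral over τ is its Marchaud derivative. Truncated at δ, it equals ∫ φ(δr) K(r) dr
for a fixed integrable K (`integral_marchaud_eq`), and so tends to f(x) ∫ K. The mass of K is found
by testing on φ(t) = e^{-t}, and it matches the normalisation c_{n,s}.

Uniqueness is the maximum principle: at a positive maximum of the difference of two solutions, the
truncated integrals stay above a positive constant. -/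

theorem fderiv_iteratedFDeriv_eq_curryLeft {E F : Type*} [NormedAddCommGroup E]
    [NormedSpace ℝ E] [NormedAddCommGroup F] [NormedSpace ℝ F] (k : ℕ) (u : E → F) (x : E) :
    fderiv ℝ (iteratedFDeriv ℝ k u) x = (iteratedFDeriv ℝ (k + 1) u x).curryLeft :=
  congrFun (fderiv_iteratedFDeriv (𝕜 := ℝ) (f := u) (n := k)) x

/-! ### Differentiation under the integral sign, to every order -/

section Parametric

variable {Z E F : Type*} [MeasurableSpace Z] {μ : Measure Z}
  [NormedAddCommGroup E] [NormedSpace ℝ E] [NormedAddCommGroup F] [NormedSpace ℝ F]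

/-- The derivative of a family of functions depends measurably on the parameter. -/
theorem aestronglyMeasurable_of_hasFDerivAt [FiniteDimensional ℝ E] {g : Z → E → F}
    {g' : Z → E →L[ℝ] F} {x : E} (hm : ∀ y, AEStronglyMeasurable (fun z => g z y) μ)
    (hd : ∀ᵐ z ∂μ, HasFDerivAt (g z) (g' z) x) : AEStronglyMeasurable g' μ := by
  have h1 : ∀ v : E, AEStronglyMeasurable (fun z => g' z v) μ := by
    intro v
    -- `g' z v` is the limit of difference quotients of step 1/m, each measurable in z; a finite
    -- basis then recovers `g'` from its values.
    refine aestronglyMeasurable_of_tendsto_ae atTop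
      (f := fun (m : ℕ) z => (m : ℝ) • (g z (x + (m : ℝ)⁻¹ • v) - g z x)) ?_ ?_
    · intro m
      exact ((hm _).sub (hm _)).const_smul _
    · filter_upwards [hd] with z hz
      refine hz.lim v ?_
      simpa using tendsto_natCast_atTop_atTop
  let b := Module.finBasis ℝ E
  have h2 : g' = fun z => ∑ i, ContinuousLinearMap.smulRightL ℝ E F
      (LinearMap.toContinuousLinearMap (b.coord i)) (g' z (b i)) := by
    funext z
    refine ContinuousLinearMap.ext fun v => ?_
    conv_lhs => rw [← b.sum_repr v]
    rw [map_sum]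
    simp
  rw [h2]
  refine Finset.aestronglyMeasurable_fun_sum _ fun i _ => ?_
  exact (ContinuousLinearMap.continuous _).comp_aestronglyMeasurable (h1 (b i))

/-- The derivative `D` is pinned down only by its values on vectors, so that the curried integral of
the next Taylor coefficient can serve as `D`. -/
theorem hasFDerivAt_integral_of_apply [FiniteDimensional ℝ E] [CompleteSpace F] {f : Z → E → F}
    {x : E} {b : Z → ℝ}
    (hm : ∀ y, AEStronglyMeasurable (fun z => f z y) μ) (hf : Integrable (fun z => f z x) μ)
    (hd : ∀ᵐ z ∂μ, ∀ y, HasFDerivAt (f z) (fderiv ℝ (f z) y) y) (hb : Integrable b μ)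
    (hfb : ∀ᵐ z ∂μ, ∀ y, ‖fderiv ℝ (f z) y‖ ≤ b z) {D : E →L[ℝ] F}
    (hD : ∀ v, D v = ∫ z, fderiv ℝ (f z) x v ∂μ) : HasFDerivAt (fun y => ∫ z, f z y ∂μ) D x := by
  have h0 := aestronglyMeasurable_of_hasFDerivAt (g := f) (x := x) hm
    (by filter_upwards [hd] with z hz using hz x)
  have h1 := hasFDerivAt_integral_of_dominated_of_fderiv_le (𝕜 := ℝ) (μ := μ) (x₀ := x)
    (F := fun x z => f z x) (F' := fun x z => fderiv ℝ (f z) x) (bound := b) (s := univ) univ_mem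
    (Eventually.of_forall hm) hf h0
    (by filter_upwards [hfb] with z hz y _ using hz y) hb
    (by filter_upwards [hd] with z hz y _ using hz y)
  convert h1 using 1
  ext v
  rw [hD, ContinuousLinearMap.integral_apply]
  refine hb.mono' h0 ?_
  filter_upwards [hfb] with z hz using hz x

/-- The derivatives of a family of functions depend measurably on the parameter. -/
theorem aestronglyMeasurable_iteratedFDeriv [FiniteDimensional ℝ E] {N : ℕ}
    {f : Z → E → F} (hf : ∀ᵐ z ∂μ, ContDiff ℝ N (f z))
    (hm : ∀ x, AEStronglyMeasurable (fun z => f z x) μ) {k : ℕ} (hk : k ≤ N) (x : E) :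
    AEStronglyMeasurable (fun z => iteratedFDeriv ℝ k (f z) x) μ := by
  induction k generalizing x with
  | zero =>
    exact ((continuousMultilinearCurryFin0 ℝ E F).symm.continuous).comp_aestronglyMeasurable (hm x)
  | succ k ih =>
    have h1 : AEStronglyMeasurable (fun z => fderiv ℝ (iteratedFDeriv ℝ k (f z)) x) μ := by
      refine aestronglyMeasurable_of_hasFDerivAt (g := fun z => iteratedFDeriv ℝ k (f z))
        (x := x) (ih (by omega)) ?_
      filter_upwards [hf] with z hz
      exact (hz.differentiable_iteratedFDeriv (by exact_mod_cast hk) x).hasFDerivAt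
    exact ((continuousMultilinearCurryLeftEquiv ℝ (fun _ => E) F).symm.continuous).comp_aestronglyMeasurable
      h1

/-- One integrable majorant per order lets each Taylor coefficient be differentiated under the
integral. Smoothness of the integral and the formula for its derivatives both follow, since a Taylor
series determines the iterated derivatives. -/
theorem hasFTaylorSeriesUpTo_integral [FiniteDimensional ℝ E] [CompleteSpace F] {N : ℕ}
    {f : Z → E → F} (hf : ∀ᵐ z ∂μ, ContDiff ℝ N (f z))
    (hm : ∀ x, AEStronglyMeasurable (fun z => f z x) μ) {b : ℕ → Z → ℝ}
    (hb : ∀ k ≤ N, Integrable (b k) μ)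
    (hfb : ∀ k ≤ N, ∀ᵐ z ∂μ, ∀ x, ‖iteratedFDeriv ℝ k (f z) x‖ ≤ b k z) :
    HasFTaylorSeriesUpTo N (fun x => ∫ z, f z x ∂μ)
      (fun x k => ∫ z, iteratedFDeriv ℝ k (f z) x ∂μ) := by
  have hdiff : ∀ k < N, ∀ᵐ z ∂μ, ∀ x, HasFDerivAt (iteratedFDeriv ℝ k (f z))
      (fderiv ℝ (iteratedFDeriv ℝ k (f z)) x) x := by
    intro k hk
    filter_upwards [hf] with z hz x
    exact (hz.differentiable_iteratedFDeriv (by exact_mod_cast hk) x).hasFDerivAt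
  have hmeas : ∀ k ≤ N, ∀ x, AEStronglyMeasurable (fun z => iteratedFDeriv ℝ k (f z) x) μ :=
    fun k hk x => aestronglyMeasurable_iteratedFDeriv hf hm hk x
  have hint : ∀ k ≤ N, ∀ x, Integrable (fun z => iteratedFDeriv ℝ k (f z) x) μ := by
    intro k hk x
    refine (hb k hk).mono' (hmeas k hk x) ?_
    filter_upwards [hfb k hk] with z hz using hz x
  refine ⟨fun x => ?_, fun k hk x => ?_, fun k hk => ?_⟩
  · have := (continuousMultilinearCurryFin0 ℝ E F).toContinuousLinearEquiv.integral_comp_comm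
      (fun z => iteratedFDeriv ℝ 0 (f z) x) (μ := μ)
    exact this.symm.trans (by simp)
  · have hk' : k < N := by exact_mod_cast hk
    refine hasFDerivAt_integral_of_apply (hmeas k hk'.le) (hint k hk'.le x) (hdiff k hk')
      (hb _ hk') ?_ fun v => ?_
    · filter_upwards [hfb (k + 1) hk'] with z hz y
      rw [norm_fderiv_iteratedFDeriv]
      exact hz y
    · ext m
      have h4 : Integrable (fun z => fderiv ℝ (iteratedFDeriv ℝ k (f z)) x v) μ := by
        refine ((hb _ hk').mul_const ‖v‖).mono' ?_ ?_
        · exact (aestronglyMeasurable_of_hasFDerivAt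
            (g := fun z => iteratedFDeriv ℝ k (f z)) (x := x) (hmeas k hk'.le)
            (by filter_upwards [hdiff k hk'] with z hz using hz x)).apply_continuousLinearMap v
        · filter_upwards [hfb (k + 1) hk'] with z hz
          refine (ContinuousLinearMap.le_opNorm _ _).trans ?_
          rw [norm_fderiv_iteratedFDeriv]
          exact mul_le_mul_of_nonneg_right (hz x) (norm_nonneg _)
      rw [ContinuousMultilinearMap.integral_apply h4]
      simp only [ContinuousMultilinearMap.curryLeft_apply, fderiv_iteratedFDeriv_eq_curryLeft]
      rw [ContinuousMultilinearMap.integral_apply (hint _ hk' x)]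
  · have hk' : k ≤ N := by exact_mod_cast hk
    refine continuous_of_dominated (hmeas k hk') (fun x => ?_) (hb k hk') ?_
    · filter_upwards [hfb k hk'] with z hz using hz x
    · filter_upwards [hf] with z hz
      exact hz.continuous_iteratedFDeriv (by exact_mod_cast hk')

theorem contDiff_integral [FiniteDimensional ℝ E] [CompleteSpace F] {N : ℕ}
    {f : Z → E → F} (hf : ∀ᵐ z ∂μ, ContDiff ℝ N (f z))
    (hm : ∀ x, AEStronglyMeasurable (fun z => f z x) μ) {b : ℕ → Z → ℝ}
    (hb : ∀ k ≤ N, Integrable (b k) μ)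
    (hfb : ∀ k ≤ N, ∀ᵐ z ∂μ, ∀ x, ‖iteratedFDeriv ℝ k (f z) x‖ ≤ b k z) :
    ContDiff ℝ N (fun x => ∫ z, f z x ∂μ) :=
  HasFTaylorSeriesUpTo.contDiff (n := (N : ℕ∞)) (hasFTaylorSeriesUpTo_integral hf hm hb hfb)

theorem iteratedFDeriv_integral [FiniteDimensional ℝ E] [CompleteSpace F] {N : ℕ}
    {f : Z → E → F} (hf : ∀ᵐ z ∂μ, ContDiff ℝ N (f z))
    (hm : ∀ x, AEStronglyMeasurable (fun z => f z x) μ) {b : ℕ → Z → ℝ}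
    (hb : ∀ k ≤ N, Integrable (b k) μ)
    (hfb : ∀ k ≤ N, ∀ᵐ z ∂μ, ∀ x, ‖iteratedFDeriv ℝ k (f z) x‖ ≤ b k z) {k : ℕ} (hk : k ≤ N)
    (x : E) :
    iteratedFDeriv ℝ k (fun x => ∫ z, f z x ∂μ) x = ∫ z, iteratedFDeriv ℝ k (f z) x ∂μ :=
  ((hasFTaylorSeriesUpTo_integral hf hm hb hfb).eq_iteratedFDeriv (by exact_mod_cast hk) x).symm

end Parametric

/-! ### Finite differences and interpolation of derivatives -/

section Differences

variable {E F : Type*} [NormedAddCommGroup E] [NormedSpace ℝ E] [NormedAddCommGroup F]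
  [NormedSpace ℝ F]

theorem norm_fderiv_iteratedFDeriv_sub (u : E → F) (k : ℕ) (x y : E) :
    ‖fderiv ℝ (iteratedFDeriv ℝ k u) x - fderiv ℝ (iteratedFDeriv ℝ k u) y‖ =
      ‖iteratedFDeriv ℝ (k + 1) u x - iteratedFDeriv ℝ (k + 1) u y‖ := by
  simp only [fderiv_iteratedFDeriv_eq_curryLeft]
  exact ContinuousMultilinearMap.curryLeft_norm
    (iteratedFDeriv ℝ (k + 1) u x - iteratedFDeriv ℝ (k + 1) u y)

theorem norm_iteratedFDeriv_sub_le {u : E → F} {k : ℕ} (hu : ContDiff ℝ (k + 1 : ℕ) u) {B : ℝ}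
    (hB : ∀ x, ‖iteratedFDeriv ℝ (k + 1) u x‖ ≤ B) (x y : E) :
    ‖iteratedFDeriv ℝ k u x - iteratedFDeriv ℝ k u y‖ ≤ B * ‖x - y‖ := by
  refine Convex.norm_image_sub_le_of_norm_fderiv_le (𝕜 := ℝ) (s := univ) (fun z _ => ?_)
    (fun z _ => ?_) convex_univ (mem_univ _) (mem_univ _)
  · exact hu.differentiable_iteratedFDeriv (by exact_mod_cast k.lt_succ_self) z
  · rw [norm_fderiv_iteratedFDeriv]
    exact hB z

/-- The mean value inequality is used twice: the first difference of `D^k u` with step h has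
derivative at most `B * ‖h‖`, and the second difference is its increment from x - h to x. -/
theorem norm_iteratedFDeriv_second_diff_le {u : E → F} {k : ℕ} (hu : ContDiff ℝ (k + 2 : ℕ) u)
    {B : ℝ} (hB : ∀ x, ‖iteratedFDeriv ℝ (k + 2) u x‖ ≤ B) (x h : E) :
    ‖iteratedFDeriv ℝ k u (x + h) + iteratedFDeriv ℝ k u (x - h) -
      (2 : ℝ) • iteratedFDeriv ℝ k u x‖ ≤ B * ‖h‖ ^ 2 := by
  have hd : Differentiable ℝ (iteratedFDeriv ℝ k u) :=
    hu.differentiable_iteratedFDeriv (by exact_mod_cast (by omega : k < k + 2))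
  have h1 := Convex.norm_image_sub_le_of_norm_fderiv_le (𝕜 := ℝ) (s := univ)
    (f := fun y => iteratedFDeriv ℝ k u (y + h) - iteratedFDeriv ℝ k u y) (C := B * ‖h‖)
    (x := x - h) (y := x) (fun z _ => (hd.comp (differentiable_id.add_const h) z).sub (hd z))
    (fun z _ => ?_) convex_univ (mem_univ _) (mem_univ _)
  · calc _ = ‖(iteratedFDeriv ℝ k u (x + h) - iteratedFDeriv ℝ k u x) -
        (iteratedFDeriv ℝ k u (x - h + h) - iteratedFDeriv ℝ k u (x - h))‖ := by
          rw [sub_add_cancel, two_smul]; congr 1; abel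
      _ ≤ B * ‖h‖ * ‖x - (x - h)‖ := h1
      _ = B * ‖h‖ ^ 2 := by rw [sub_sub_cancel]; ring
  · have e : fderiv ℝ (fun y => iteratedFDeriv ℝ k u (y + h) - iteratedFDeriv ℝ k u y) z =
        fderiv ℝ (iteratedFDeriv ℝ k u) (z + h) - fderiv ℝ (iteratedFDeriv ℝ k u) z := by
      rw [fderiv_fun_sub _ (hd z), fderiv_comp_add_right]
      exact hd.comp (differentiable_id.add_const h) z
    rw [e, norm_fderiv_iteratedFDeriv_sub]
    simpa using norm_iteratedFDeriv_sub_le (k := k + 1) hu hB (z + h) z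

/-- A bound for the derivative by the function and the second differences of the derivative. -/
theorem norm_fderiv_le_of_second_diff {g : E → F} (hg : Differentiable ℝ g) {A L : ℝ}
    (hA : ∀ x, ‖g x‖ ≤ A)
    (hL : ∀ x h, ‖h‖ ≤ 1 → ‖fderiv ℝ g (x + h) + fderiv ℝ g (x - h) - (2 : ℝ) • fderiv ℝ g x‖ ≤ L)
    (x : E) : ‖fderiv ℝ g x‖ ≤ A + L / 2 := by
  have hA0 : 0 ≤ A := (norm_nonneg _).trans (hA x)
  have hL0 : 0 ≤ L := (norm_nonneg _).trans (hL x 0 (by simp))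
  refine ContinuousLinearMap.opNorm_le_of_unit_norm (by positivity) fun v hv => ?_
  -- This function of τ vanishes at 0, and its derivative is a second difference of g' applied to v,
  -- hence at most L. At τ = 1 this gives |2 g'(x) v| ≤ 2A + L.
  have hder : ∀ τ : ℝ, HasDerivAt (fun τ : ℝ => g (x + τ • v) - g (x - τ • v) -
      (2 * τ) • fderiv ℝ g x v)
      ((fderiv ℝ g (x + τ • v) + fderiv ℝ g (x - τ • v) - (2 : ℝ) • fderiv ℝ g x) v) τ := by
    intro τ
    have e1 : HasDerivAt (fun τ : ℝ => x + τ • v) v τ := by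
      simpa using ((hasDerivAt_id τ).smul_const v).const_add x
    have e2 : HasDerivAt (fun τ : ℝ => x - τ • v) (-v) τ := by
      simpa using ((hasDerivAt_id τ).smul_const v).const_sub x
    have e3 := (hg (x + τ • v)).hasFDerivAt.comp_hasDerivAt τ e1
    have e4 := (hg (x - τ • v)).hasFDerivAt.comp_hasDerivAt τ e2
    have e5 : HasDerivAt (fun τ : ℝ => (2 * τ) • fderiv ℝ g x v) ((2 : ℝ) • fderiv ℝ g x v) τ := by
      simpa using ((hasDerivAt_id τ).const_mul 2).smul_const (fderiv ℝ g x v)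
    convert (e3.sub e4).sub e5 using 1
    · rfl
    · simp
  have h1 := Convex.norm_image_sub_le_of_norm_hasDerivWithin_le (s := Icc (0 : ℝ) 1) (C := L)
    (x := 0) (y := 1)
    (fun τ _ => (hder τ).hasDerivWithinAt) (fun τ hτ => ?_) (convex_Icc 0 1)
    (by simp) (by simp)
  · simp only [one_smul, mul_one, zero_smul, add_zero, sub_zero, sub_self, mul_zero, norm_one] at h1
    have h2 : ‖(2 : ℝ) • fderiv ℝ g x v‖ ≤ L + (A + A) := by
      calc ‖(2 : ℝ) • fderiv ℝ g x v‖ = ‖(g (x + v) - g (x - v)) -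
            (g (x + v) - g (x - v) - (2 : ℝ) • fderiv ℝ g x v)‖ := by congr 1; abel
        _ ≤ ‖g (x + v) - g (x - v)‖ + ‖g (x + v) - g (x - v) - (2 : ℝ) • fderiv ℝ g x v‖ :=
            norm_sub_le _ _
        _ ≤ (A + A) + L := add_le_add ((norm_sub_le _ _).trans (add_le_add (hA _) (hA _))) h1
        _ = _ := by ring
    rw [norm_smul, Real.norm_ofNat] at h2
    linarith
  · refine (ContinuousLinearMap.le_opNorm _ _).trans ?_
    rw [hv, mul_one]
    refine hL _ _ ?_
    rw [norm_smul, hv, mul_one, Real.norm_of_nonneg hτ.1]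
    exact hτ.2

theorem norm_iteratedFDeriv_succ_le_of_second_diff {u : E → F} {k : ℕ}
    (hu : ContDiff ℝ (k + 1 : ℕ) u) {A L : ℝ} (hA : ∀ x, ‖iteratedFDeriv ℝ k u x‖ ≤ A)
    (hL : ∀ x h, ‖h‖ ≤ 1 → ‖iteratedFDeriv ℝ (k + 1) u (x + h) +
      iteratedFDeriv ℝ (k + 1) u (x - h) - (2 : ℝ) • iteratedFDeriv ℝ (k + 1) u x‖ ≤ L)
    (x : E) : ‖iteratedFDeriv ℝ (k + 1) u x‖ ≤ A + L / 2 := by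
  rw [← norm_fderiv_iteratedFDeriv]
  refine norm_fderiv_le_of_second_diff
    (hu.differentiable_iteratedFDeriv (by exact_mod_cast k.lt_succ_self)) hA (fun y h hh => ?_) x
  simp only [fderiv_iteratedFDeriv_eq_curryLeft]
  exact (ContinuousMultilinearMap.curryLeft_norm (iteratedFDeriv ℝ (k + 1) u (y + h) +
    iteratedFDeriv ℝ (k + 1) u (y - h) - (2 : ℝ) • iteratedFDeriv ℝ (k + 1) u y)).le.trans
    (hL y h hh)

/-- First order Taylor expansion with step 1/4. The step is short enough that the coefficient of B
is below 1, so that B can later be absorbed. -/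
theorem norm_iteratedFDeriv_one_le {u : E → F} (hu : ContDiff ℝ 2 u) {A B : ℝ}
    (hA : ∀ x, ‖u x‖ ≤ A) (hB : ∀ x, ‖iteratedFDeriv ℝ 2 u x‖ ≤ B) (x : E) :
    ‖iteratedFDeriv ℝ 1 u x‖ ≤ 8 * A + B / 4 := by
  have hA0 : 0 ≤ A := (norm_nonneg _).trans (hA x)
  have hB0 : 0 ≤ B := (norm_nonneg _).trans (hB x)
  have hd : Differentiable ℝ u := hu.differentiable (by norm_num)
  have hnorm : ∀ y z, ‖fderiv ℝ u y - fderiv ℝ u z‖ =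
      ‖iteratedFDeriv ℝ 1 u y - iteratedFDeriv ℝ 1 u z‖ := by
    intro y z
    rw [← norm_fderiv_iteratedFDeriv_sub]
    have e : iteratedFDeriv ℝ 0 u = (continuousMultilinearCurryFin0 ℝ E F).symm ∘ u := rfl
    have e' : ∀ w, fderiv ℝ (iteratedFDeriv ℝ 0 u) w =
        ((continuousMultilinearCurryFin0 ℝ E F).symm.toContinuousLinearEquiv :
          F →L[ℝ] E [×0]→L[ℝ] F).comp (fderiv ℝ u w) := fun w => by
      rw [e]
      exact ((continuousMultilinearCurryFin0 ℝ E F).symm.toContinuousLinearEquiv).comp_fderiv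
    rw [e', e', ← ContinuousLinearMap.comp_sub]
    exact ((continuousMultilinearCurryFin0 ℝ E F).symm.toLinearIsometry.norm_toContinuousLinearMap_comp).symm
  have hone : ‖iteratedFDeriv ℝ 1 u x‖ = ‖fderiv ℝ u x‖ := norm_iteratedFDeriv_one u
  rw [hone]
  refine ContinuousLinearMap.opNorm_le_of_unit_norm (by positivity) fun v hv => ?_
  have h1 := Convex.norm_image_sub_le_of_norm_hasFDerivWithin_le' (𝕜 := ℝ) (f := u)
    (s := Metric.closedBall x (1 / 4)) (C := B / 4) (f' := fun y => fderiv ℝ u y)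
    (φ := fderiv ℝ u x) (x := x) (y := x + (1 / 4 : ℝ) • v)
    (fun y _ => (hd y).hasFDerivAt.hasFDerivWithinAt) (fun y hy => ?_) (convex_closedBall _ _)
    (by simp) (by simp [norm_smul, hv])
  · simp only [add_sub_cancel_left, map_smul, norm_smul, hv] at h1
    have h2 : ‖(1 / 4 : ℝ) • fderiv ℝ u x v‖ ≤ (A + A) + B / 4 * (‖(1 / 4 : ℝ)‖ * 1) := by
      calc ‖(1 / 4 : ℝ) • fderiv ℝ u x v‖ = ‖(u (x + (1 / 4 : ℝ) • v) - u x) -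
          (u (x + (1 / 4 : ℝ) • v) - u x - (1 / 4 : ℝ) • fderiv ℝ u x v)‖ := by congr 1; abel
        _ ≤ _ := (norm_sub_le _ _).trans
          (add_le_add ((norm_sub_le _ _).trans (add_le_add (hA _) (hA _))) h1)
    rw [norm_smul] at h2
    norm_num at h2
    linarith
  · rw [hnorm]
    refine (norm_iteratedFDeriv_sub_le (k := 1) hu hB y x).trans ?_
    have : ‖y - x‖ ≤ 1 / 4 := by simpa [dist_eq_norm] using hy
    nlinarith

/-- Interpolation of the first two derivatives between the function and the second differences of
its second derivative. -/
theorem norm_iteratedFDeriv_le_of_second_diff_two {u : E → F} (hu : ContDiff ℝ 2 u) {A L B : ℝ}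
    (hA : ∀ x, ‖u x‖ ≤ A) (hB : ∀ x, ‖iteratedFDeriv ℝ 1 u x‖ ≤ B)
    (hL : ∀ x h, ‖h‖ ≤ 1 → ‖iteratedFDeriv ℝ 2 u (x + h) +
      iteratedFDeriv ℝ 2 u (x - h) - (2 : ℝ) • iteratedFDeriv ℝ 2 u x‖ ≤ L)
    (x : E) : ‖iteratedFDeriv ℝ 1 u x‖ ≤ 11 * A + L ∧ ‖iteratedFDeriv ℝ 2 u x‖ ≤ 11 * A + 2 * L := by
  have hA0 : 0 ≤ A := (norm_nonneg _).trans (hA x)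
  have hL0 : 0 ≤ L := (norm_nonneg _).trans (hL x 0 (by simp))
  -- The bound B serves only to make S finite. The second derivative is at most S + L/2, so S ≤ 8A +
  -- (S + L/2)/4, and S on the right is absorbed; B disappears from the conclusion.
  set S := ⨆ x, ‖iteratedFDeriv ℝ 1 u x‖ with hS
  have hbdd : BddAbove (range fun x => ‖iteratedFDeriv ℝ 1 u x‖) := by
    refine ⟨B, ?_⟩
    rintro _ ⟨y, rfl⟩
    exact hB y
  have h1 : ∀ y, ‖iteratedFDeriv ℝ 1 u y‖ ≤ S := fun y => le_ciSup hbdd y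
  have h2 := norm_iteratedFDeriv_succ_le_of_second_diff (k := 1) hu h1 hL
  have h3 : S ≤ 8 * A + (S + L / 2) / 4 := by
    have : Nonempty E := ⟨x⟩
    exact ciSup_le fun y => norm_iteratedFDeriv_one_le hu hA h2 y
  have h4 := h1 x
  have h5 : ‖iteratedFDeriv ℝ 2 u x‖ ≤ S + L / 2 := h2 x
  constructor <;> linarith

end Differences

/-! ### From operator norms of derivatives to Hölder and Zygmund norms -/

section Norms

variable {n : ℕ}

/-- Coordinate vectors have length at most 1, so estimates in operator norm pass to every partial
derivative without a constant. -/
theorem norm_apply_single_le {k : ℕ} (T : EuclideanSpace ℝ (Fin n) [×k]→L[ℝ] ℝ) (γ : Fin k → Fin n) :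
    ‖T (fun j => EuclideanSpace.single (γ j) (1 : ℝ))‖ ≤ ‖T‖ := by
  simpa using T.le_opNorm (fun j => EuclideanSpace.single (γ j) (1 : ℝ))

theorem partialD_zero (γ : Fin 0 → Fin n) (u : EuclideanSpace ℝ (Fin n) → ℝ) :
    partialD γ u = u := rfl

theorem eLpNorm_top_le_ofReal {u : EuclideanSpace ℝ (Fin n) → ℝ} {c : ℝ} (h : ∀ x, ‖u x‖ ≤ c) :
    eLpNorm u ∞ volume ≤ ENNReal.ofReal c := by
  rw [eLpNorm_exponent_top]
  exact eLpNormEssSup_le_of_ae_bound (Eventually.of_forall h)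

theorem ckNorm_le {k : ℕ} {u : EuclideanSpace ℝ (Fin n) → ℝ} {c : ℝ}
    (h : ∀ j ≤ k, ∀ x, ‖iteratedFDeriv ℝ j u x‖ ≤ c) :
    ckNorm k u ≤ (k + 1 : ℕ) * ENNReal.ofReal c := by
  unfold ckNorm
  refine (Finset.sum_le_card_nsmul _ _ (ENNReal.ofReal c) fun j hj => iSup_le fun γ =>
    eLpNorm_top_le_ofReal fun x => (norm_apply_single_le _ γ).trans ?_).trans (by simp)
  exact h j (by simpa [Nat.lt_succ_iff] using hj) x

theorem holderWith_partialD {k : ℕ} {β : ℝ} (hβ : 0 < β) {u : EuclideanSpace ℝ (Fin n) → ℝ}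
    {c : ℝ} (h : ∀ x y, ‖iteratedFDeriv ℝ k u x - iteratedFDeriv ℝ k u y‖ ≤ c * ‖x - y‖ ^ β)
    (γ : Fin k → Fin n) : HolderWith c.toNNReal β.toNNReal (partialD γ u) := by
  intro x y
  have h1 : ‖partialD γ u x - partialD γ u y‖ ≤ c * ‖x - y‖ ^ β :=
    (norm_apply_single_le (iteratedFDeriv ℝ k u x - iteratedFDeriv ℝ k u y) γ).trans (h x y)
  rw [edist_eq_enorm_sub, edist_eq_enorm_sub, Real.coe_toNNReal _ hβ.le, ← ofReal_norm,
    ← ofReal_norm, ENNReal.ofReal_rpow_of_nonneg (norm_nonneg _) hβ.le]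
  change _ ≤ ENNReal.ofReal c * _
  rw [← ENNReal.ofReal_mul' (by positivity)]
  exact ENNReal.ofReal_le_ofReal h1

theorem holderNorm_le {k : ℕ} {β : ℝ} (hβ : 0 < β) {u : EuclideanSpace ℝ (Fin n) → ℝ} {c : ℝ}
    (h : ∀ j ≤ k, ∀ x, ‖iteratedFDeriv ℝ j u x‖ ≤ c)
    (h' : ∀ x y, ‖iteratedFDeriv ℝ k u x - iteratedFDeriv ℝ k u y‖ ≤ c * ‖x - y‖ ^ β) :
    holderNorm k β u ≤ (k + 2 : ℕ) * ENNReal.ofReal c := by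
  unfold holderNorm
  have h2 : (⨆ γ : Fin k → Fin n, eHolderNorm β.toNNReal (partialD γ u)) ≤ ENNReal.ofReal c :=
    iSup_le fun γ => (holderWith_partialD hβ h' γ).eHolderNorm_le
  calc _ ≤ (k + 1 : ℕ) * ENNReal.ofReal c + ENNReal.ofReal c := add_le_add (ckNorm_le h) h2
    _ = _ := by push_cast; ring

theorem zygmundNorm_le {k : ℕ} {u : EuclideanSpace ℝ (Fin n) → ℝ} {c : ℝ}
    (h : ∀ j ≤ k, ∀ x, ‖iteratedFDeriv ℝ j u x‖ ≤ c)
    (h' : ∀ x h, ‖iteratedFDeriv ℝ k u (x + h) + iteratedFDeriv ℝ k u (x - h) -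
      (2 : ℝ) • iteratedFDeriv ℝ k u x‖ ≤ c * ‖h‖) :
    zygmundNorm (k + 1) u ≤ (k + 2 : ℕ) * ENNReal.ofReal c := by
  unfold zygmundNorm
  have h2 : (⨆ γ : Fin k → Fin n, zygmundSeminorm (partialD γ u)) ≤ ENNReal.ofReal c := by
    refine iSup_le fun γ => iSup_le fun x => iSup_le fun y => ENNReal.div_le_of_le_mul ?_
    have h1 : ‖partialD γ u (x + y) + partialD γ u (x - y) - 2 * partialD γ u x‖ ≤ c * ‖y‖ :=
      (norm_apply_single_le (iteratedFDeriv ℝ k u (x + y) + iteratedFDeriv ℝ k u (x - y) -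
        (2 : ℝ) • iteratedFDeriv ℝ k u x) γ).trans (h' x y)
    rw [← ofReal_norm, ← ofReal_norm y, ← ENNReal.ofReal_mul' (by positivity)]
    exact ENNReal.ofReal_le_ofReal h1
  calc _ ≤ (k + 1 : ℕ) * ENNReal.ofReal c + ENNReal.ofReal c := add_le_add (ckNorm_le h) h2
    _ = _ := by push_cast; ring

/-- A continuous function is bounded everywhere by its essential supremum. -/
theorem norm_le_toReal_eLpNorm_top {u : EuclideanSpace ℝ (Fin n) → ℝ} (hu : Continuous u)
    (hfin : eLpNorm u ∞ volume ≠ ∞) (x : EuclideanSpace ℝ (Fin n)) :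
    ‖u x‖ ≤ (eLpNorm u ∞ volume).toReal := by
  have h1 : ∀ᵐ y ∂(volume : Measure (EuclideanSpace ℝ (Fin n))),
      ‖u y‖ ≤ (eLpNorm u ∞ volume).toReal := by
    filter_upwards [ae_le_eLpNormEssSup (f := u) (μ := volume)] with y hy
    rw [← eLpNorm_exponent_top] at hy
    rw [← toReal_enorm]
    exact ENNReal.toReal_mono hfin hy
  have h2 : IsClosed {y | ‖u y‖ ≤ (eLpNorm u ∞ volume).toReal} :=
    isClosed_le hu.norm continuous_const
  have h3 := (Measure.dense_of_ae h1).closure_eq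
  rw [h2.closure_eq] at h3
  exact (h3 ▸ mem_univ x : x ∈ {y | ‖u y‖ ≤ (eLpNorm u ∞ volume).toReal})

/-- Members of `C^{0,α}` are bounded and Hölder continuous by their norm. -/
theorem MemHolderSpace.bounds {α : ℝ} (hα : 0 < α) {f : EuclideanSpace ℝ (Fin n) → ℝ}
    (hf : MemHolderSpace 0 α f) : (∀ x, |f x| ≤ (holderNorm 0 α f).toReal) ∧
      ∀ x y, |f x - f y| ≤ (holderNorm 0 α f).toReal * ‖x - y‖ ^ α := by
  have hfin := hf.2.ne
  have e : holderNorm 0 α f = eLpNorm f ∞ volume + eHolderNorm α.toNNReal f := by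
    simp [holderNorm, ckNorm, partialD_zero]
  have h1 : eLpNorm f ∞ volume ≤ holderNorm 0 α f := e ▸ le_self_add
  have h2 : eHolderNorm α.toNNReal f ≤ holderNorm 0 α f := e ▸ le_add_self
  refine ⟨fun x => ?_, fun x y => ?_⟩
  · exact (norm_le_toReal_eLpNorm_top hf.1.continuous (ne_top_of_le_ne_top hfin h1) x).trans
      (ENNReal.toReal_mono hfin h1)
  · have h3 : MemHolder α.toNNReal f := eHolderNorm_ne_top.1 (ne_top_of_le_ne_top hfin h2)
    have h4 := h3.holderWith.dist_le x y
    rw [Real.coe_toNNReal _ hα.le, dist_eq_norm, dist_eq_norm, Real.norm_eq_abs] at h4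
    refine h4.trans (mul_le_mul_of_nonneg_right ?_ (by positivity))
    exact ENNReal.toReal_mono hfin h2

end Norms

/-! ### Gaussian estimates -/

section HeatKernel

variable {n : ℕ}

theorem heatKernel_nonneg {t : ℝ} (ht : 0 < t) (x : EuclideanSpace ℝ (Fin n)) :
    0 ≤ heatKernel t x := by
  have := Real.pi_pos
  unfold heatKernel
  positivity

theorem heatKernel_eq {t : ℝ} (ht : 0 < t) (x : EuclideanSpace ℝ (Fin n)) :
    heatKernel t x = (4 * Real.pi * t) ^ (-((n : ℝ) / 2)) * Real.exp (-‖x‖ ^ 2 / (4 * t)) := by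
  have := Real.pi_pos
  rw [heatKernel, Real.rpow_neg (by positivity), one_div]

theorem heatKernel_le {t : ℝ} (ht : 0 < t) (x : EuclideanSpace ℝ (Fin n)) :
    heatKernel t x ≤ (4 * Real.pi * t) ^ (-((n : ℝ) / 2)) := by
  have := Real.pi_pos
  rw [heatKernel_eq ht]
  refine mul_le_of_le_one_right (by positivity) (Real.exp_le_one_iff.2 ?_)
  rw [neg_div, neg_nonpos]
  positivity

theorem heatKernel_neg (t : ℝ) (x : EuclideanSpace ℝ (Fin n)) :
    heatKernel t (-x) = heatKernel t x := by
  simp [heatKernel]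

theorem measurable_heatKernel_uncurry :
    Measurable fun p : ℝ × EuclideanSpace ℝ (Fin n) => heatKernel p.1 p.2 := by
  unfold heatKernel
  fun_prop

theorem contDiff_heatKernel {t : ℝ} {N : WithTop ℕ∞} :
    ContDiff ℝ N (heatKernel t : EuclideanSpace ℝ (Fin n) → ℝ) := by
  unfold heatKernel
  exact contDiff_const.mul (((contDiff_norm_sq ℝ).neg.div_const _).exp)

theorem continuous_heatKernel {t : ℝ} :
    Continuous (heatKernel t : EuclideanSpace ℝ (Fin n) → ℝ) :=
  (contDiff_heatKernel (N := 0)).continuous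

theorem integral_heatKernel {t : ℝ} (ht : 0 < t) :
    ∫ x : EuclideanSpace ℝ (Fin n), heatKernel t x = 1 := by
  have hpi := Real.pi_pos
  have h := GaussianFourier.integral_rexp_neg_mul_sq_norm (V := EuclideanSpace ℝ (Fin n))
    (b := 1 / (4 * t)) (by positivity)
  simp only [heatKernel_eq ht]
  rw [integral_const_mul]
  have e : ∀ x : EuclideanSpace ℝ (Fin n), Real.exp (-‖x‖ ^ 2 / (4 * t)) =
      Real.exp (-(1 / (4 * t)) * ‖x‖ ^ 2) := fun x => by congr 1; ring
  simp only [e]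
  rw [h, finrank_euclideanSpace, Fintype.card_fin, Real.rpow_neg (by positivity),
    show Real.pi / (1 / (4 * t)) = 4 * Real.pi * t by field_simp]
  exact inv_mul_cancel₀ (by positivity)

theorem integrable_heatKernel {t : ℝ} (ht : 0 < t) :
    Integrable (heatKernel t : EuclideanSpace ℝ (Fin n) → ℝ) :=
  Integrable.of_integral_ne_zero (by rw [integral_heatKernel ht]; exact one_ne_zero)

/-- Completing the square in z. The last factor is a translated heat kernel, so integrating in z
gives the semigroup law. -/
theorem heatKernel_mul_heatKernel {t τ : ℝ} (ht : 0 < t) (hτ : 0 < τ)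
    (x z : EuclideanSpace ℝ (Fin n)) :
    heatKernel t (x - z) * heatKernel τ z =
      heatKernel (t + τ) x * heatKernel (t * τ / (t + τ)) (z - (τ / (t + τ)) • x) := by
  have hpi := Real.pi_pos
  have h1 : 0 < t + τ := by positivity
  have h2 : 0 < t * τ / (t + τ) := by positivity
  rw [heatKernel_eq ht, heatKernel_eq hτ, heatKernel_eq h1, heatKernel_eq h2,
    mul_mul_mul_comm, mul_mul_mul_comm ((4 * Real.pi * (t + τ)) ^ _), ← Real.exp_add, ← Real.exp_add,
    ← Real.mul_rpow (by positivity) (by positivity), ← Real.mul_rpow (by positivity) (by positivity)]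
  have e : ‖x - z‖ ^ 2 = ‖x‖ ^ 2 - 2 * inner ℝ x z + ‖z‖ ^ 2 := norm_sub_sq_real x z
  have e' : ‖z - (τ / (t + τ)) • x‖ ^ 2 =
      ‖z‖ ^ 2 - 2 * ((τ / (t + τ)) * inner ℝ x z) + (τ / (t + τ)) ^ 2 * ‖x‖ ^ 2 := by
    rw [norm_sub_sq_real, inner_smul_right, norm_smul, mul_pow, real_inner_comm,
      Real.norm_eq_abs, sq_abs]
  rw [e, e']
  congr 2
  · field_simp
  · field_simp
    ring

theorem integral_heatKernel_mul_heatKernel {t τ : ℝ} (ht : 0 < t) (hτ : 0 < τ)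
    (x : EuclideanSpace ℝ (Fin n)) :
    ∫ z, heatKernel t (x - z) * heatKernel τ z = heatKernel (t + τ) x := by
  simp only [heatKernel_mul_heatKernel ht hτ]
  rw [integral_const_mul, integral_sub_right_eq_self (fun z => heatKernel (t * τ / (t + τ)) z),
    integral_heatKernel (by positivity), mul_one]

/-- The exponent is quadratic: its gradient is linear, its Hessian constant, and the rest vanishes.
The common geometric bound in i is the shape required by the estimate for derivatives of a
composition. -/
theorem norm_iteratedFDeriv_neg_sq_div_le {t : ℝ} (ht : 0 < t) (x : EuclideanSpace ℝ (Fin n))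
    {i : ℕ} (hi : 1 ≤ i) :
    ‖iteratedFDeriv ℝ i (fun y : EuclideanSpace ℝ (Fin n) => -‖y‖ ^ 2 / (4 * t)) x‖ ≤
      ((1 + ‖x‖ / √t) / √t) ^ i := by
  obtain ⟨i, rfl⟩ := Nat.exists_eq_add_of_le' hi
  have hs : 0 < √t := Real.sqrt_pos.2 ht
  have hst : √t * √t = t := Real.mul_self_sqrt ht.le
  have hf : fderiv ℝ (fun y : EuclideanSpace ℝ (Fin n) => -‖y‖ ^ 2 / (4 * t)) =
      fun y => (-(1 / (2 * t)) • innerSL ℝ : EuclideanSpace ℝ (Fin n) →L[ℝ]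
        EuclideanSpace ℝ (Fin n) →L[ℝ] ℝ) y := by
    funext y
    have e : (fun y : EuclideanSpace ℝ (Fin n) => -‖y‖ ^ 2 / (4 * t)) =
        fun y => (-(1 / (4 * t))) • ‖y‖ ^ 2 := by
      funext y; rw [smul_eq_mul]; ring
    rw [e, fderiv_fun_const_smul (contDiff_norm_sq ℝ (n := 1)).differentiable_one.differentiableAt,
      fderiv_norm_sq_apply]
    ext v
    simp
    field_simp
    ring
  have hL : ‖(-(1 / (2 * t)) • innerSL ℝ : EuclideanSpace ℝ (Fin n) →L[ℝ]
        EuclideanSpace ℝ (Fin n) →L[ℝ] ℝ)‖ ≤ 1 / (2 * t) := by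
    refine ContinuousLinearMap.opNorm_le_bound _ (by positivity) fun v => ?_
    change ‖-(1 / (2 * t)) • innerSL ℝ v‖ ≤ _
    rw [norm_smul, norm_neg, Real.norm_of_nonneg (by positivity), innerSL_apply_norm]
  rw [← norm_iteratedFDeriv_fderiv, hf]
  rcases i with _ | _ | i
  · rw [norm_iteratedFDeriv_zero, zero_add, pow_one]
    refine (ContinuousLinearMap.le_opNorm _ _).trans
      ((mul_le_mul_of_nonneg_right hL (norm_nonneg _)).trans ?_)
    rw [add_div, div_div, hst]
    have h1 : 1 / (2 * t) * ‖x‖ ≤ ‖x‖ / t := by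
      rw [one_div_mul_eq_div]
      exact div_le_div_of_nonneg_left (norm_nonneg _) ht (by linarith)
    have : 0 ≤ 1 / √t := by positivity
    linarith
  · rw [zero_add, norm_iteratedFDeriv_one, ContinuousLinearMap.fderiv]
    refine hL.trans ?_
    have h1 : 1 / √t ≤ (1 + ‖x‖ / √t) / √t := by
      refine div_le_div_of_nonneg_right ?_ hs.le
      have : 0 ≤ ‖x‖ / √t := by positivity
      linarith
    calc 1 / (2 * t) ≤ 1 / t := one_div_le_one_div_of_le ht (by linarith)
      _ = (1 / √t) ^ 2 := by rw [div_pow, one_pow, Real.sq_sqrt ht.le]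
      _ ≤ _ := pow_le_pow_left₀ (by positivity) h1 2
  · rw [← norm_iteratedFDeriv_fderiv]
    have e : fderiv ℝ (fun y => (-(1 / (2 * t)) • innerSL ℝ : EuclideanSpace ℝ (Fin n) →L[ℝ]
        EuclideanSpace ℝ (Fin n) →L[ℝ] ℝ) y) = fun _ => (-(1 / (2 * t)) • innerSL ℝ) := by
      funext y
      exact ContinuousLinearMap.fderiv _
    rw [e, iteratedFDeriv_succ_const]
    simp only [Pi.zero_apply, norm_zero]
    positivity

/-- Every derivative of exp is exp, so the composition estimate returns the kernel itself times k!
and the polynomial factor of the exponent. -/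
theorem norm_iteratedFDeriv_heatKernel_le {t : ℝ} (ht : 0 < t) (k : ℕ)
    (x : EuclideanSpace ℝ (Fin n)) :
    ‖iteratedFDeriv ℝ k (heatKernel t) x‖ ≤
      k.factorial * heatKernel t x * ((1 + ‖x‖ / √t) / √t) ^ k := by
  have hpi := Real.pi_pos
  have e : (heatKernel t : EuclideanSpace ℝ (Fin n) → ℝ) =
      ((4 * Real.pi * t) ^ (-((n : ℝ) / 2))) •
        (Real.exp ∘ fun y : EuclideanSpace ℝ (Fin n) => -‖y‖ ^ 2 / (4 * t)) := by
    funext y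
    rw [heatKernel_eq ht]; rfl
  have hc : ContDiff ℝ k (fun y : EuclideanSpace ℝ (Fin n) => -‖y‖ ^ 2 / (4 * t)) :=
    (contDiff_norm_sq ℝ).neg.div_const _
  rw [e, iteratedFDeriv_const_smul_apply (Real.contDiff_exp.comp hc).contDiffAt, norm_smul,
    Real.norm_of_nonneg (by positivity)]
  have h := norm_iteratedFDeriv_comp_le Real.contDiff_exp hc le_rfl x
    (C := Real.exp (-‖x‖ ^ 2 / (4 * t))) (D := (1 + ‖x‖ / √t) / √t)
    (fun i _ => by
      rw [norm_iteratedFDeriv_eq_norm_iteratedDeriv, iteratedDeriv_eq_iterate, Real.iter_deriv_exp,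
        Real.norm_of_nonneg (Real.exp_pos _).le])
    (fun i hi _ => norm_iteratedFDeriv_neg_sq_div_le ht x hi)
  calc _ ≤ (4 * Real.pi * t) ^ (-((n : ℝ) / 2)) * _ := mul_le_mul_of_nonneg_left h (by positivity)
    _ = _ := by simp only [Pi.smul_apply, Function.comp_apply, smul_eq_mul]; ring

/-- Since 1 + r ≤ e^r, it suffices that pr - r²/8 ≤ 2p², which is (r - 4p)² ≥ 0. Half of the
Gaussian thus pays for any polynomial weight. -/
theorem one_add_rpow_mul_exp_le {p r : ℝ} (hp : 0 ≤ p) (hr : 0 ≤ r) :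
    (1 + r) ^ p * Real.exp (-r ^ 2 / 8) ≤ Real.exp (2 * p ^ 2) := by
  have h1 : (1 + r) ^ p ≤ Real.exp r ^ p :=
    Real.rpow_le_rpow (by positivity) (by linarith [Real.add_one_le_exp r]) hp
  rw [← Real.exp_mul] at h1
  refine (mul_le_mul_of_nonneg_right h1 (Real.exp_pos _).le).trans ?_
  rw [← Real.exp_add]
  refine Real.exp_le_exp.2 ?_
  nlinarith [sq_nonneg (r - 4 * p)]

/-- Weighted Gaussian bounds for the derivatives of the heat kernel. -/
theorem exists_rpow_mul_norm_iteratedFDeriv_heatKernel_le (n k : ℕ) {a : ℝ} (ha : 0 ≤ a) :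
    ∃ C : ℝ, 0 < C ∧ ∀ t : ℝ, 0 < t → ∀ x : EuclideanSpace ℝ (Fin n),
      ‖x‖ ^ a * ‖iteratedFDeriv ℝ k (heatKernel t) x‖ ≤
        C * t ^ ((a - k) / 2) * heatKernel (2 * t) x := by
  -- With r = |x|/√t, one has G_t = 2^(n/2) e^(-r²/8) G_{2t}. The factorial is that of the
  -- composition estimate, and the exponential bounds the weight (1 + r)^(a+k) against e^(-r²/8).
  refine ⟨k.factorial * 2 ^ ((n : ℝ) / 2) * Real.exp (2 * (a + k) ^ 2), by positivity,
    fun t ht x => ?_⟩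
  have hpi := Real.pi_pos
  have hs : 0 < √t := Real.sqrt_pos.2 ht
  set r := ‖x‖ / √t with hr
  have hr0 : 0 ≤ r := by positivity
  have hx : ‖x‖ = √t * r := by rw [hr]; field_simp
  have e1 : heatKernel t x = 2 ^ ((n : ℝ) / 2) * Real.exp (-r ^ 2 / 8) * heatKernel (2 * t) x := by
    rw [heatKernel_eq ht, heatKernel_eq (by positivity : 0 < 2 * t),
      show 4 * Real.pi * (2 * t) = 2 * (4 * Real.pi * t) by ring,
      Real.mul_rpow (x := 2) (y := 4 * Real.pi * t) (by norm_num) (by positivity), Real.rpow_neg (by norm_num : (0 : ℝ) ≤ 2)]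
    have e2 : Real.exp (-‖x‖ ^ 2 / (4 * t)) =
        Real.exp (-r ^ 2 / 8) * Real.exp (-‖x‖ ^ 2 / (4 * (2 * t))) := by
      rw [← Real.exp_add, hx, mul_pow, Real.sq_sqrt ht.le]
      congr 1
      field_simp
      ring
    rw [e2]
    field_simp
  have e3 : ‖x‖ ^ a * (1 / √t) ^ k = t ^ ((a - k) / 2) * r ^ a := by
    rw [hx, Real.mul_rpow hs.le hr0, Real.sqrt_eq_rpow, one_div (_ ^ _), inv_pow, ← Real.rpow_natCast,
      ← Real.rpow_mul ht.le, ← Real.rpow_mul ht.le, ← Real.rpow_neg ht.le,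
      mul_right_comm, ← Real.rpow_add ht]
    congr 2
    ring
  have h2 : r ^ a ≤ (1 + r) ^ a := Real.rpow_le_rpow hr0 (by linarith) ha
  have h3 : r ^ a * (1 + r) ^ k * Real.exp (-r ^ 2 / 8) ≤ Real.exp (2 * (a + k) ^ 2) := by
    refine le_trans ?_ (one_add_rpow_mul_exp_le (by positivity : 0 ≤ a + k) hr0)
    rw [Real.rpow_add (by positivity), Real.rpow_natCast]
    gcongr
  calc ‖x‖ ^ a * ‖iteratedFDeriv ℝ k (heatKernel t) x‖
      ≤ ‖x‖ ^ a * (k.factorial * heatKernel t x * ((1 + r) / √t) ^ k) :=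
        mul_le_mul_of_nonneg_left (norm_iteratedFDeriv_heatKernel_le ht k x) (by positivity)
    _ = k.factorial * heatKernel t x * (1 + r) ^ k * (‖x‖ ^ a * (1 / √t) ^ k) := by
        rw [div_pow, div_pow, one_pow]; ring
    _ = k.factorial * 2 ^ ((n : ℝ) / 2) * (r ^ a * (1 + r) ^ k * Real.exp (-r ^ 2 / 8)) *
          t ^ ((a - k) / 2) * heatKernel (2 * t) x := by rw [e3, e1]; ring
    _ ≤ _ := by
        have := heatKernel_nonneg (by positivity : 0 < 2 * t) x
        gcongr

theorem integrable_iteratedFDeriv_heatKernel {t : ℝ} (ht : 0 < t) (k : ℕ) :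
    Integrable (iteratedFDeriv ℝ k (heatKernel t : EuclideanSpace ℝ (Fin n) → ℝ)) := by
  obtain ⟨C, hC, h⟩ := exists_rpow_mul_norm_iteratedFDeriv_heatKernel_le n k le_rfl
  refine ((integrable_heatKernel (by positivity : 0 < 2 * t)).const_mul
    (C * t ^ (((0 : ℝ) - k) / 2))).mono' ?_ (Eventually.of_forall fun x => ?_)
  · exact (contDiff_heatKernel.continuous_iteratedFDeriv le_rfl).aestronglyMeasurable
  · simpa using h t ht x

/-- Integration by parts against the constant 1. This cancellation is what turns Hölder regularity
of f into a gain of t^(α/2). -/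
theorem integral_iteratedFDeriv_heatKernel {t : ℝ} (ht : 0 < t) (k : ℕ) :
    ∫ x, iteratedFDeriv ℝ (k + 1) (heatKernel t : EuclideanSpace ℝ (Fin n) → ℝ) x = 0 := by
  ext m
  rw [ContinuousMultilinearMap.integral_apply (integrable_iteratedFDeriv_heatKernel ht _)]
  set g : EuclideanSpace ℝ (Fin n) → ℝ := fun x => iteratedFDeriv ℝ k (heatKernel t) x (Fin.tail m)
    with hg
  have hd : Differentiable ℝ (iteratedFDeriv ℝ k (heatKernel t : EuclideanSpace ℝ (Fin n) → ℝ)) :=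
    (contDiff_heatKernel (N := (k + 1 : ℕ))).differentiable_iteratedFDeriv
      (by exact_mod_cast k.lt_succ_self)
  have hg' : ∀ x, HasFDerivAt g ((ContinuousMultilinearMap.apply ℝ _ ℝ (Fin.tail m)).comp
      (fderiv ℝ (iteratedFDeriv ℝ k (heatKernel t)) x)) x := fun x =>
    (ContinuousMultilinearMap.apply ℝ (fun _ : Fin k => EuclideanSpace ℝ (Fin n)) ℝ
      (Fin.tail m)).hasFDerivAt.comp x (hd x).hasFDerivAt
  have e : ∀ x, iteratedFDeriv ℝ (k + 1) (heatKernel t) x m = fderiv ℝ g x (m 0) := by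
    intro x
    rw [(hg' x).fderiv, iteratedFDeriv_succ_apply_left]
    rfl
  have h1 : Integrable fun x => fderiv ℝ g x (m 0) := by
    simp only [← e]
    refine ((integrable_iteratedFDeriv_heatKernel ht (k + 1)).norm.mul_const (∏ i, ‖m i‖)).mono' ?_
      (Eventually.of_forall fun x => ContinuousMultilinearMap.le_opNorm _ _)
    have hc : Continuous fun x => iteratedFDeriv ℝ (k + 1)
        (heatKernel t : EuclideanSpace ℝ (Fin n) → ℝ) x :=
      contDiff_heatKernel.continuous_iteratedFDeriv le_rfl
    exact ((ContinuousMultilinearMap.apply ℝ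
      (fun _ : Fin (k + 1) => EuclideanSpace ℝ (Fin n)) ℝ m).continuous.comp hc).aestronglyMeasurable
  have h2 : Integrable g := by
    refine ((integrable_iteratedFDeriv_heatKernel ht k).norm.mul_const
      (∏ i, ‖Fin.tail m i‖)).mono' ?_
      (Eventually.of_forall fun x => ContinuousMultilinearMap.le_opNorm _ _)
    exact (Differentiable.continuous fun x => (hg' x).differentiableAt).aestronglyMeasurable
  simp only [e]
  have h3 := integral_mul_fderiv_eq_neg_fderiv_mul_of_integrable (𝕜 := ℝ) (μ := volume)
    (f := fun _ : EuclideanSpace ℝ (Fin n) => (1 : ℝ)) (g := g) (v := m 0)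
    (by simp) (by simpa using h1) (by simpa using h2) (fun x _ => differentiableAt_const _)
    (fun x _ => (hg' x).differentiableAt)
  simpa using h3

end HeatKernel

/-! ### The heat semigroup: smoothing, semigroup law, limits -/

section HeatSemigroup

variable {n : ℕ}

theorem iteratedFDeriv_heatKernel_sub_mul (t c : ℝ) (k : ℕ) (z x : EuclideanSpace ℝ (Fin n)) :
    iteratedFDeriv ℝ k (fun y => heatKernel t (y - z) * c) x =
      c • iteratedFDeriv ℝ k (heatKernel t) (x - z) := by
  have e : (fun y => heatKernel t (y - z) * c) = c • fun y => heatKernel t (y - z) := by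
    funext y; simp [mul_comm]
  rw [e, iteratedFDeriv_const_smul_apply, iteratedFDeriv_comp_sub]
  exact (contDiff_heatKernel.comp (contDiff_id.sub contDiff_const)).contDiffAt

theorem exists_norm_iteratedFDeriv_heatKernel_le (n k : ℕ) :
    ∃ C : ℝ, 0 < C ∧ ∀ t : ℝ, 0 < t → ∀ x : EuclideanSpace ℝ (Fin n),
      ‖iteratedFDeriv ℝ k (heatKernel t) x‖ ≤ C * t ^ (-((n : ℝ) + k) / 2) := by
  have hpi := Real.pi_pos
  obtain ⟨C, hC, h⟩ := exists_rpow_mul_norm_iteratedFDeriv_heatKernel_le n k le_rfl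
  refine ⟨C * (8 * Real.pi) ^ (-((n : ℝ) / 2)), by positivity, fun t ht x => ?_⟩
  have h1 := h t ht x
  rw [Real.rpow_zero, one_mul] at h1
  refine h1.trans ((mul_le_mul_of_nonneg_left (heatKernel_le (by positivity) x)
    (by positivity)).trans_eq ?_)
  rw [show 4 * Real.pi * (2 * t) = 8 * Real.pi * t by ring,
    Real.mul_rpow (x := 8 * Real.pi) (by positivity) ht.le,
    show -((n : ℝ) + k) / 2 = (0 - k) / 2 + -((n : ℝ) / 2) by ring, Real.rpow_add ht]
  ring

theorem contDiff_heatSemigroup {t : ℝ} (ht : 0 < t) {f : EuclideanSpace ℝ (Fin n) → ℝ}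
    (hf : Integrable f) (N : ℕ) : ContDiff ℝ N (heatSemigroup t f) ∧
      ∀ k ≤ N, ∀ x, iteratedFDeriv ℝ k (heatSemigroup t f) x =
        ∫ z, f z • iteratedFDeriv ℝ k (heatKernel t) (x - z) := by
  choose C _ h using exists_norm_iteratedFDeriv_heatKernel_le n
  have h1 : ∀ᵐ z : EuclideanSpace ℝ (Fin n), ContDiff ℝ N fun x => heatKernel t (x - z) * f z :=
    Eventually.of_forall fun z =>
      (contDiff_heatKernel.comp (contDiff_id.sub contDiff_const)).mul contDiff_const
  have h2 : ∀ x : EuclideanSpace ℝ (Fin n),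
      AEStronglyMeasurable (fun z => heatKernel t (x - z) * f z) volume := fun x =>
    ((continuous_heatKernel.comp (continuous_const.sub continuous_id)).aestronglyMeasurable).mul
      hf.aestronglyMeasurable
  have h3 : ∀ k ≤ N, Integrable fun z => C k * t ^ (-((n : ℝ) + k) / 2) * ‖f z‖ := fun k _ =>
    hf.norm.const_mul _
  have h4 : ∀ k ≤ N, ∀ᵐ z : EuclideanSpace ℝ (Fin n), ∀ x,
      ‖iteratedFDeriv ℝ k (fun x => heatKernel t (x - z) * f z) x‖ ≤
        C k * t ^ (-((n : ℝ) + k) / 2) * ‖f z‖ := fun k _ => Eventually.of_forall fun z x => by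
    rw [iteratedFDeriv_heatKernel_sub_mul, norm_smul, mul_comm]
    exact mul_le_mul_of_nonneg_right (h k t ht _) (norm_nonneg _)
  refine ⟨contDiff_integral h1 h2 h3 h4, fun k hk x => ?_⟩
  simp only [← iteratedFDeriv_heatKernel_sub_mul]
  exact iteratedFDeriv_integral h1 h2 h3 h4 hk x

/-- Decay for large t. Because ‖f‖_{L¹} is not controlled by the Hölder norm alone, this bound is
reserved for convergence and finiteness. -/
theorem exists_norm_iteratedFDeriv_heatSemigroup_le (n k : ℕ) :
    ∃ C : ℝ, 0 < C ∧ ∀ f : EuclideanSpace ℝ (Fin n) → ℝ, Integrable f → ∀ t : ℝ, 0 < t → ∀ x,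
      ‖iteratedFDeriv ℝ k (heatSemigroup t f) x‖ ≤
        C * t ^ (-((n : ℝ) + k) / 2) * ∫ z, ‖f z‖ := by
  obtain ⟨C, hC, h⟩ := exists_norm_iteratedFDeriv_heatKernel_le n k
  refine ⟨C, hC, fun f hf t ht x => ?_⟩
  rw [(contDiff_heatSemigroup ht hf k).2 k le_rfl, ← integral_const_mul]
  refine norm_integral_le_of_norm_le (hf.norm.const_mul _) (Eventually.of_forall fun z => ?_)
  rw [norm_smul, mul_comm]
  exact mul_le_mul_of_nonneg_right (h t ht _) (norm_nonneg _)

/-- Compactly supported functions that are bounded by `H` and `α`-Hölder continuous with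
constant `H`. -/
structure IsCompactHolder (α H : ℝ) (f : EuclideanSpace ℝ (Fin n) → ℝ) : Prop where
  continuous : Continuous f
  hasCompactSupport : HasCompactSupport f
  nonneg : 0 ≤ H
  bound : ∀ x, |f x| ≤ H
  holder : ∀ x y, |f x - f y| ≤ H * ‖x - y‖ ^ α

theorem IsCompactHolder.integrable {α H : ℝ} {f : EuclideanSpace ℝ (Fin n) → ℝ}
    (hf : IsCompactHolder α H f) : Integrable f :=
  hf.continuous.integrable_of_hasCompactSupport hf.hasCompactSupport

/-- The smoothing estimate for the heat semigroup on Hölder functions. -/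
theorem exists_norm_iteratedFDeriv_heatSemigroup_le_of_holder (n k : ℕ) {α : ℝ} (hα : 0 < α) :
    ∃ C : ℝ, 0 < C ∧ ∀ (f : EuclideanSpace ℝ (Fin n) → ℝ) (H : ℝ), IsCompactHolder α H f →
      ∀ t : ℝ, 0 < t → ∀ x,
      ‖iteratedFDeriv ℝ (k + 1) (heatSemigroup t f) x‖ ≤ C * H * t ^ ((α - (k + 1 : ℕ)) / 2) := by
  obtain ⟨C, hC, h⟩ := exists_rpow_mul_norm_iteratedFDeriv_heatKernel_le n (k + 1) hα.le
  refine ⟨C, hC, fun f H hfH t ht x => ?_⟩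
  have hH1 := hfH.nonneg
  have hf := hfH.integrable
  set K := iteratedFDeriv ℝ (k + 1) (heatKernel t : EuclideanSpace ℝ (Fin n) → ℝ) with hK
  have hKi : Integrable fun z => K (x - z) :=
    (integrable_iteratedFDeriv_heatKernel ht (k + 1)).comp_sub_left x
  have hK0 : ∫ z, K (x - z) = 0 := by
    rw [integral_sub_left_eq_self (fun z => K z), hK, integral_iteratedFDeriv_heatKernel ht]
  have h1 : Integrable fun z => f z • K (x - z) := by
    refine (hKi.norm.const_mul H).mono' (hf.aestronglyMeasurable.smul hKi.aestronglyMeasurable)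
      (Eventually.of_forall fun z => ?_)
    rw [norm_smul]
    exact mul_le_mul_of_nonneg_right (hfH.bound z) (norm_nonneg _)
  have h2 : Integrable fun z => f x • K (x - z) := hKi.smul (f x)
  -- The kernel has mean zero, so f(x) may be subtracted; the Hölder bound then supplies the weight
  -- |x - z|^α for the weighted Gaussian estimate.
  have e : iteratedFDeriv ℝ (k + 1) (heatSemigroup t f) x = ∫ z, (f z - f x) • K (x - z) := by
    simp only [sub_smul]
    rw [integral_sub h1 h2, integral_smul, hK0, smul_zero, sub_zero]
    exact (contDiff_heatSemigroup ht hf (k + 1)).2 _ le_rfl x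
  have hG : Integrable fun z : EuclideanSpace ℝ (Fin n) => heatKernel (2 * t) (x - z) :=
    (integrable_heatKernel (by positivity)).comp_sub_left x
  rw [e]
  calc ‖∫ z, (f z - f x) • K (x - z)‖
      ≤ ∫ z, C * H * t ^ ((α - (k + 1 : ℕ)) / 2) * heatKernel (2 * t) (x - z) := by
        refine norm_integral_le_of_norm_le (hG.const_mul _) (Eventually.of_forall fun z => ?_)
        have h2 := h t ht (x - z)
        have h3 := hfH.holder z x
        rw [norm_sub_rev] at h3
        rw [norm_smul, Real.norm_eq_abs]
        calc |f z - f x| * ‖K (x - z)‖ ≤ H * ‖x - z‖ ^ α * ‖K (x - z)‖ := by gcongr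
          _ = H * (‖x - z‖ ^ α * ‖K (x - z)‖) := by ring
          _ ≤ H * (C * t ^ ((α - (k + 1 : ℕ)) / 2) * heatKernel (2 * t) (x - z)) := by gcongr
          _ = _ := by ring
    _ = C * H * t ^ ((α - (k + 1 : ℕ)) / 2) := by
        rw [integral_const_mul, integral_sub_left_eq_self (fun z => heatKernel (2 * t) z),
          integral_heatKernel (by positivity), mul_one]

theorem heatSemigroup_eq_integral_sub (t : ℝ) (f : EuclideanSpace ℝ (Fin n) → ℝ)
    (x : EuclideanSpace ℝ (Fin n)) :
    heatSemigroup t f x = ∫ w, heatKernel t w * f (x - w) := by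
  have h := integral_sub_left_eq_self (fun w => heatKernel t w * f (x - w)) volume x
  simp only [sub_sub_cancel] at h
  exact h

theorem integrable_heatKernel_mul {t : ℝ} (ht : 0 < t) {g : EuclideanSpace ℝ (Fin n) → ℝ}
    (hg : AEStronglyMeasurable g volume) {M : ℝ} (hM : ∀ x, |g x| ≤ M) :
    Integrable fun w => heatKernel t w * g w :=
  (integrable_heatKernel ht).mul_bdd (c := M) hg (Eventually.of_forall hM)

theorem abs_integral_heatKernel_mul_le {t : ℝ} (ht : 0 < t) {g : EuclideanSpace ℝ (Fin n) → ℝ}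
    {M : ℝ} (hM : ∀ x, |g x| ≤ M) : |∫ w, heatKernel t w * g w| ≤ M := by
  have h := norm_integral_le_of_norm_le (f := fun w => heatKernel t w * g w)
    ((integrable_heatKernel (n := n) ht).mul_const M) (Eventually.of_forall fun w => by
      rw [norm_mul, Real.norm_of_nonneg (heatKernel_nonneg ht w)]
      exact mul_le_mul_of_nonneg_left (hM w) (heatKernel_nonneg ht w))
  rwa [integral_mul_const, integral_heatKernel ht, one_mul] at h

theorem abs_heatSemigroup_le {t : ℝ} (ht : 0 < t) {f : EuclideanSpace ℝ (Fin n) → ℝ} {M : ℝ}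
    (hM : ∀ x, |f x| ≤ M) (x : EuclideanSpace ℝ (Fin n)) : |heatSemigroup t f x| ≤ M := by
  rw [heatSemigroup_eq_integral_sub]
  exact abs_integral_heatKernel_mul_le ht fun w => hM _

/-- Averaging translates of f against a probability density preserves the Hölder seminorm. -/
theorem abs_heatSemigroup_sub_le {t : ℝ} (ht : 0 < t) {α H : ℝ}
    {f : EuclideanSpace ℝ (Fin n) → ℝ} (hf : IsCompactHolder α H f)
    (x y : EuclideanSpace ℝ (Fin n)) :
    |heatSemigroup t f x - heatSemigroup t f y| ≤ H * ‖x - y‖ ^ α := by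
  have h1 : ∀ x, Integrable fun w => heatKernel t w * f (x - w) := fun x =>
    integrable_heatKernel_mul ht
      (hf.continuous.comp (continuous_const.sub continuous_id)).aestronglyMeasurable
      fun w => hf.bound _
  rw [heatSemigroup_eq_integral_sub, heatSemigroup_eq_integral_sub, ← integral_sub (h1 x) (h1 y)]
  simp only [← mul_sub]
  refine abs_integral_heatKernel_mul_le ht fun w => ?_
  simpa using hf.holder (x - w) (y - w)

theorem exists_integral_heatKernel_mul_rpow_le (n : ℕ) {a : ℝ} (ha : 0 ≤ a) :
    ∃ C : ℝ, 0 < C ∧ ∀ t : ℝ, 0 < t →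
      Integrable (fun w : EuclideanSpace ℝ (Fin n) => heatKernel t w * ‖w‖ ^ a) ∧
      ∫ w : EuclideanSpace ℝ (Fin n), heatKernel t w * ‖w‖ ^ a ≤ C * t ^ (a / 2) := by
  obtain ⟨C, hC, h⟩ := exists_rpow_mul_norm_iteratedFDeriv_heatKernel_le n 0 ha
  refine ⟨C, hC, fun t ht => ?_⟩
  have hG : Integrable fun w : EuclideanSpace ℝ (Fin n) =>
      C * t ^ (a / 2) * heatKernel (2 * t) w :=
    (integrable_heatKernel (by positivity)).const_mul _
  have hb : ∀ w : EuclideanSpace ℝ (Fin n), heatKernel t w * ‖w‖ ^ a ≤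
      C * t ^ (a / 2) * heatKernel (2 * t) w := fun w => by
    have := h t ht w
    rwa [norm_iteratedFDeriv_zero, Real.norm_of_nonneg (heatKernel_nonneg ht w), mul_comm,
      Nat.cast_zero, sub_zero] at this
  have hi : Integrable fun w : EuclideanSpace ℝ (Fin n) => heatKernel t w * ‖w‖ ^ a := by
    refine hG.mono' ?_ (Eventually.of_forall fun w => ?_)
    · exact (continuous_heatKernel.mul
        (continuous_norm.rpow_const fun _ => Or.inr ha)).aestronglyMeasurable
    · rw [Real.norm_of_nonneg (mul_nonneg (heatKernel_nonneg ht w) (by positivity))]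
      exact hb w
  refine ⟨hi, (integral_mono hi hG hb).trans_eq ?_⟩
  rw [integral_const_mul, integral_heatKernel (by positivity), mul_one]

theorem tendsto_heatSemigroup_nhdsWithin_zero {α H : ℝ} (hα : 0 < α)
    {f : EuclideanSpace ℝ (Fin n) → ℝ} (hf : IsCompactHolder α H f)
    (x : EuclideanSpace ℝ (Fin n)) :
    Tendsto (fun t => heatSemigroup t f x) (𝓝[>] 0) (𝓝 (f x)) := by
  obtain ⟨C, _, h⟩ := exists_integral_heatKernel_mul_rpow_le n hα.le
  have hlim : Tendsto (fun t : ℝ => H * (C * t ^ (α / 2))) (𝓝[>] 0) (𝓝 0) := by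
    have h1 : Tendsto (fun t : ℝ => t ^ (α / 2)) (𝓝 0) (𝓝 0) := by
      simpa [Real.zero_rpow (by positivity : α / 2 ≠ 0)] using
        (Real.continuousAt_rpow_const 0 (α / 2) (Or.inr (by positivity))).tendsto
    simpa using ((h1.mono_left nhdsWithin_le_nhds).const_mul C).const_mul H
  rw [tendsto_iff_norm_sub_tendsto_zero]
  refine squeeze_zero' (Eventually.of_forall fun _ => norm_nonneg _) ?_ hlim
  filter_upwards [self_mem_nhdsWithin] with t ht
  have ht : 0 < t := ht
  have h1 : Integrable fun w => heatKernel t w * f (x - w) :=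
    integrable_heatKernel_mul ht
      (hf.continuous.comp (continuous_const.sub continuous_id)).aestronglyMeasurable
      fun w => hf.bound _
  have e : heatSemigroup t f x - f x = ∫ w, heatKernel t w * (f (x - w) - f x) := by
    simp only [mul_sub]
    rw [integral_sub h1 ((integrable_heatKernel ht).mul_const _), integral_mul_const,
      integral_heatKernel ht, one_mul, heatSemigroup_eq_integral_sub]
  rw [e]
  refine (norm_integral_le_of_norm_le (((h t ht).1).const_mul H)
    (Eventually.of_forall fun w => ?_)).trans ?_
  · rw [norm_mul, Real.norm_of_nonneg (heatKernel_nonneg ht w), mul_left_comm]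
    refine mul_le_mul_of_nonneg_left ?_ (heatKernel_nonneg ht w)
    simpa using hf.holder (x - w) x
  · rw [integral_const_mul]
    exact mul_le_mul_of_nonneg_left (h t ht).2 hf.nonneg

/-- Fubini and the convolution identity for Gaussians. Bounding G_t by its maximum gives a product
majorant, so f only has to be integrable. -/
theorem heatSemigroup_add {t τ : ℝ} (ht : 0 < t) (hτ : 0 < τ) {f : EuclideanSpace ℝ (Fin n) → ℝ}
    (hf : Integrable f) (x : EuclideanSpace ℝ (Fin n)) :
    ∫ z, heatKernel τ (x - z) * heatSemigroup t f z = heatSemigroup (t + τ) f x := by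
  have hi : Integrable (Function.uncurry fun z w : EuclideanSpace ℝ (Fin n) =>
      heatKernel τ (x - z) * (heatKernel t (z - w) * f w)) (volume.prod volume) := by
    have h1 : Integrable (fun p : EuclideanSpace ℝ (Fin n) × EuclideanSpace ℝ (Fin n) =>
        (4 * Real.pi * t) ^ (-((n : ℝ) / 2)) * (heatKernel τ (x - p.1) * ‖f p.2‖))
        (volume.prod volume) :=
      (((integrable_heatKernel hτ).comp_sub_left x).mul_prod hf.norm).const_mul _
    refine h1.mono' ?_ (Eventually.of_forall fun p => ?_)
    · refine AEStronglyMeasurable.mul (Continuous.aestronglyMeasurable ?_)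
        (AEStronglyMeasurable.mul (Continuous.aestronglyMeasurable ?_) ?_)
      · exact continuous_heatKernel.comp (continuous_const.sub continuous_fst)
      · exact continuous_heatKernel.comp (continuous_fst.sub continuous_snd)
      · exact hf.aestronglyMeasurable.comp_snd
    · simp only [Function.uncurry]
      rw [norm_mul, norm_mul, Real.norm_of_nonneg (heatKernel_nonneg hτ _),
        Real.norm_of_nonneg (heatKernel_nonneg ht _), mul_left_comm]
      refine mul_le_mul_of_nonneg_right (heatKernel_le ht _)
        (mul_nonneg (heatKernel_nonneg hτ _) (norm_nonneg _))
  have e1 : ∀ z, heatKernel τ (x - z) * heatSemigroup t f z =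
      ∫ w, heatKernel τ (x - z) * (heatKernel t (z - w) * f w) := fun z => by
    rw [integral_const_mul]; rfl
  simp only [e1]
  rw [integral_integral_swap hi]
  refine integral_congr_ae (Eventually.of_forall fun w => ?_)
  simp only [← mul_assoc]
  rw [integral_mul_const]
  congr 1
  have h2 := integral_add_right_eq_self
    (fun z => heatKernel τ (x - z) * heatKernel t (z - w)) (μ := volume) w
  rw [← h2]
  simp only [add_sub_cancel_right, ← sub_sub, sub_right_comm x _ w]
  rw [integral_heatKernel_mul_heatKernel hτ ht, add_comm]

theorem stronglyMeasurable_heatSemigroup_uncurry {f : EuclideanSpace ℝ (Fin n) → ℝ}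
    (hf : Continuous f) :
    StronglyMeasurable fun p : ℝ × EuclideanSpace ℝ (Fin n) => heatSemigroup p.1 f p.2 := by
  refine StronglyMeasurable.integral_prod_right 
    (f := fun (p : ℝ × EuclideanSpace ℝ (Fin n)) z => heatKernel p.1 (p.2 - z) * f z) ?_
  refine Measurable.stronglyMeasurable ?_
  refine Measurable.mul ?_ (hf.measurable.comp measurable_snd)
  exact measurable_heatKernel_uncurry.comp
    ((measurable_fst.comp measurable_fst).prodMk ((measurable_snd.comp measurable_fst).sub measurable_snd))

theorem tendsto_heatKernel_cocompact {t : ℝ} (ht : 0 < t) :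
    Tendsto (heatKernel t) (cocompact (EuclideanSpace ℝ (Fin n))) (𝓝 0) := by
  have h1 : Tendsto (fun x : EuclideanSpace ℝ (Fin n) => -‖x‖ ^ 2 / (4 * t))
      (cocompact (EuclideanSpace ℝ (Fin n))) atBot := by
    simp only [neg_div]
    refine tendsto_neg_atTop_atBot.comp (Tendsto.atTop_div_const (by positivity) ?_)
    exact (tendsto_pow_atTop two_ne_zero).comp tendsto_norm_cocompact_atTop
  have h2 := (Real.tendsto_exp_atBot.comp h1).const_mul (1 / (4 * Real.pi * t) ^ ((n : ℝ) / 2))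
  rw [mul_zero] at h2
  exact h2

/-- Dominated convergence along a filter needs it to be countably generated; the form `comap norm
atTop` of the filter at infinity shows this. -/
theorem tendsto_heatSemigroup_of_norm_atTop {t : ℝ} (ht : 0 < t)
    {f : EuclideanSpace ℝ (Fin n) → ℝ} (hf : Integrable f) :
    Tendsto (fun x => heatSemigroup t f x) (comap norm atTop) (𝓝 0) := by
  have h := tendsto_integral_filter_of_dominated_convergence (μ := volume)
    (l := comap norm (atTop : Filter ℝ))
    (F := fun x z => heatKernel t (x - z) * f z) (f := fun _ => (0 : ℝ))
    (fun z => (4 * Real.pi * t) ^ (-((n : ℝ) / 2)) * ‖f z‖)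
    (Eventually.of_forall fun x => ((continuous_heatKernel.comp
      (continuous_const.sub continuous_id)).aestronglyMeasurable).mul hf.aestronglyMeasurable)
    (Eventually.of_forall fun x => Eventually.of_forall fun z => by
      rw [norm_mul, Real.norm_of_nonneg (heatKernel_nonneg ht _)]
      exact mul_le_mul_of_nonneg_right (heatKernel_le ht _) (norm_nonneg _))
    (hf.norm.const_mul _) (Eventually.of_forall fun z => ?_)
  · rw [integral_zero] at h
    exact h
  · have h1 : Tendsto (fun x : EuclideanSpace ℝ (Fin n) => x - z) (comap norm atTop)
        (cocompact (EuclideanSpace ℝ (Fin n))) := by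
      rw [comap_norm_atTop, ← Metric.cobounded_eq_cocompact]
      simp [sub_eq_add_neg]
    simpa using ((tendsto_heatKernel_cocompact ht).comp h1).mul_const (f z)

end HeatSemigroup

/-! ### Time integrals split at a threshold -/

section SplitIntegrals

theorem integrableOn_Ioi_ite_rpow (A B : ℝ) {a b r : ℝ} (ha : 0 < a) (hb : 0 < b) (hr : 0 < r) :
    IntegrableOn (fun t : ℝ => if t ≤ r then A * t ^ (a - 1) else B * t ^ (-b - 1)) (Ioi 0) ∧
      ∫ t in Ioi (0 : ℝ), (if t ≤ r then A * t ^ (a - 1) else B * t ^ (-b - 1)) =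
        A * r ^ a / a + B * r ^ (-b) / b := by
  have hI1 : IntegrableOn (fun t : ℝ => A * t ^ (a - 1)) (Ioc 0 r) := by
    refine Integrable.const_mul ?_ A
    have := intervalIntegral.intervalIntegrable_rpow' (a := 0) (b := r) (by linarith : -1 < a - 1)
    rwa [intervalIntegrable_iff_integrableOn_Ioc_of_le hr.le] at this
  have hI2 : IntegrableOn (fun t : ℝ => B * t ^ (-b - 1)) (Ioi r) :=
    Integrable.const_mul (integrableOn_Ioi_rpow_of_lt (by linarith) hr) B
  have h1 : IntegrableOn (fun t : ℝ => if t ≤ r then A * t ^ (a - 1) else B * t ^ (-b - 1))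
      (Ioc 0 r) := hI1.congr_fun (fun t ht => by simp [ht.2]) measurableSet_Ioc
  have h2 : IntegrableOn (fun t : ℝ => if t ≤ r then A * t ^ (a - 1) else B * t ^ (-b - 1))
      (Ioi r) := hI2.congr_fun (fun t ht => by simp [not_le.2 (show r < t from ht)])
        measurableSet_Ioi
  rw [← Ioc_union_Ioi_eq_Ioi hr.le]
  refine ⟨h1.union h2, ?_⟩
  rw [setIntegral_union Ioc_disjoint_Ioi_same measurableSet_Ioi h1 h2,
    setIntegral_congr_fun (g := fun t : ℝ => A * t ^ (a - 1)) measurableSet_Ioc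
      (fun t ht => by simp [ht.2]),
    setIntegral_congr_fun (g := fun t : ℝ => B * t ^ (-b - 1)) measurableSet_Ioi
      (fun t ht => by simp [not_le.2 (show r < t from ht)]),
    integral_const_mul, integral_const_mul, integral_Ioi_rpow_of_lt (by linarith) hr,
    ← intervalIntegral.integral_of_le hr.le, integral_rpow (Or.inl (by linarith)),
    sub_add_cancel, sub_add_cancel, Real.zero_rpow ha.ne', sub_zero, neg_div_neg_eq]
  ring

variable {V : Type*} [NormedAddCommGroup V] [NormedSpace ℝ V]

theorem norm_rpow_div_Gamma_smul_le {q : ℝ → V} {s a b A B R : ℝ} (hs : 0 < s)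
    (h1 : ∀ t, 0 < t → t ≤ R → ‖q t‖ ≤ A * t ^ (a - s))
    (h2 : ∀ t, 0 < t → R < t → ‖q t‖ ≤ B * t ^ (-b - s)) {t : ℝ} (ht : 0 < t) :
    ‖(t ^ (s - 1) / Real.Gamma s) • q t‖ ≤
      (if t ≤ R then A * t ^ (a - 1) else B * t ^ (-b - 1)) / Real.Gamma s := by
  have hG := Real.Gamma_pos_of_pos hs
  rw [norm_smul, Real.norm_of_nonneg (by positivity), div_mul_eq_mul_div]
  refine div_le_div_of_nonneg_right ?_ hG.le
  split_ifs with htR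
  · calc t ^ (s - 1) * ‖q t‖ ≤ t ^ (s - 1) * (A * t ^ (a - s)) :=
        mul_le_mul_of_nonneg_left (h1 t ht htR) (by positivity)
      _ = A * (t ^ (s - 1) * t ^ (a - s)) := by ring
      _ = A * t ^ (a - 1) := by rw [← Real.rpow_add ht]; congr 2; ring
  · calc t ^ (s - 1) * ‖q t‖ ≤ t ^ (s - 1) * (B * t ^ (-b - s)) :=
        mul_le_mul_of_nonneg_left (h2 t ht (not_le.1 htR)) (by positivity)
      _ = B * (t ^ (s - 1) * t ^ (-b - s)) := by ring
      _ = B * t ^ (-b - 1) := by rw [← Real.rpow_add ht]; congr 2; ring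

/-- The exponents are normalised so that the weight t^(s-1) turns them into a - 1 and -b - 1.
Positivity of a is convergence at 0, positivity of b convergence at infinity, and the threshold R
stays free. -/
theorem norm_integral_rpow_div_Gamma_smul_le {q : ℝ → V} {s a b A B R : ℝ} (hs : 0 < s)
    (ha : 0 < a) (hb : 0 < b) (hR : 0 < R)
    (h1 : ∀ t, 0 < t → t ≤ R → ‖q t‖ ≤ A * t ^ (a - s))
    (h2 : ∀ t, 0 < t → R < t → ‖q t‖ ≤ B * t ^ (-b - s)) :
    ‖∫ t in Ioi (0 : ℝ), (t ^ (s - 1) / Real.Gamma s) • q t‖ ≤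
      (A * R ^ a / a + B * R ^ (-b) / b) / Real.Gamma s := by
  have h := integrableOn_Ioi_ite_rpow A B ha hb hR
  rw [← h.2, ← integral_div]
  refine norm_integral_le_of_norm_le (h.1.div_const _) ?_
  filter_upwards [ae_restrict_mem measurableSet_Ioi] with t ht
  exact norm_rpow_div_Gamma_smul_le hs h1 h2 ht

end SplitIntegrals

/-! ### Derivatives of the potential and their differences -/

section NegPow

variable {n : ℕ}

theorem negPowLaplacian_eq (s : ℝ) (f : EuclideanSpace ℝ (Fin n) → ℝ)
    (x : EuclideanSpace ℝ (Fin n)) : negPowLaplacian s f x =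
      ∫ t in Ioi (0 : ℝ), t ^ (s - 1) / Real.Gamma s * heatSemigroup t f x := by
  rw [negPowLaplacian, ← integral_const_mul]
  refine setIntegral_congr_fun measurableSet_Ioi fun t ht => ?_
  have ht : 0 < t := ht
  rw [show s - 1 = -(1 - s) by ring, Real.rpow_neg ht.le]
  ring

/-- For k ≥ 1 the smoothing estimate gives a = (α - k)/2 + s, positive exactly when k < α + 2s; for
k = 0 the sup bound gives a = s. -/
theorem exists_norm_iteratedFDeriv_heatSemigroup_le_rpow {s α H : ℝ} (hs : 0 < s) (hα : 0 < α)
    {k : ℕ} (hk : (k : ℝ) < α + 2 * s) {f : EuclideanSpace ℝ (Fin n) → ℝ}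
    (hf : IsCompactHolder α H f) : ∃ a A : ℝ, 0 < a ∧ ∀ t, 0 < t → ∀ x,
      ‖iteratedFDeriv ℝ k (heatSemigroup t f) x‖ ≤ A * t ^ (a - s) := by
  rcases k with _ | k
  · refine ⟨s, H, hs, fun t ht x => ?_⟩
    rw [sub_self, Real.rpow_zero, mul_one, norm_iteratedFDeriv_zero]
    exact abs_heatSemigroup_le ht hf.bound x
  · obtain ⟨C, _, h⟩ := exists_norm_iteratedFDeriv_heatSemigroup_le_of_holder n k hα
    refine ⟨(α - (k + 1 : ℕ)) / 2 + s, C * H, by linarith, fun t ht x => ?_⟩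
    rw [add_sub_cancel_right]
    exact h f H hf t ht x

/-- For t > 1 the extra decay t^(-k/2) is discarded, leaving the tail exponent b = n/2 - s for every
order at once. -/
theorem exists_norm_iteratedFDeriv_heatSemigroup_le_rpow_tail (k : ℕ) (s : ℝ)
    {f : EuclideanSpace ℝ (Fin n) → ℝ} (hf : Integrable f) :
    ∃ B : ℝ, ∀ t, 0 < t → 1 < t → ∀ x,
      ‖iteratedFDeriv ℝ k (heatSemigroup t f) x‖ ≤ B * t ^ (-((n : ℝ) / 2 - s) - s) := by
  obtain ⟨C, hC, h⟩ := exists_norm_iteratedFDeriv_heatSemigroup_le n k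
  refine ⟨C * ∫ z, ‖f z‖, fun t ht ht1 x => (h f hf t ht x).trans ?_⟩
  rw [mul_right_comm]
  have : 0 ≤ ∫ z, ‖f z‖ := integral_nonneg fun _ => norm_nonneg _
  refine mul_le_mul_of_nonneg_left (Real.rpow_le_rpow_of_exponent_le ht1.le ?_) (by positivity)
  have : (0 : ℝ) ≤ k := k.cast_nonneg
  linarith

theorem aestronglyMeasurable_rpow_smul_iteratedFDeriv_heatSemigroup (s : ℝ) (k : ℕ)
    {f : EuclideanSpace ℝ (Fin n) → ℝ} (hf : Continuous f) (hi : Integrable f)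
    (x : EuclideanSpace ℝ (Fin n)) :
    AEStronglyMeasurable (fun t : ℝ => (t ^ (s - 1) / Real.Gamma s) •
      iteratedFDeriv ℝ k (heatSemigroup t f) x) (volume.restrict (Ioi 0)) := by
  have h0 : Measurable fun t : ℝ => t ^ (s - 1) / Real.Gamma s := by fun_prop
  refine h0.aestronglyMeasurable.smul ?_
  refine aestronglyMeasurable_iteratedFDeriv (N := k) ?_ (fun y => ?_) le_rfl x
  · filter_upwards [ae_restrict_mem measurableSet_Ioi] with t ht
    exact (contDiff_heatSemigroup ht hi k).1
  · exact ((stronglyMeasurable_heatSemigroup_uncurry hf).comp_measurable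
      (measurable_id.prodMk measurable_const)).aestronglyMeasurable

theorem exists_integrable_bound_rpow_smul_iteratedFDeriv_heatSemigroup {s α H : ℝ} (hs : 0 < s)
    (hsn : s < (n : ℝ) / 2) (hα : 0 < α) {k : ℕ} (hk : (k : ℝ) < α + 2 * s)
    {f : EuclideanSpace ℝ (Fin n) → ℝ} (hf : IsCompactHolder α H f) :
    ∃ b : ℝ → ℝ, IntegrableOn b (Ioi 0) ∧ ∀ t, 0 < t → ∀ x,
      ‖(t ^ (s - 1) / Real.Gamma s) • iteratedFDeriv ℝ k (heatSemigroup t f) x‖ ≤ b t := by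
  obtain ⟨a, A, ha, h1⟩ := exists_norm_iteratedFDeriv_heatSemigroup_le_rpow hs hα hk hf
  obtain ⟨B, h2⟩ := exists_norm_iteratedFDeriv_heatSemigroup_le_rpow_tail k s hf.integrable
  exact ⟨_, (integrableOn_Ioi_ite_rpow A B ha (sub_pos.2 hsn) one_pos).1.div_const _,
    fun t ht x => norm_rpow_div_Gamma_smul_le (a := a) (b := (n : ℝ) / 2 - s) hs
      (fun t ht _ => h1 t ht x) (fun t ht ht1 => h2 t ht ht1 x) ht⟩

theorem integrable_rpow_smul_iteratedFDeriv_heatSemigroup {s α H : ℝ} (hs : 0 < s)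
    (hsn : s < (n : ℝ) / 2) (hα : 0 < α) {k : ℕ} (hk : (k : ℝ) < α + 2 * s)
    {f : EuclideanSpace ℝ (Fin n) → ℝ} (hf : IsCompactHolder α H f)
    (x : EuclideanSpace ℝ (Fin n)) :
    IntegrableOn (fun t : ℝ => (t ^ (s - 1) / Real.Gamma s) •
      iteratedFDeriv ℝ k (heatSemigroup t f) x) (Ioi 0) := by
  obtain ⟨b, hb, h⟩ :=
    exists_integrable_bound_rpow_smul_iteratedFDeriv_heatSemigroup hs hsn hα hk hf
  refine hb.mono' (aestronglyMeasurable_rpow_smul_iteratedFDeriv_heatSemigroup s k hf.continuous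
    hf.integrable x) ?_
  filter_upwards [ae_restrict_mem measurableSet_Ioi] with t ht using h t ht x

theorem iteratedFDeriv_const_mul_heatSemigroup {t : ℝ} (ht : 0 < t) (c : ℝ) (k : ℕ)
    {f : EuclideanSpace ℝ (Fin n) → ℝ} (hf : Integrable f) (x : EuclideanSpace ℝ (Fin n)) :
    iteratedFDeriv ℝ k (fun y => c * heatSemigroup t f y) x =
      c • iteratedFDeriv ℝ k (heatSemigroup t f) x :=
  iteratedFDeriv_const_smul_apply (a := c) (f := heatSemigroup t f)
    (contDiff_heatSemigroup ht hf k).1.contDiffAt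

/-- `(-Δ)^{-s} f` is of class `C^N` for `N < α + 2s`, and its derivatives may be computed under the
integral sign. -/
theorem contDiff_negPowLaplacian {s α H : ℝ} (hs : 0 < s) (hsn : s < (n : ℝ) / 2) (hα : 0 < α)
    {N : ℕ} (hN : (N : ℝ) < α + 2 * s) {f : EuclideanSpace ℝ (Fin n) → ℝ}
    (hf : IsCompactHolder α H f) :
    ContDiff ℝ N (negPowLaplacian s f) ∧ ∀ k ≤ N, ∀ x,
      iteratedFDeriv ℝ k (negPowLaplacian s f) x = ∫ t in Ioi (0 : ℝ),
        (t ^ (s - 1) / Real.Gamma s) • iteratedFDeriv ℝ k (heatSemigroup t f) x := by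
  have hk : ∀ k ≤ N, (k : ℝ) < α + 2 * s := fun k hk =>
    lt_of_le_of_lt (by exact_mod_cast hk) hN
  -- The majorants are made total in k, with the junk value 0 beyond N, so that a single sequence
  -- can be chosen.
  have hex : ∀ k : ℕ, ∃ b : ℝ → ℝ, k ≤ N → (IntegrableOn b (Ioi 0) ∧ ∀ t, 0 < t → ∀ x,
      ‖(t ^ (s - 1) / Real.Gamma s) • iteratedFDeriv ℝ k (heatSemigroup t f) x‖ ≤ b t) := by
    intro k
    by_cases h : k ≤ N
    · obtain ⟨b, hb⟩ :=
        exists_integrable_bound_rpow_smul_iteratedFDeriv_heatSemigroup hs hsn hα (hk k h) hf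
      exact ⟨b, fun _ => hb⟩
    · exact ⟨0, fun h' => absurd h' h⟩
  choose b hb using hex
  have h1 : ∀ᵐ t ∂volume.restrict (Ioi (0 : ℝ)), ContDiff ℝ N fun x =>
      t ^ (s - 1) / Real.Gamma s * heatSemigroup t f x := by
    filter_upwards [ae_restrict_mem measurableSet_Ioi] with t ht
    exact contDiff_const.mul (contDiff_heatSemigroup ht hf.integrable N).1
  have h2 : ∀ x : EuclideanSpace ℝ (Fin n), AEStronglyMeasurable (fun t : ℝ =>
      t ^ (s - 1) / Real.Gamma s * heatSemigroup t f x) (volume.restrict (Ioi 0)) := fun x =>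
    AEStronglyMeasurable.mul (Measurable.aestronglyMeasurable (by fun_prop))
      ((stronglyMeasurable_heatSemigroup_uncurry hf.continuous).comp_measurable
      (measurable_id.prodMk measurable_const)).aestronglyMeasurable
  have h3 : ∀ k ≤ N, Integrable (b k) (volume.restrict (Ioi 0)) := fun k hk => (hb k hk).1
  have h4 : ∀ k ≤ N, ∀ᵐ t ∂volume.restrict (Ioi (0 : ℝ)), ∀ x,
      ‖iteratedFDeriv ℝ k (fun x => t ^ (s - 1) / Real.Gamma s * heatSemigroup t f x) x‖ ≤
        b k t := fun k hk => by
    filter_upwards [ae_restrict_mem measurableSet_Ioi] with t ht x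
    rw [iteratedFDeriv_const_mul_heatSemigroup ht _ _ hf.integrable]
    exact (hb k hk).2 t ht x
  have e : negPowLaplacian s f = fun x => ∫ t in Ioi (0 : ℝ),
      t ^ (s - 1) / Real.Gamma s * heatSemigroup t f x := funext fun x => negPowLaplacian_eq s f x
  rw [e]
  refine ⟨contDiff_integral h1 h2 h3 h4, fun k hk x => ?_⟩
  rw [iteratedFDeriv_integral h1 h2 h3 h4 hk x]
  refine setIntegral_congr_fun measurableSet_Ioi fun t ht => ?_
  exact iteratedFDeriv_const_mul_heatSemigroup ht _ _ hf.integrable x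

/-- Purely qualitative: B depends on f itself. It supplies the finiteness needed by the absorption
argument. -/
theorem exists_norm_iteratedFDeriv_negPowLaplacian_le {s α H : ℝ} (hs : 0 < s)
    (hsn : s < (n : ℝ) / 2) (hα : 0 < α) {k : ℕ} (hk : (k : ℝ) < α + 2 * s)
    {f : EuclideanSpace ℝ (Fin n) → ℝ} (hf : IsCompactHolder α H f) :
    ∃ B, ∀ x, ‖iteratedFDeriv ℝ k (negPowLaplacian s f) x‖ ≤ B := by
  obtain ⟨b, hb, h⟩ :=
    exists_integrable_bound_rpow_smul_iteratedFDeriv_heatSemigroup hs hsn hα hk hf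
  refine ⟨∫ t in Ioi (0 : ℝ), b t, fun x => ?_⟩
  rw [(contDiff_negPowLaplacian hs hsn hα hk hf).2 k le_rfl x]
  refine norm_integral_le_of_norm_le hb ?_
  filter_upwards [ae_restrict_mem measurableSet_Ioi] with t ht using h t ht x

/-- The short-time bound for differences of derivatives of the heat semigroup. -/
theorem exists_norm_iteratedFDeriv_heatSemigroup_sub_le (n : ℕ) {s α : ℝ} (hs : 0 < s)
    (hα : 0 < α) {k : ℕ} (hk : (k : ℝ) < α + 2 * s) :
    ∃ a e C : ℝ, 0 < a ∧ 0 < C ∧ e + 2 * a = α + 2 * s - k ∧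
      ∀ (f : EuclideanSpace ℝ (Fin n) → ℝ) (H : ℝ), IsCompactHolder α H f →
      ∀ t : ℝ, 0 < t → ∀ x y,
      ‖iteratedFDeriv ℝ k (heatSemigroup t f) x - iteratedFDeriv ℝ k (heatSemigroup t f) y‖ ≤
        C * H * ‖x - y‖ ^ e * t ^ (a - s) := by
  rcases k with _ | k
  · refine ⟨s, α, 1, hs, one_pos, by simp, fun f H hf t ht x y => ?_⟩
    rw [sub_self, Real.rpow_zero, mul_one, one_mul]
    refine le_trans (le_of_eq ?_) (abs_heatSemigroup_sub_le ht hf x y)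
    simp only [iteratedFDeriv_zero_eq_comp, Function.comp_apply]
    exact ((continuousMultilinearCurryFin0 ℝ (EuclideanSpace ℝ (Fin n)) ℝ).symm.norm_map
      (heatSemigroup t f x - heatSemigroup t f y))
  · obtain ⟨C, hC, h⟩ := exists_norm_iteratedFDeriv_heatSemigroup_le_of_holder n k hα
    -- For positive order no power of |x - y| is kept (e = 0); the two derivatives are estimated
    -- separately.
    refine ⟨(α - (k + 1 : ℕ)) / 2 + s, 0, 2 * C, by linarith, by positivity, by ring,
      fun f H hf t ht x y => ?_⟩
    rw [add_sub_cancel_right, Real.rpow_zero, mul_one]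
    refine (norm_sub_le _ _).trans ((add_le_add (h f H hf t ht x) (h f H hf t ht y)).trans_eq ?_)
    ring

/-- Evaluates a split integral at the parabolic threshold R = r². In both applications the two
resulting powers of r coincide. -/
theorem split_rpow_eq {r a b e c : ℝ} (hr : 0 < r) (X Y : ℝ) :
    X * r ^ e * (r ^ 2) ^ a / a + Y * r ^ c * (r ^ 2) ^ (-b) / b =
      X / a * r ^ (e + 2 * a) + Y / b * r ^ (c - 2 * b) := by
  rw [← Real.rpow_natCast r 2, ← Real.rpow_mul hr.le, ← Real.rpow_mul hr.le, Real.rpow_add hr,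
    Real.rpow_sub hr]
  rw [show ((2 : ℕ) : ℝ) * -b = -(2 * b) by push_cast; ring, Real.rpow_neg hr.le]
  push_cast
  ring

/-- Hölder estimate for the top order derivatives of `(-Δ)^{-s} f`. -/
theorem exists_norm_iteratedFDeriv_negPowLaplacian_sub_le (n : ℕ) {s α : ℝ} (hs : 0 < s)
    (hsn : s < (n : ℝ) / 2) (hα : 0 < α) {k : ℕ} (hk : (k : ℝ) < α + 2 * s)
    (hk' : α + 2 * s < k + 1) :
    ∃ C : ℝ, 0 < C ∧ ∀ (f : EuclideanSpace ℝ (Fin n) → ℝ) (H : ℝ), IsCompactHolder α H f →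
      ∀ x y, ‖iteratedFDeriv ℝ k (negPowLaplacian s f) x -
        iteratedFDeriv ℝ k (negPowLaplacian s f) y‖ ≤ C * H * ‖x - y‖ ^ (α + 2 * s - k) := by
  obtain ⟨a, e, C, ha, hC, hae, h1⟩ := exists_norm_iteratedFDeriv_heatSemigroup_sub_le n hs hα hk
  obtain ⟨D, hD, h2⟩ := exists_norm_iteratedFDeriv_heatSemigroup_le_of_holder n k hα
  have hG := Real.Gamma_pos_of_pos hs
  -- Convergence of the late piece, where one extra derivative is spent; this is where α + 2s < k +
  -- 1 enters.
  have hb : 0 < (k + 1 - α) / 2 - s := by linarith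
  refine ⟨(C / a + D / ((k + 1 - α) / 2 - s)) / Real.Gamma s, by positivity,
    fun f H hf x y => ?_⟩
  rcases eq_or_ne x y with rfl | hxy
  · rw [sub_self, norm_zero, sub_self, norm_zero, Real.zero_rpow (by linarith), mul_zero]
  have hr : 0 < ‖x - y‖ := norm_pos_iff.2 (sub_ne_zero.2 hxy)
  have hi := integrable_rpow_smul_iteratedFDeriv_heatSemigroup hs hsn hα hk hf
  rw [(contDiff_negPowLaplacian hs hsn hα hk hf).2 k le_rfl x,
    (contDiff_negPowLaplacian hs hsn hα hk hf).2 k le_rfl y, ← integral_sub (hi x) (hi y)]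
  simp only [← smul_sub]
  -- Before t = |x - y|² the difference is bounded directly; afterwards the mean value inequality
  -- gives the factor |x - y| and one more derivative.
  refine (norm_integral_rpow_div_Gamma_smul_le (R := ‖x - y‖ ^ 2) (B := D * H * ‖x - y‖ ^ (1 : ℝ))
    hs ha hb (by positivity) (fun t ht _ => h1 f H hf t ht x y) (fun t ht _ => ?_)).trans_eq ?_
  · have := norm_iteratedFDeriv_sub_le (contDiff_heatSemigroup ht hf.integrable (k + 1)).1
      (h2 f H hf t ht) x y
    refine this.trans_eq ?_
    rw [Real.rpow_one, mul_right_comm]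
    congr 2
    push_cast
    ring
  · rw [split_rpow_eq hr, hae, show 1 - 2 * ((k + 1 - α) / 2 - s) = α + 2 * s - k by ring]
    ring

/-- Estimate for the second differences of the derivatives of `(-Δ)^{-s} f`. -/
theorem exists_norm_iteratedFDeriv_negPowLaplacian_second_diff_le (n : ℕ) {s α : ℝ} (hs : 0 < s)
    (hsn : s < (n : ℝ) / 2) (hα : 0 < α) {k : ℕ} (hk : (k : ℝ) < α + 2 * s)
    (hk' : α + 2 * s < k + 2) :
    ∃ C : ℝ, 0 < C ∧ ∀ (f : EuclideanSpace ℝ (Fin n) → ℝ) (H : ℝ), IsCompactHolder α H f →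
      ∀ x h, ‖iteratedFDeriv ℝ k (negPowLaplacian s f) (x + h) +
        iteratedFDeriv ℝ k (negPowLaplacian s f) (x - h) -
        (2 : ℝ) • iteratedFDeriv ℝ k (negPowLaplacian s f) x‖ ≤ C * H * ‖h‖ ^ (α + 2 * s - k) := by
  obtain ⟨a, e, C, ha, hC, hae, h1⟩ := exists_norm_iteratedFDeriv_heatSemigroup_sub_le n hs hα hk
  obtain ⟨D, hD, h2⟩ := exists_norm_iteratedFDeriv_heatSemigroup_le_of_holder n (k + 1) hα
  have hG := Real.Gamma_pos_of_pos hs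
  -- Two extra derivatives make the late piece converge up to α + 2s < k + 2, which includes the
  -- critical value α + 2s = k + 1.
  have hb : 0 < (k + 2 - α) / 2 - s := by linarith
  refine ⟨(2 * C / a + D / ((k + 2 - α) / 2 - s)) / Real.Gamma s, by positivity,
    fun f H hf x h => ?_⟩
  rcases eq_or_ne h 0 with rfl | hh
  · rw [add_zero, sub_zero, two_smul, sub_self, norm_zero, norm_zero,
      Real.zero_rpow (by linarith), mul_zero]
  have hr : 0 < ‖h‖ := norm_pos_iff.2 hh
  have hi := integrable_rpow_smul_iteratedFDeriv_heatSemigroup hs hsn hα hk hf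
  have hu := (contDiff_negPowLaplacian hs hsn hα hk hf).2 k le_rfl
  have e1 : iteratedFDeriv ℝ k (negPowLaplacian s f) (x + h) +
        iteratedFDeriv ℝ k (negPowLaplacian s f) (x - h) -
        (2 : ℝ) • iteratedFDeriv ℝ k (negPowLaplacian s f) x =
      ∫ t in Ioi (0 : ℝ), (t ^ (s - 1) / Real.Gamma s) •
        (iteratedFDeriv ℝ k (heatSemigroup t f) (x + h) +
        iteratedFDeriv ℝ k (heatSemigroup t f) (x - h) -
        (2 : ℝ) • iteratedFDeriv ℝ k (heatSemigroup t f) x) := by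
    rw [hu, hu, hu, ← integral_add (hi _) (hi _), ← integral_smul, ← integral_sub]
    · refine integral_congr_ae (Eventually.of_forall fun t => ?_)
      simp only [smul_sub, smul_add]
      rw [smul_comm]
    · exact (hi _).add (hi _)
    · exact (hi x).smul (2 : ℝ)
  rw [e1]
  -- Early times: the second difference is a sum of two first differences, hence the 2C. Late times:
  -- the second order bound, with factor |h|².
  refine (norm_integral_rpow_div_Gamma_smul_le (R := ‖h‖ ^ 2) (A := 2 * C * H * ‖h‖ ^ e)
    (B := D * H * ‖h‖ ^ (2 : ℝ))
    hs ha hb (by positivity) (fun t ht _ => ?_) (fun t ht _ => ?_)).trans_eq ?_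
  · have h3 := h1 f H hf t ht (x + h) x
    have h4 := h1 f H hf t ht (x - h) x
    rw [add_sub_cancel_left] at h3
    rw [sub_sub_cancel_left, norm_neg] at h4
    calc _ = ‖(iteratedFDeriv ℝ k (heatSemigroup t f) (x + h) -
          iteratedFDeriv ℝ k (heatSemigroup t f) x) +
        (iteratedFDeriv ℝ k (heatSemigroup t f) (x - h) -
        iteratedFDeriv ℝ k (heatSemigroup t f) x)‖ := by rw [two_smul]; congr 1; abel
      _ ≤ _ := norm_add_le _ _
      _ ≤ _ := add_le_add h3 h4
      _ = _ := by ring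
  · have := norm_iteratedFDeriv_second_diff_le (contDiff_heatSemigroup ht hf.integrable (k + 2)).1
      (h2 f H hf t ht) x h
    refine this.trans_eq ?_
    rw [Real.rpow_two, mul_right_comm]
    congr 2
    push_cast
    ring
  · rw [split_rpow_eq hr, hae, show 2 - 2 * ((k + 2 - α) / 2 - s) = α + 2 * s - k by ring]
    ring

end NegPow

/-! ### Hölder and Zygmund estimates; decay at infinity -/

section Schauder

variable {n : ℕ}

theorem MemHolderSpace.isCompactHolder {α : ℝ} (hα : 0 < α) {f : EuclideanSpace ℝ (Fin n) → ℝ}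
    (hf : MemHolderSpace 0 α f) (hc : HasCompactSupport f) :
    IsCompactHolder α (holderNorm 0 α f).toReal f :=
  ⟨hf.1.continuous, hc, ENNReal.toReal_nonneg, (hf.bounds hα).1, (hf.bounds hα).2⟩

/-- Collects the interpolation inequalities for k = 0, 1, 2. Second differences are used because
both the Hölder and the Zygmund bounds control them; the bounds B only certify finiteness and do not
enter the result. -/
theorem norm_iteratedFDeriv_le_of_second_diff {u : EuclideanSpace ℝ (Fin n) → ℝ} {k : ℕ}
    (hk : k ≤ 2) (hu : ContDiff ℝ k u) {A L : ℝ} (hA : ∀ x, ‖u x‖ ≤ A)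
    (hB : ∀ j ≤ k, ∃ B, ∀ x, ‖iteratedFDeriv ℝ j u x‖ ≤ B)
    (hL : ∀ x h, ‖h‖ ≤ 1 → ‖iteratedFDeriv ℝ k u (x + h) +
      iteratedFDeriv ℝ k u (x - h) - (2 : ℝ) • iteratedFDeriv ℝ k u x‖ ≤ L) :
    ∀ j ≤ k, ∀ x, ‖iteratedFDeriv ℝ j u x‖ ≤ 11 * A + 2 * L := by
  have hA0 : 0 ≤ A := (norm_nonneg _).trans (hA 0)
  have hL0 : 0 ≤ L := (norm_nonneg _).trans (hL 0 0 (by simp))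
  have h0 : ∀ x, ‖iteratedFDeriv ℝ 0 u x‖ ≤ A := fun x => by
    rw [norm_iteratedFDeriv_zero]; exact hA x
  intro j hj x
  rcases j with _ | j
  · exact (h0 x).trans (by linarith)
  interval_cases k
  · omega
  · obtain rfl : j = 0 := by omega
    exact (norm_iteratedFDeriv_succ_le_of_second_diff (k := 0) hu h0 hL x).trans (by linarith)
  · obtain ⟨B, hB⟩ := hB 1 one_le_two
    have := norm_iteratedFDeriv_le_of_second_diff_two hu hA hB hL x
    obtain rfl | rfl : j = 0 ∨ j = 1 := by omega
    · exact this.1.trans (by linarith)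
    · exact this.2

theorem IsCompactHolder.eLpNorm_negPowLaplacian_ne_top {s α H : ℝ} (hs : 0 < s)
    (hsn : s < (n : ℝ) / 2) (hα : 0 < α) {f : EuclideanSpace ℝ (Fin n) → ℝ}
    (hf : IsCompactHolder α H f) : eLpNorm (negPowLaplacian s f) ∞ volume ≠ ∞ := by
  obtain ⟨B, hB⟩ := exists_norm_iteratedFDeriv_negPowLaplacian_le (k := 0) hs hsn hα
    (by simp; linarith) hf
  refine ne_top_of_le_ne_top ENNReal.ofReal_ne_top (eLpNorm_top_le_ofReal (c := B) fun x => ?_)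
  simpa using hB x

theorem mul_ofReal_mul_add_toReal_le {m : ℕ} {c : ℝ} (hc : 0 ≤ c) {A N : ℝ≥0∞} (hA : A ≠ ∞)
    (hN : N ≠ ∞) :
    (m : ℝ≥0∞) * ENNReal.ofReal (c * (A.toReal + N.toReal)) = ENNReal.ofReal (m * c) * (A + N) := by
  rw [ENNReal.ofReal_mul hc, ENNReal.ofReal_mul m.cast_nonneg, ENNReal.ofReal_natCast,
    ENNReal.ofReal_add ENNReal.toReal_nonneg ENNReal.toReal_nonneg, ENNReal.ofReal_toReal hA,
    ENNReal.ofReal_toReal hN, mul_assoc]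

theorem exists_holderNorm_negPowLaplacian_le (n : ℕ) {s α : ℝ} (hs : 0 < s)
    (hsn : s < (n : ℝ) / 2) (hα : 0 < α) {k : ℕ} (hk2 : k ≤ 2) (hk : (k : ℝ) < α + 2 * s)
    (hk' : α + 2 * s < k + 1) :
    ∃ C : ℝ, 0 < C ∧ ∀ f : EuclideanSpace ℝ (Fin n) → ℝ,
      MemHolderSpace 0 α f → HasCompactSupport f →
        MemHolderSpace k (α + 2 * s - k) (negPowLaplacian s f) ∧
        holderNorm k (α + 2 * s - k) (negPowLaplacian s f) ≤
          ENNReal.ofReal C * (eLpNorm (negPowLaplacian s f) ∞ volume + holderNorm 0 α f) := by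
  obtain ⟨C, hC, h⟩ := exists_norm_iteratedFDeriv_negPowLaplacian_sub_le n hs hsn hα hk hk'
  -- Interpolation gives 11A + 2L with L = 2CN, a second difference being two first differences. The
  -- norm is a sum of k + 1 sup norms and one seminorm, hence k + 2.
  refine ⟨(k + 2 : ℕ) * (11 + 4 * C), by positivity, fun f hf hc => ?_⟩
  have hfH := hf.isCompactHolder hα hc
  have hfin := hfH.eLpNorm_negPowLaplacian_ne_top hs hsn hα
  have hu := (contDiff_negPowLaplacian hs hsn hα hk hfH).1
  set A := (eLpNorm (negPowLaplacian s f) ∞ volume).toReal with hA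
  set N := (holderNorm 0 α f).toReal with hN
  have hA0 : 0 ≤ A := ENNReal.toReal_nonneg
  have hN0 : 0 ≤ N := ENNReal.toReal_nonneg
  have hβ : 0 < α + 2 * s - k := by linarith
  have h1 := h f N hfH
  have h2 := norm_iteratedFDeriv_le_of_second_diff (L := 2 * (C * N)) hk2 hu
    (norm_le_toReal_eLpNorm_top hu.continuous hfin)
    (fun j hj => exists_norm_iteratedFDeriv_negPowLaplacian_le hs hsn hα
      (lt_of_le_of_lt (by exact_mod_cast hj) hk) hfH)
    (fun x y hy => by
      have e : ‖y‖ ^ (α + 2 * s - k) ≤ 1 := Real.rpow_le_one (norm_nonneg _) hy hβ.le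
      have h3 := (h1 (x + y) x).trans (b := C * N * ‖x + y - x‖ ^ (α + 2 * s - k))
        (mul_le_of_le_one_right (by positivity) (by rwa [add_sub_cancel_left]))
      have h4 := (h1 (x - y) x).trans
        (mul_le_of_le_one_right (by positivity) (by rwa [sub_sub_cancel_left, norm_neg]))
      calc _ = ‖(iteratedFDeriv ℝ k (negPowLaplacian s f) (x + y) -
            iteratedFDeriv ℝ k (negPowLaplacian s f) x) +
          (iteratedFDeriv ℝ k (negPowLaplacian s f) (x - y) -
            iteratedFDeriv ℝ k (negPowLaplacian s f) x)‖ := by rw [two_smul]; congr 1; abel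
        _ ≤ _ := norm_add_le _ _
        _ ≤ _ := add_le_add h3 h4
        _ = _ := by ring)
  have h5 : holderNorm k (α + 2 * s - k) (negPowLaplacian s f) ≤
      ENNReal.ofReal ((k + 2 : ℕ) * (11 + 4 * C)) *
        (eLpNorm (negPowLaplacian s f) ∞ volume + holderNorm 0 α f) := by
    rw [← mul_ofReal_mul_add_toReal_le (by positivity) hfin hf.2.ne]
    refine holderNorm_le hβ (fun j hj x => (h2 j hj x).trans ?_) (fun x y => (h1 x y).trans ?_)
    · nlinarith [mul_nonneg hC.le hA0]
    · refine mul_le_mul_of_nonneg_right ?_ (by positivity)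
      nlinarith [mul_nonneg hC.le hA0]
  exact ⟨⟨hu, h5.trans_lt (ENNReal.mul_lt_top ENNReal.ofReal_lt_top
    (ENNReal.add_lt_top.2 ⟨hfin.lt_top, hf.2⟩))⟩, h5⟩

/-- When α + 2s = k + 1, the exponent α + 2s - k in the second difference estimate is 1, and that
estimate is the Zygmund seminorm bound for derivatives of order k. -/
theorem exists_zygmundNorm_negPowLaplacian_le (n : ℕ) {s α : ℝ} (hs : 0 < s)
    (hsn : s < (n : ℝ) / 2) (hα : 0 < α) {k : ℕ} (hk2 : k ≤ 1) (hk : α + 2 * s = (k + 1 : ℕ)) :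
    ∃ C : ℝ, 0 < C ∧ ∀ f : EuclideanSpace ℝ (Fin n) → ℝ,
      MemHolderSpace 0 α f → HasCompactSupport f →
        MemZygmundSpace (k + 1) (negPowLaplacian s f) ∧
        zygmundNorm (k + 1) (negPowLaplacian s f) ≤
          ENNReal.ofReal C * (eLpNorm (negPowLaplacian s f) ∞ volume + holderNorm 0 α f) := by
  push_cast at hk
  have hk1 : (k : ℝ) < α + 2 * s := by linarith
  obtain ⟨C, hC, h⟩ :=
    exists_norm_iteratedFDeriv_negPowLaplacian_second_diff_le n hs hsn hα hk1 (by linarith)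
  refine ⟨(k + 2 : ℕ) * (11 + 2 * C), by positivity, fun f hf hc => ?_⟩
  have hfH := hf.isCompactHolder hα hc
  have hfin := hfH.eLpNorm_negPowLaplacian_ne_top hs hsn hα
  have hu := (contDiff_negPowLaplacian hs hsn hα hk1 hfH).1
  set A := (eLpNorm (negPowLaplacian s f) ∞ volume).toReal with hA
  set N := (holderNorm 0 α f).toReal with hN
  have hA0 : 0 ≤ A := ENNReal.toReal_nonneg
  have hN0 : 0 ≤ N := ENNReal.toReal_nonneg
  have h1 := h f N hfH
  rw [hk, add_sub_cancel_left] at h1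
  simp only [Real.rpow_one] at h1
  have h2 := norm_iteratedFDeriv_le_of_second_diff (L := C * N) (by omega) hu
    (norm_le_toReal_eLpNorm_top hu.continuous hfin)
    (fun j hj => exists_norm_iteratedFDeriv_negPowLaplacian_le hs hsn hα
      (lt_of_le_of_lt (by exact_mod_cast hj) hk1) hfH)
    (fun x y hy => (h1 x y).trans (mul_le_of_le_one_right (by positivity) hy))
  have h5 : zygmundNorm (k + 1) (negPowLaplacian s f) ≤
      ENNReal.ofReal ((k + 2 : ℕ) * (11 + 2 * C)) *
        (eLpNorm (negPowLaplacian s f) ∞ volume + holderNorm 0 α f) := by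
    rw [← mul_ofReal_mul_add_toReal_le (by positivity) hfin hf.2.ne]
    refine zygmundNorm_le (fun j hj x => (h2 j hj x).trans ?_) (fun x y => (h1 x y).trans ?_)
    · nlinarith [mul_nonneg hC.le hA0]
    · refine mul_le_mul_of_nonneg_right ?_ (by positivity)
      nlinarith [mul_nonneg hC.le hA0]
  exact ⟨⟨hu, h5.trans_lt (ENNReal.mul_lt_top ENNReal.ofReal_lt_top
    (ENNReal.add_lt_top.2 ⟨hfin.lt_top, hf.2⟩))⟩, h5⟩

theorem IsCompactHolder.integrableOn_rpow_mul_heatSemigroup {s α H : ℝ} (hs : 0 < s)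
    (hsn : s < (n : ℝ) / 2) (hα : 0 < α) {f : EuclideanSpace ℝ (Fin n) → ℝ}
    (hf : IsCompactHolder α H f) (x : EuclideanSpace ℝ (Fin n)) :
    IntegrableOn (fun t : ℝ => t ^ (s - 1) / Real.Gamma s * heatSemigroup t f x) (Ioi 0) :=
  (ContinuousMultilinearMap.apply ℝ (fun _ : Fin 0 => EuclideanSpace ℝ (Fin n)) ℝ
    0).integrable_comp (integrable_rpow_smul_iteratedFDeriv_heatSemigroup (k := 0) hs hsn hα
      (by simp; linarith) hf x)

theorem IsCompactHolder.integrableOn_heatSemigroup_div {s α H : ℝ} (hs : 0 < s)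
    (hsn : s < (n : ℝ) / 2) (hα : 0 < α) {f : EuclideanSpace ℝ (Fin n) → ℝ}
    (hf : IsCompactHolder α H f) (x : EuclideanSpace ℝ (Fin n)) :
    IntegrableOn (fun t : ℝ => heatSemigroup t f x / t ^ (1 - s)) (Ioi 0) := by
  have hG := Real.Gamma_pos_of_pos hs
  have h : IntegrableOn (fun t : ℝ => Real.Gamma s *
      (t ^ (s - 1) / Real.Gamma s * heatSemigroup t f x)) (Ioi 0) :=
    (hf.integrableOn_rpow_mul_heatSemigroup hs hsn hα x).const_mul _
  refine h.congr_fun (fun t ht => ?_) measurableSet_Ioi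
  have ht : 0 < t := ht
  simp only [show s - 1 = -(1 - s) by ring, Real.rpow_neg ht.le]
  field_simp

/-- An integrable majorant of the integrand of `(-Δ)^{-s} f`, uniform in space. -/
theorem IsCompactHolder.exists_bound_rpow_mul_heatSemigroup {s α H : ℝ} (hs : 0 < s)
    (hsn : s < (n : ℝ) / 2) (hα : 0 < α) {f : EuclideanSpace ℝ (Fin n) → ℝ}
    (hf : IsCompactHolder α H f) :
    ∃ b : ℝ → ℝ, IntegrableOn b (Ioi 0) ∧ ∀ t, 0 < t → ∀ x,
      |t ^ (s - 1) / Real.Gamma s * heatSemigroup t f x| ≤ b t := by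
  obtain ⟨b, hb, h⟩ := exists_integrable_bound_rpow_smul_iteratedFDeriv_heatSemigroup (k := 0)
    hs hsn hα (by simp; linarith) hf
  refine ⟨b, hb, fun t ht x => le_trans (le_of_eq ?_) (h t ht x)⟩
  rw [norm_smul, norm_iteratedFDeriv_zero, abs_mul, Real.norm_eq_abs, Real.norm_eq_abs]

theorem IsCompactHolder.tendsto_negPowLaplacian {s α H : ℝ} (hs : 0 < s)
    (hsn : s < (n : ℝ) / 2) (hα : 0 < α) {f : EuclideanSpace ℝ (Fin n) → ℝ}
    (hf : IsCompactHolder α H f) :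
    Tendsto (negPowLaplacian s f) (cocompact (EuclideanSpace ℝ (Fin n))) (𝓝 0) := by
  obtain ⟨b, hb, h⟩ := hf.exists_bound_rpow_mul_heatSemigroup hs hsn hα
  rw [← Metric.cobounded_eq_cocompact, ← comap_norm_atTop]
  have h1 := tendsto_integral_filter_of_dominated_convergence
    (l := comap norm (atTop : Filter ℝ)) (μ := volume.restrict (Ioi (0 : ℝ)))
    (F := fun (x : EuclideanSpace ℝ (Fin n)) t => t ^ (s - 1) / Real.Gamma s * heatSemigroup t f x)
    (f := fun _ => 0) b
    (Eventually.of_forall fun x => (hf.integrableOn_rpow_mul_heatSemigroup hs hsn hα x).1)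
    (Eventually.of_forall fun x => by
      filter_upwards [ae_restrict_mem measurableSet_Ioi] with t ht using h t ht x) hb
    (by
      filter_upwards [ae_restrict_mem measurableSet_Ioi] with t ht
      simpa only [mul_zero] using (tendsto_heatSemigroup_of_norm_atTop ht hf.integrable).const_mul
        (t ^ (s - 1) / Real.Gamma s))
  simpa only [← negPowLaplacian_eq, integral_zero] using h1

end Schauder

/-! ### Removing a truncation -/

section Truncation

/-- For an absolutely convergent integral the truncations recover the full value. It is applied with
ρ the identity in the time variable and with ρ the norm in space. -/
theorem tendsto_setIntegral_lt {X : Type*} [MeasurableSpace X] {μ : Measure X} {g : X → ℝ}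
    {ρ : X → ℝ} (hρ : Measurable ρ) (hg : IntegrableOn g {x | 0 < ρ x} μ) :
    Tendsto (fun ε : ℝ => ∫ x in {x | ε < ρ x}, g x ∂μ) (𝓝[>] 0)
      (𝓝 (∫ x in {x | 0 < ρ x}, g x ∂μ)) := by
  have hm : ∀ ε : ℝ, MeasurableSet {x | ε < ρ x} := fun ε => measurableSet_lt measurable_const hρ
  have h1 := tendsto_integral_filter_of_dominated_convergence (l := 𝓝[>] (0 : ℝ))
    (μ := μ.restrict {x | 0 < ρ x}) (F := fun ε => {x | ε < ρ x}.indicator g) (f := g)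
    (fun x => ‖g x‖)
    (Eventually.of_forall fun ε => hg.aestronglyMeasurable.indicator (hm ε))
    (Eventually.of_forall fun ε => Eventually.of_forall fun x => norm_indicator_le_norm_self _ _)
    hg.norm (by
      filter_upwards [ae_restrict_mem (hm 0)] with x hx
      refine tendsto_const_nhds.congr' ?_
      have hx : 0 < ρ x := hx
      filter_upwards [Ioo_mem_nhdsGT hx] with ε hε
      rw [indicator_of_mem (show x ∈ {x | ε < ρ x} from hε.2)])
  refine h1.congr' ?_
  filter_upwards [self_mem_nhdsWithin] with ε hε
  have hε : 0 < ε := hε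
  rw [integral_indicator (hm ε), Measure.restrict_restrict (hm ε)]
  congr 2
  ext x
  exact ⟨fun h => h.1, fun h => ⟨h, hε.trans h⟩⟩

end Truncation

/-! ### The Marchaud derivative of a Weyl fractional integral -/

section Marchaud

/-- The integrand has the primitive -((v - τ)/τ)^s / (s v), continuous up to τ = v. Since the
integrand is nonnegative, its integrability across the endpoint v follows from that continuity. -/
theorem integral_Ioo_rpow_mul_sub_rpow {s δ v : ℝ} (hs : 0 < s) (hδ : 0 < δ) (hv : δ < v) :
    IntegrableOn (fun τ : ℝ => τ ^ (-1 - s) * (v - τ) ^ (s - 1)) (Ioo δ v) ∧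
      ∫ τ in Ioo δ v, τ ^ (-1 - s) * (v - τ) ^ (s - 1) = ((v - δ) / δ) ^ s / (s * v) := by
  have hv0 : 0 < v := hδ.trans hv
  have hcont : ContinuousOn (fun τ : ℝ => -(((v - τ) / τ) ^ s / (s * v))) (Icc δ v) := by
    refine ((ContinuousOn.rpow_const (ContinuousOn.div (by fun_prop) (by fun_prop) ?_)
      fun _ _ => Or.inr hs.le).div_const _).neg
    intro τ hτ
    exact (hδ.trans_le hτ.1).ne'
  have hder : ∀ τ ∈ Ioo δ v, HasDerivAt (fun τ : ℝ => -(((v - τ) / τ) ^ s / (s * v)))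
      (τ ^ (-1 - s) * (v - τ) ^ (s - 1)) τ := by
    intro τ hτ
    have hτ0 : 0 < τ := hδ.trans hτ.1
    have hτv : 0 < v - τ := sub_pos.2 hτ.2
    have h1 : HasDerivAt (fun τ : ℝ => (v - τ) / τ) ((-1 * τ - (v - τ) * 1) / τ ^ 2) τ := by
      have := ((hasDerivAt_id τ).const_sub v).fun_div (hasDerivAt_id τ) hτ0.ne'
      exact this
    have h2 := ((h1.rpow_const (p := s) (Or.inl (by positivity))).div_const (s * v)).fun_neg
    refine h2.congr_deriv (Eq.symm ?_)
    rw [Real.div_rpow hτv.le hτ0.le, show -1 - s = -(s - 1) - 2 by ring, Real.rpow_sub hτ0,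
      Real.rpow_neg hτ0.le, Real.rpow_two]
    field_simp
    ring
  have hi := intervalIntegral.integrableOn_deriv_of_nonneg hcont hder fun τ hτ =>
    mul_nonneg (Real.rpow_nonneg (hδ.trans hτ.1).le _) (Real.rpow_nonneg (sub_nonneg.2 hτ.2.le) _)
  refine ⟨hi.mono_set Ioo_subset_Ioc_self, ?_⟩
  rw [← integral_Ioc_eq_integral_Ioo, ← intervalIntegral.integral_of_le hv.le,
    intervalIntegral.integral_eq_sub_of_hasDerivAt_of_le hv.le hcont hder
      ((intervalIntegrable_iff_integrableOn_Ioc_of_le hv.le).2 hi)]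
  rw [sub_self, zero_div, Real.zero_rpow hs.ne', zero_div]
  ring

theorem integral_Ioi_comp_add_right (g : ℝ → ℝ) (τ : ℝ) :
    ∫ v in Ioi τ, g v = ∫ t in Ioi (0 : ℝ), g (t + τ) := by
  have h := (measurePreserving_add_right volume τ).setIntegral_preimage_emb
    (measurableEmbedding_addRight τ) g (Ioi τ)
  rw [← h]
  congr 2
  ext t
  simp

theorem integrableOn_Ioi_comp_add_right {g : ℝ → ℝ} {τ : ℝ} :
    IntegrableOn g (Ioi τ) ↔ IntegrableOn (fun t => g (t + τ)) (Ioi 0) := by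
  have h := (measurePreserving_add_right volume τ).integrableOn_comp_preimage
    (measurableEmbedding_addRight τ) (f := g) (s := Ioi τ)
  rw [← h]
  have e : (fun x => x + τ) ⁻¹' Ioi τ = Ioi 0 := by ext t; simp
  rw [e]; rfl

variable {φ b : ℝ → ℝ} {s : ℝ}

theorem integrableOn_rpow_mul_comp_add (hφ : Measurable φ)
    (hb : IntegrableOn (fun t => t ^ (s - 1) * b t) (Ioi 0))
    (hφb : ∀ t τ, 0 < t → 0 ≤ τ → |φ (t + τ)| ≤ b t) {τ : ℝ} (hτ : 0 ≤ τ) :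
    IntegrableOn (fun t => t ^ (s - 1) * φ (t + τ)) (Ioi 0) := by
  refine Integrable.mono' hb (Measurable.aestronglyMeasurable (by fun_prop)) ?_
  filter_upwards [ae_restrict_mem measurableSet_Ioi] with t ht
  rw [norm_mul, Real.norm_of_nonneg (Real.rpow_nonneg (le_of_lt ht) _)]
  exact mul_le_mul_of_nonneg_left (hφb t τ ht hτ) (Real.rpow_nonneg (le_of_lt ht) _)

theorem abs_integral_rpow_mul_comp_add_le
    (hb : IntegrableOn (fun t => t ^ (s - 1) * b t) (Ioi 0))
    (hφb : ∀ t τ, 0 < t → 0 ≤ τ → |φ (t + τ)| ≤ b t) {τ : ℝ} (hτ : 0 ≤ τ) :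
    ∫ t in Ioi 0, |t ^ (s - 1) * φ (t + τ)| ≤ ∫ t in Ioi 0, t ^ (s - 1) * b t := by
  by_cases h : IntegrableOn (fun t => |t ^ (s - 1) * φ (t + τ)|) (Ioi 0)
  · refine setIntegral_mono_on h hb measurableSet_Ioi fun t ht => ?_
    rw [abs_mul, abs_of_nonneg (Real.rpow_nonneg (le_of_lt ht) _)]
    exact mul_le_mul_of_nonneg_left (hφb t τ ht hτ) (Real.rpow_nonneg (le_of_lt ht) _)
  -- Without integrability the left side is 0 by convention, and b ≥ 0 because it dominates |φ|.
  · rw [integral_undef h]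
    refine setIntegral_nonneg measurableSet_Ioi fun t ht => ?_
    have ht : 0 < t := ht
    have := (abs_nonneg _).trans (hφb t 0 ht le_rfl)
    positivity

/-- Fubini for the truncated Marchaud integral of a Weyl fractional integral. -/
theorem integral_rpow_mul_weyl (hs : 0 < s) (hφ : Measurable φ)
    (hb : IntegrableOn (fun t => t ^ (s - 1) * b t) (Ioi 0))
    (hφb : ∀ t τ, 0 < t → 0 ≤ τ → |φ (t + τ)| ≤ b t) {δ : ℝ} (hδ : 0 < δ) :
    IntegrableOn (fun τ => τ ^ (-1 - s) * ∫ t in Ioi 0, t ^ (s - 1) * φ (t + τ)) (Ioi δ) ∧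
    IntegrableOn (fun v => φ v * (((v - δ) / δ) ^ s / (s * v))) (Ioi δ) ∧
    ∫ τ in Ioi δ, τ ^ (-1 - s) * ∫ t in Ioi 0, t ^ (s - 1) * φ (t + τ) =
      ∫ v in Ioi δ, φ v * (((v - δ) / δ) ^ s / (s * v)) := by
  -- With v = t + τ the double integral lives on δ < τ < v. Slices in v are the Weyl integrals;
  -- slices in τ are the explicit integral over (δ, v).
  set A : Set (ℝ × ℝ) := {p | δ < p.1 ∧ p.1 < p.2} with hA
  have hAm : MeasurableSet A := (measurableSet_lt measurable_const measurable_fst).inter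
    (measurableSet_lt measurable_fst measurable_snd)
  set G : ℝ × ℝ → ℝ := fun p => p.1 ^ (-1 - s) * (p.2 - p.1) ^ (s - 1) * φ p.2 with hG
  have hGm : Measurable G := by fun_prop
  have e1 : ∀ τ, (fun v => A.indicator G (τ, v)) =
      if δ < τ then (Ioi τ).indicator (fun v => τ ^ (-1 - s) * ((v - τ) ^ (s - 1) * φ v)) else 0 := by
    intro τ
    funext v
    by_cases h1 : δ < τ <;> by_cases h2 : τ < v <;> simp [hA, hG, indicator, h1, h2, mul_assoc]
  have e2 : ∀ v, (fun τ => A.indicator G (τ, v)) =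
      (Ioo δ v).indicator (fun τ => φ v * (τ ^ (-1 - s) * (v - τ) ^ (s - 1))) := by
    intro v
    funext τ
    by_cases h1 : δ < τ <;> by_cases h2 : τ < v <;> simp [hA, hG, indicator, h1, h2, mul_comm]
  have hint : ∀ τ, δ < τ → IntegrableOn (fun v => (v - τ) ^ (s - 1) * φ v) (Ioi τ) := by
    intro τ hτ
    rw [integrableOn_Ioi_comp_add_right]
    simp only [add_sub_cancel_right]
    exact integrableOn_rpow_mul_comp_add hφ hb hφb (hδ.trans hτ).le
  have hI : Integrable (A.indicator G) (volume.prod volume) := by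
    rw [integrable_prod_iff (hGm.indicator hAm).aestronglyMeasurable]
    constructor
    · refine Eventually.of_forall fun τ => ?_
      rw [e1]
      split_ifs with h1
      · exact (integrable_indicator_iff measurableSet_Ioi).2 ((hint τ h1).const_mul _)
      · exact integrable_zero _ _ _
    · have h1 : Integrable ((Ioi δ).indicator fun τ : ℝ => τ ^ (-1 - s) *
          ∫ t in Ioi 0, t ^ (s - 1) * b t) := by
        rw [integrable_indicator_iff measurableSet_Ioi]
        exact Integrable.mul_const (integrableOn_Ioi_rpow_of_lt (by linarith) hδ) _
      refine h1.mono' ((hGm.indicator hAm).norm.stronglyMeasurable.integral_prod_right').aestronglyMeasurable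
        (Eventually.of_forall fun τ => ?_)
      rw [Real.norm_of_nonneg (integral_nonneg fun _ => norm_nonneg _)]
      have e3 : (fun v => ‖A.indicator G (τ, v)‖) = fun v => ‖(fun v => A.indicator G (τ, v)) v‖ := rfl
      rw [e3, e1]
      by_cases h2 : δ < τ
      · have hτ : 0 < τ := hδ.trans h2
        rw [indicator_of_mem (show τ ∈ Ioi δ from h2), if_pos h2]
        simp only [norm_indicator_eq_indicator_norm]
        rw [integral_indicator measurableSet_Ioi]
        simp only [norm_mul (τ ^ (-1 - s))]
        rw [integral_const_mul, Real.norm_of_nonneg (by positivity)]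
        refine mul_le_mul_of_nonneg_left ?_ (by positivity)
        rw [integral_Ioi_comp_add_right]
        simp only [add_sub_cancel_right, Real.norm_eq_abs]
        exact abs_integral_rpow_mul_comp_add_le hb hφb hτ.le
      · rw [indicator_of_notMem (show τ ∉ Ioi δ from h2), if_neg h2]
        simp
  have e4 : ∀ τ, ∫ v, A.indicator G (τ, v) =
      (Ioi δ).indicator (fun τ => τ ^ (-1 - s) * ∫ t in Ioi 0, t ^ (s - 1) * φ (t + τ)) τ := by
    intro τ
    rw [e1]
    by_cases h2 : δ < τ
    · rw [indicator_of_mem (show τ ∈ Ioi δ from h2), if_pos h2, integral_indicator measurableSet_Ioi,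
        integral_const_mul, integral_Ioi_comp_add_right]
      simp only [add_sub_cancel_right]
    · rw [indicator_of_notMem (show τ ∉ Ioi δ from h2), if_neg h2]
      simp
  have e5 : ∀ v, ∫ τ, A.indicator G (τ, v) =
      (Ioi δ).indicator (fun v => φ v * (((v - δ) / δ) ^ s / (s * v))) v := by
    intro v
    rw [e2, integral_indicator measurableSet_Ioo, integral_const_mul]
    by_cases h2 : δ < v
    · rw [indicator_of_mem (show v ∈ Ioi δ from h2), (integral_Ioo_rpow_mul_sub_rpow hs hδ h2).2]
    · rw [indicator_of_notMem (show v ∉ Ioi δ from h2), Ioo_eq_empty h2]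
      simp
  refine ⟨?_, ?_, ?_⟩
  · have := hI.integral_prod_left
    simp only [e4] at this
    exact (integrable_indicator_iff measurableSet_Ioi).1 this
  · have := hI.integral_prod_right
    simp only [e5] at this
    exact (integrable_indicator_iff measurableSet_Ioi).1 this
  · have := integral_integral_swap (f := fun τ v => A.indicator G (τ, v)) hI
    simp only [e4, e5] at this
    rwa [integral_indicator measurableSet_Ioi, integral_indicator measurableSet_Ioi] at this

/-- The approximate identity that arises from the Marchaud derivative of a Weyl integral. -/
noncomputable def marchaudKernel (s r : ℝ) : ℝ := (r ^ s - (max (r - 1) 0) ^ s) / (s * r)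

theorem measurable_marchaudKernel : Measurable (marchaudKernel s) := by
  unfold marchaudKernel
  fun_prop

/-- For r > 1, Bernoulli in the form (1 - 1/r)^s ≥ 1 - 1/r gives r^s - (r-1)^s ≤ r^(s-1), so the
kernel is O(r^(s-2)) at infinity; near 0 it is at most r^(s-1)/s. -/
theorem abs_marchaudKernel_le (hs : 0 < s) (hs1 : s < 1) {r : ℝ} (hr : 0 < r) :
    |marchaudKernel s r| ≤ if r ≤ 1 then 1 / s * r ^ (s - 1) else 1 / s * r ^ (-(1 - s) - 1) := by
  have h0 : max (r - 1) 0 ≤ r := max_le (by linarith) hr.le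
  have h1 : (max (r - 1) 0) ^ s ≤ r ^ s := Real.rpow_le_rpow (le_max_right _ _) h0 hs.le
  have h2 : 0 ≤ (max (r - 1) 0) ^ s := Real.rpow_nonneg (le_max_right _ _) _
  rw [marchaudKernel, abs_of_nonneg (div_nonneg (by linarith) (by positivity))]
  split_ifs with h
  · rw [Real.rpow_sub_one hr.ne', one_div_mul_eq_div, div_div, mul_comm r s]
    exact div_le_div_of_nonneg_right (by linarith) (by positivity)
  · rw [not_le] at h
    have h3 : r ^ s - r ^ (s - 1) ≤ (max (r - 1) 0) ^ s := by
      rw [max_eq_left (by linarith)]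
      have h4 : (0 : ℝ) ≤ 1 - 1 / r := by
        rw [sub_nonneg, div_le_one hr]; exact h.le
      have h5 : (1 - 1 / r) ≤ (1 - 1 / r) ^ s := by
        have h6 : 1 - 1 / r ≤ 1 := by
          have : 0 < 1 / r := by positivity
          linarith
        simpa using Real.rpow_le_rpow_of_exponent_ge' h4 h6 hs.le hs1.le
      calc r ^ s - r ^ (s - 1) = r ^ s * (1 - 1 / r) := by
            rw [Real.rpow_sub_one hr.ne']; ring
        _ ≤ r ^ s * (1 - 1 / r) ^ s := mul_le_mul_of_nonneg_left h5 (by positivity)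
        _ = (r - 1) ^ s := by
            rw [← Real.mul_rpow hr.le h4]; congr 1; field_simp
    rw [show -(1 - s) - 1 = s - 1 - 1 by ring, Real.rpow_sub_one hr.ne', one_div_mul_eq_div, div_div,
      mul_comm r s]
    exact div_le_div_of_nonneg_right (by linarith) (by positivity)

theorem integrableOn_marchaudKernel (hs : 0 < s) (hs1 : s < 1) :
    IntegrableOn (marchaudKernel s) (Ioi 0) := by
  refine Integrable.mono' (integrableOn_Ioi_ite_rpow (1 / s) (1 / s) hs (sub_pos.2 hs1) one_pos).1
    measurable_marchaudKernel.aestronglyMeasurable ?_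
  filter_upwards [ae_restrict_mem measurableSet_Ioi] with r hr
  exact abs_marchaudKernel_le hs hs1 hr

/-- The constant term contributes δ^(-s)/s times ∫ t^(s-1) φ and the shifted term is given by
Fubini. The substitution v = δ r then makes the kernel independent of δ, so that δ only rescales φ.
-/
theorem integral_marchaud_eq (hs : 0 < s) (hφ : Measurable φ)
    (hb : IntegrableOn (fun t => t ^ (s - 1) * b t) (Ioi 0))
    (hφb : ∀ t τ, 0 < t → 0 ≤ τ → |φ (t + τ)| ≤ b t) {δ : ℝ} (hδ : 0 < δ) :
    ∫ τ in Ioi δ, τ ^ (-1 - s) * ((∫ t in Ioi 0, t ^ (s - 1) * φ t) -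
        ∫ t in Ioi 0, t ^ (s - 1) * φ (t + τ)) =
      ∫ r in Ioi 0, φ (δ * r) * marchaudKernel s r := by
  obtain ⟨h1, h2, h3⟩ := integral_rpow_mul_weyl hs hφ hb hφb hδ
  have h4 : IntegrableOn (fun t => t ^ (s - 1) * φ t) (Ioi 0) := by
    simpa using integrableOn_rpow_mul_comp_add hφ hb hφb le_rfl
  have h5 : IntegrableOn (fun τ : ℝ => τ ^ (-1 - s)) (Ioi δ) :=
    integrableOn_Ioi_rpow_of_lt (by linarith) hδ
  have h6 := integral_comp_mul_left_Ioi (fun v => δ⁻¹ * (φ v * marchaudKernel s (v / δ))) 0 hδ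
  simp only [mul_zero, smul_eq_mul, mul_div_cancel_left₀ _ hδ.ne'] at h6
  rw [integral_const_mul, integral_const_mul] at h6
  have h7 := mul_left_cancel₀ (inv_ne_zero hδ.ne') h6
  rw [h7]
  simp only [mul_sub]
  rw [integral_sub (Integrable.mul_const h5 _) h1, h3, integral_mul_const,
    integral_Ioi_rpow_of_lt (by linarith) hδ, ← integral_const_mul]
  have h8 : ∫ v in Ioi δ, φ v * (((v - δ) / δ) ^ s / (s * v)) =
      ∫ v in Ioi 0, (Ioi δ).indicator (fun v => φ v * (((v - δ) / δ) ^ s / (s * v))) v := by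
    rw [setIntegral_indicator measurableSet_Ioi, Ioi_inter_Ioi, max_eq_right hδ.le]
  have h9 : IntegrableOn ((Ioi δ).indicator (fun v => φ v * (((v - δ) / δ) ^ s / (s * v))))
      (Ioi 0) := ((integrable_indicator_iff measurableSet_Ioi).2 h2).integrableOn
  rw [h8, ← integral_const_mul, ← integral_sub (h4.const_mul _) h9]
  refine setIntegral_congr_fun measurableSet_Ioi fun v hv => ?_
  have hv : 0 < v := hv
  simp only [marchaudKernel]
  have e1 : -δ ^ (-1 - s + 1) / (-1 - s + 1) = (δ ^ s)⁻¹ / s := by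
    rw [show -1 - s + 1 = -s by ring, Real.rpow_neg hδ.le, neg_div_neg_eq]
  rw [e1, Real.rpow_sub_one hv.ne', Real.div_rpow hv.le hδ.le]
  by_cases h : δ < v
  · rw [indicator_of_mem (show v ∈ Ioi δ from h),
      max_eq_left (by rw [sub_nonneg, one_le_div hδ]; exact h.le),
      show v / δ - 1 = (v - δ) / δ by field_simp]
    field_simp
  · rw [indicator_of_notMem (show v ∉ Ioi δ from h), max_eq_right
      (by rw [sub_nonpos, div_le_one hδ]; exact not_lt.1 h), Real.zero_rpow hs.ne']
    field_simp
    ring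

theorem tendsto_integral_comp_mul_marchaudKernel (hs : 0 < s) (hs1 : s < 1) (hφ : Measurable φ)
    {M φ₀ : ℝ} (hM : ∀ t, 0 < t → |φ t| ≤ M) (hφ₀ : Tendsto φ (𝓝[>] 0) (𝓝 φ₀)) :
    Tendsto (fun δ => ∫ r in Ioi 0, φ (δ * r) * marchaudKernel s r) (𝓝[>] 0)
      (𝓝 (φ₀ * ∫ r in Ioi 0, marchaudKernel s r)) := by
  rw [← integral_const_mul]
  refine tendsto_integral_filter_of_dominated_convergence (fun r => M * ‖marchaudKernel s r‖)
    (Eventually.of_forall fun δ => ?_) ?_ ((integrableOn_marchaudKernel hs hs1).norm.const_mul M) ?_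
  · have := measurable_marchaudKernel (s := s)
    exact Measurable.aestronglyMeasurable (by fun_prop)
  · filter_upwards [self_mem_nhdsWithin] with δ hδ
    filter_upwards [ae_restrict_mem measurableSet_Ioi] with r hr
    rw [norm_mul]
    exact mul_le_mul_of_nonneg_right (hM _ (mul_pos hδ hr)) (norm_nonneg _)
  · filter_upwards [ae_restrict_mem measurableSet_Ioi] with r hr
    refine Tendsto.mul_const _ (hφ₀.comp ?_)
    refine tendsto_nhdsWithin_iff.2 ⟨?_, ?_⟩
    · have : Tendsto (fun δ : ℝ => δ * r) (𝓝 0) (𝓝 (0 * r)) :=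
        (continuous_mul_const r).tendsto 0
      rw [zero_mul] at this
      exact this.mono_left nhdsWithin_le_nhds
    · filter_upwards [self_mem_nhdsWithin] with δ hδ using mul_pos (mem_Ioi.1 hδ) (mem_Ioi.1 hr)

/-- Both sides are limits of the same truncation as δ → 0: one by absolute convergence, the other
because the rescaled kernel is an approximate identity up to its mass. -/
theorem integral_marchaud_eq_mul (hs : 0 < s) (hs1 : s < 1) (hφ : Measurable φ)
    (hb : IntegrableOn (fun t => t ^ (s - 1) * b t) (Ioi 0))
    (hφb : ∀ t τ, 0 < t → 0 ≤ τ → |φ (t + τ)| ≤ b t)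
    {M φ₀ : ℝ} (hM : ∀ t, 0 < t → |φ t| ≤ M) (hφ₀ : Tendsto φ (𝓝[>] 0) (𝓝 φ₀))
    (hint : IntegrableOn (fun τ => τ ^ (-1 - s) * ((∫ t in Ioi 0, t ^ (s - 1) * φ t) -
        ∫ t in Ioi 0, t ^ (s - 1) * φ (t + τ))) (Ioi 0)) :
    ∫ τ in Ioi 0, τ ^ (-1 - s) * ((∫ t in Ioi 0, t ^ (s - 1) * φ t) -
        ∫ t in Ioi 0, t ^ (s - 1) * φ (t + τ)) = φ₀ * ∫ r in Ioi 0, marchaudKernel s r := by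
  refine tendsto_nhds_unique (tendsto_setIntegral_lt (ρ := id) measurable_id hint) ?_
  refine (tendsto_integral_comp_mul_marchaudKernel hs hs1 hφ hM hφ₀).congr' ?_
  filter_upwards [self_mem_nhdsWithin] with δ hδ
  exact (integral_marchaud_eq hs hφ hb hφb hδ).symm

/-- Integration by parts: (1 - e^(-τ)) τ^(-s) vanishes at both ends, and its derivative is the
integrand of Γ(1 - s) minus s times the integrand in question. -/
theorem integral_one_sub_exp_neg_mul_rpow (hs : 0 < s) (hs1 : s < 1) :
    IntegrableOn (fun τ : ℝ => τ ^ (-1 - s) * (1 - Real.exp (-τ))) (Ioi 0) ∧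
      ∫ τ in Ioi 0, τ ^ (-1 - s) * (1 - Real.exp (-τ)) = Real.Gamma (1 - s) / s := by
  have hi : IntegrableOn (fun τ : ℝ => τ ^ (-1 - s) * (1 - Real.exp (-τ))) (Ioi 0) := by
    refine Integrable.mono' (integrableOn_Ioi_ite_rpow 1 1 (sub_pos.2 hs1) hs one_pos).1
      (Measurable.aestronglyMeasurable (by fun_prop)) ?_
    filter_upwards [ae_restrict_mem measurableSet_Ioi] with t ht
    have ht : 0 < t := ht
    have h1 : 0 ≤ 1 - Real.exp (-t) := by
      rw [sub_nonneg, Real.exp_le_one_iff]; linarith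
    rw [Real.norm_of_nonneg (by positivity)]
    split_ifs with h
    · rw [one_mul, show 1 - s - 1 = (-1 - s) + 1 by ring, Real.rpow_add_one ht.ne']
      refine mul_le_mul_of_nonneg_left ?_ (by positivity)
      have := Real.add_one_le_exp (-t)
      linarith
    · rw [one_mul, show -s - 1 = -1 - s by ring]
      refine mul_le_of_le_one_right (by positivity) ?_
      have := Real.exp_pos (-t)
      linarith
  refine ⟨hi, ?_⟩
  have hg : IntegrableOn (fun τ : ℝ => Real.exp (-τ) * τ ^ ((1 - s) - 1)) (Ioi 0) :=
    Real.GammaIntegral_convergent (sub_pos.2 hs1)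
  have hF : ∀ τ ∈ Ioi (0 : ℝ), HasDerivAt (fun τ : ℝ => (1 - Real.exp (-τ)) * τ ^ (-s))
      (Real.exp (-τ) * τ ^ ((1 - s) - 1) - s * (τ ^ (-1 - s) * (1 - Real.exp (-τ)))) τ := by
    intro τ hτ
    have hτ : 0 < τ := hτ
    have h1 : HasDerivAt (fun τ : ℝ => 1 - Real.exp (-τ)) (Real.exp (-τ)) τ := by
      have := ((hasDerivAt_id τ).neg.exp).const_sub 1
      simpa using this
    have h2 := h1.fun_mul (Real.hasDerivAt_rpow_const (p := -s) (Or.inl hτ.ne'))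
    refine h2.congr_deriv (Eq.symm ?_)
    rw [show 1 - s - 1 = -s by ring, show -1 - s = -s - 1 by ring]
    ring
  have hlim0 : Tendsto (fun τ : ℝ => (1 - Real.exp (-τ)) * τ ^ (-s)) (𝓝[>] 0) (𝓝 0) := by
    have h1 : Tendsto (fun τ : ℝ => τ ^ (1 - s)) (𝓝[>] 0) (𝓝 0) := by
      have := (Real.continuousAt_rpow_const 0 (1 - s) (Or.inr (by linarith))).tendsto
      rw [Real.zero_rpow (by linarith)] at this
      exact this.mono_left nhdsWithin_le_nhds
    refine squeeze_zero' ?_ ?_ h1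
    · filter_upwards [self_mem_nhdsWithin] with τ hτ
      have hτ : 0 < τ := hτ
      have h1 : 0 ≤ 1 - Real.exp (-τ) := by
        rw [sub_nonneg, Real.exp_le_one_iff]; linarith
      positivity
    · filter_upwards [self_mem_nhdsWithin] with τ hτ
      have hτ : 0 < τ := hτ
      rw [show 1 - s = -s + 1 by ring, Real.rpow_add_one hτ.ne', mul_comm]
      refine mul_le_mul_of_nonneg_left ?_ (by positivity)
      have := Real.add_one_le_exp (-τ)
      linarith
  have hliminf : Tendsto (fun τ : ℝ => (1 - Real.exp (-τ)) * τ ^ (-s)) atTop (𝓝 0) := by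
    have h1 := (tendsto_const_nhds (x := (1 : ℝ))).sub (Real.tendsto_exp_neg_atTop_nhds_zero)
    simpa using h1.mul (tendsto_rpow_neg_atTop hs)
  have h3 := integral_Ioi_of_hasDerivAt_of_tendsto (continuousWithinAt_Ioi_iff_Ici.1
    (by simpa [ContinuousWithinAt] using hlim0)) hF (hg.sub (hi.const_mul s)) hliminf
  rw [integral_sub hg (hi.const_mul s), integral_const_mul,
    ← Real.Gamma_eq_integral (sub_pos.2 hs1)] at h3
  simp only [neg_zero, Real.exp_zero, sub_self, zero_mul] at h3
  rw [eq_div_iff hs.ne']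
  linarith

/-- The mass is read off from the test function φ(t) = e^(-t), whose Weyl integral is Γ(s) e^(-τ).
-/
theorem integral_marchaudKernel (hs : 0 < s) (hs1 : s < 1) :
    ∫ r in Ioi 0, marchaudKernel s r = Real.Gamma s * (Real.Gamma (1 - s) / s) := by
  have hg : ∀ τ : ℝ, ∫ t in Ioi 0, t ^ (s - 1) * Real.exp (-(t + τ)) =
      Real.Gamma s * Real.exp (-τ) := by
    intro τ
    rw [Real.Gamma_eq_integral hs, ← integral_mul_const]
    refine integral_congr_ae (Eventually.of_forall fun t => ?_)
    simp only [neg_add, Real.exp_add]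
    ring
  have hg0 := hg 0
  simp only [add_zero, neg_zero, Real.exp_zero, mul_one] at hg0
  obtain ⟨hi, hval⟩ := integral_one_sub_exp_neg_mul_rpow hs hs1
  have e : ∀ τ : ℝ, τ ^ (-1 - s) * (Real.Gamma s - Real.Gamma s * Real.exp (-τ)) =
      Real.Gamma s * (τ ^ (-1 - s) * (1 - Real.exp (-τ))) := fun τ => by ring
  have h := integral_marchaud_eq_mul (φ := fun t => Real.exp (-t)) (b := fun t => Real.exp (-t))
    (M := 1) (φ₀ := 1) hs hs1 (by fun_prop)
    (by simpa only [mul_comm] using Real.GammaIntegral_convergent hs)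
    (fun t τ ht hτ => by
      rw [abs_of_pos (Real.exp_pos _)]; exact Real.exp_le_exp.2 (by linarith))
    (fun t ht => by
      rw [abs_of_pos (Real.exp_pos _), Real.exp_le_one_iff]; linarith)
    (by
      have : Continuous fun t : ℝ => Real.exp (-t) := by fun_prop
      have h := this.tendsto 0
      rw [neg_zero, Real.exp_zero] at h
      exact h.mono_left nhdsWithin_le_nhds)
    (by simp only [hg, hg0, e]; exact hi.const_mul _)
  simp only [hg, hg0, e] at h
  rw [integral_const_mul, hval, one_mul] at h
  exact h.symm

end Marchaud

/-! ### The potential solves the equation -/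

section Equation

variable {n : ℕ}

/-- Beyond distance 1 the sup bound replaces the Hölder bound, hence the factor 2. Qualitative
statements can thus be proved with α as small as convenient. -/
theorem IsCompactHolder.mono {α β H : ℝ} (hβ : 0 < β) (hβα : β ≤ α)
    {f : EuclideanSpace ℝ (Fin n) → ℝ} (hf : IsCompactHolder α H f) :
    IsCompactHolder β (2 * H) f := by
  have hH := hf.nonneg
  refine ⟨hf.continuous, hf.hasCompactSupport, by linarith,
    fun x => (hf.bound x).trans (by linarith), fun x y => ?_⟩
  rcases le_or_gt ‖x - y‖ 1 with h | h
  · have h1 : ‖x - y‖ ^ α ≤ ‖x - y‖ ^ β :=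
      Real.rpow_le_rpow_of_exponent_ge' (norm_nonneg _) h hβ.le hβα
    calc |f x - f y| ≤ H * ‖x - y‖ ^ α := hf.holder x y
      _ ≤ H * ‖x - y‖ ^ β := mul_le_mul_of_nonneg_left h1 hH
      _ ≤ 2 * H * ‖x - y‖ ^ β := mul_le_mul_of_nonneg_right (by linarith) (by positivity)
  · have h1 : 1 ≤ ‖x - y‖ ^ β := Real.one_le_rpow h.le hβ.le
    calc |f x - f y| ≤ |f x| + |f y| := abs_sub _ _
      _ ≤ H + H := add_le_add (hf.bound x) (hf.bound y)
      _ = 2 * H * 1 := by ring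
      _ ≤ 2 * H * ‖x - y‖ ^ β := mul_le_mul_of_nonneg_left h1 (by positivity)

/-- Fubini and the semigroup law: applying e^{τΔ} to the potential shifts time by τ under the
integral, which produces a Weyl fractional integral. -/
theorem heatSemigroup_negPowLaplacian {s α H : ℝ} (hs : 0 < s) (hsn : s < (n : ℝ) / 2)
    (hα : 0 < α) {f : EuclideanSpace ℝ (Fin n) → ℝ} (hf : IsCompactHolder α H f) {τ : ℝ}
    (hτ : 0 < τ) (x : EuclideanSpace ℝ (Fin n)) :
    heatSemigroup τ (negPowLaplacian s f) x =
      (∫ t in Ioi 0, t ^ (s - 1) * heatSemigroup (t + τ) f x) / Real.Gamma s := by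
  obtain ⟨b, hb, hbd⟩ := hf.exists_bound_rpow_mul_heatSemigroup hs hsn hα
  have hi : Integrable (Function.uncurry fun (z : EuclideanSpace ℝ (Fin n)) (t : ℝ) =>
      heatKernel τ (x - z) * (t ^ (s - 1) / Real.Gamma s * heatSemigroup t f z))
      (volume.prod (volume.restrict (Ioi 0))) := by
    have h1 : Integrable (fun p : EuclideanSpace ℝ (Fin n) × ℝ => heatKernel τ (x - p.1) * b p.2)
        (volume.prod (volume.restrict (Ioi 0))) :=
      ((integrable_heatKernel hτ).comp_sub_left x).mul_prod hb
    refine h1.mono' ?_ ?_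
    · refine Measurable.aestronglyMeasurable (Measurable.mul ?_ (Measurable.mul ?_ ?_))
      · exact continuous_heatKernel.measurable.comp (measurable_const.sub measurable_fst)
      · fun_prop
      · exact (stronglyMeasurable_heatSemigroup_uncurry hf.continuous).measurable.comp
          (measurable_snd.prodMk measurable_fst)
    · have h2 : ∀ᵐ p ∂((volume : Measure (EuclideanSpace ℝ (Fin n))).prod
          (volume.restrict (Ioi (0 : ℝ)))), p.2 ∈ Ioi (0 : ℝ) :=
        Measure.quasiMeasurePreserving_snd.ae (ae_restrict_mem measurableSet_Ioi)
      filter_upwards [h2] with p hp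
      simp only [Function.uncurry]
      rw [norm_mul, Real.norm_of_nonneg (heatKernel_nonneg hτ _)]
      exact mul_le_mul_of_nonneg_left (hbd p.2 hp p.1) (heatKernel_nonneg hτ _)
  have e : heatSemigroup τ (negPowLaplacian s f) x = ∫ z, ∫ t in Ioi 0,
      heatKernel τ (x - z) * (t ^ (s - 1) / Real.Gamma s * heatSemigroup t f z) := by
    rw [heatSemigroup]
    simp only [negPowLaplacian_eq, integral_const_mul]
  rw [e, integral_integral_swap hi, ← integral_div]
  refine setIntegral_congr_fun measurableSet_Ioi fun t ht => ?_
  simp only [mul_left_comm (heatKernel τ _)]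
  rw [integral_const_mul, heatSemigroup_add ht hτ hf.integrable]
  ring

/-- The semigroup contracts the sup norm, so a majorant uniform in space at time t dominates all
later times as well. -/
theorem IsCompactHolder.exists_bound_heatSemigroup_add {s α H : ℝ} (hs : 0 < s)
    (hsn : s < (n : ℝ) / 2) (hα : 0 < α) {f : EuclideanSpace ℝ (Fin n) → ℝ}
    (hf : IsCompactHolder α H f) (x : EuclideanSpace ℝ (Fin n)) :
    ∃ b : ℝ → ℝ, IntegrableOn (fun t => t ^ (s - 1) * b t) (Ioi 0) ∧
      ∀ t τ, 0 < t → 0 ≤ τ → |heatSemigroup (t + τ) f x| ≤ b t := by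
  have hG := Real.Gamma_pos_of_pos hs
  obtain ⟨b, hb, hbd⟩ := hf.exists_bound_rpow_mul_heatSemigroup hs hsn hα
  have h1 : ∀ t, 0 < t → ∀ y, |heatSemigroup t f y| ≤ Real.Gamma s * b t / t ^ (s - 1) := by
    intro t ht y
    have h := hbd t ht y
    rw [abs_mul, abs_of_pos (by positivity)] at h
    rw [le_div_iff₀ (by positivity)]
    rw [div_mul_eq_mul_div, div_le_iff₀ hG] at h
    linarith
  refine ⟨fun t => Real.Gamma s * b t / t ^ (s - 1), ?_, fun t τ ht hτ => ?_⟩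
  · have h2 : IntegrableOn (fun t => Real.Gamma s * b t) (Ioi 0) := Integrable.const_mul hb _
    refine h2.congr_fun (fun t ht => ?_) measurableSet_Ioi
    have ht : 0 < t := ht
    have : 0 < t ^ (s - 1) := by positivity
    field_simp
  · rcases hτ.eq_or_lt with rfl | hτ
    · rw [add_zero]; exact h1 t ht x
    · rw [← heatSemigroup_add ht hτ hf.integrable]
      exact abs_heatSemigroup_le hτ (h1 t ht) x

/-- The subordination formula for the kernel of the fractional Laplacian. -/
theorem integral_rpow_mul_heatKernel {s : ℝ} (hs : 0 < s) {y : EuclideanSpace ℝ (Fin n)}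
    (hy : y ≠ 0) :
    ∫ τ in Ioi 0, τ ^ (-1 - s) * heatKernel τ y =
      4 ^ s * Real.Gamma ((n : ℝ) / 2 + s) / Real.pi ^ ((n : ℝ) / 2) /
        ‖y‖ ^ ((n : ℝ) + 2 * s) := by
  have hpi := Real.pi_pos
  have hy0 : 0 < ‖y‖ := norm_pos_iff.2 hy
  set a := (n : ℝ) / 2 + s with ha
  have ha0 : 0 < a := by positivity
  set r := ‖y‖ ^ 2 / 4 with hr
  have hr0 : 0 < r := by positivity
  -- The inversion τ = 1/v turns the integral into a Gamma integral with exponent n/2 + s and rate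
  -- |y|²/4.
  have h := integral_comp_rpow_Ioi (fun v : ℝ => v ^ (a - 1) * Real.exp (-(r * v)))
    (p := -1) (by norm_num)
  rw [Real.integral_rpow_mul_exp_neg_mul_Ioi ha0 hr0] at h
  have e : ∀ τ ∈ Ioi (0 : ℝ), τ ^ (-1 - s) * heatKernel τ y = (4 * Real.pi) ^ (-((n : ℝ) / 2)) *
      ((|(-1 : ℝ)| * τ ^ ((-1 : ℝ) - 1)) • ((τ ^ (-1 : ℝ)) ^ (a - 1) *
        Real.exp (-(r * τ ^ (-1 : ℝ))))) := by
    intro τ hτ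
    have hτ : 0 < τ := hτ
    rw [heatKernel_eq hτ, Real.mul_rpow (x := 4 * Real.pi) (by positivity) hτ.le, abs_neg, abs_one,
      one_mul, smul_eq_mul, ← Real.rpow_mul hτ.le]
    have e1 : τ ^ ((-1 : ℝ) - 1) * (τ ^ (-1 * (a - 1)) * Real.exp (-(r * τ ^ (-1 : ℝ)))) =
        τ ^ (-1 - s) * τ ^ (-((n : ℝ) / 2)) * Real.exp (-(r * τ ^ (-1 : ℝ))) := by
      rw [← mul_assoc, ← Real.rpow_add hτ, ← Real.rpow_add hτ]
      congr 2
      rw [ha]; ring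
    have e2 : -‖y‖ ^ 2 / (4 * τ) = -(r * τ ^ (-1 : ℝ)) := by
      rw [hr, Real.rpow_neg_one]; field_simp
    rw [e1, e2]
    ring
  rw [setIntegral_congr_fun measurableSet_Ioi e, integral_const_mul, h]
  have e3 : (1 / r) ^ a = 4 ^ ((n : ℝ) / 2) * 4 ^ s / ‖y‖ ^ ((n : ℝ) + 2 * s) := by
    rw [hr, one_div_div, Real.div_rpow (by norm_num) (by positivity), ← Real.rpow_natCast,
      ← Real.rpow_mul hy0.le, ha, Real.rpow_add (by norm_num)]
    congr 2
    push_cast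
    ring
  rw [e3, Real.rpow_neg (by positivity), Real.mul_rpow (by norm_num) hpi.le]
  field_simp

/-- The kernel is even with mass 1, so u(x + y) and u(x - y) have the same average, namely
e^{τΔ}u(x). -/
theorem integral_second_diff_mul_heatKernel {τ : ℝ} (hτ : 0 < τ)
    {u : EuclideanSpace ℝ (Fin n) → ℝ} (hu : Continuous u) {A : ℝ} (hA : ∀ x, |u x| ≤ A)
    (x : EuclideanSpace ℝ (Fin n)) :
    ∫ y, (2 * u x - u (x + y) - u (x - y)) * heatKernel τ y = 2 * (u x - heatSemigroup τ u x) := by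
  have h1 : Integrable fun y => heatKernel τ y * u (x - y) := integrable_heatKernel_mul hτ
    (hu.comp (continuous_const.sub continuous_id)).aestronglyMeasurable fun y => hA _
  have h2 : Integrable fun y => heatKernel τ y * u (x + y) := integrable_heatKernel_mul hτ
    (hu.comp (continuous_const.add continuous_id)).aestronglyMeasurable fun y => hA _
  have e1 : ∫ y, heatKernel τ y * u (x + y) = heatSemigroup τ u x := by
    rw [heatSemigroup_eq_integral_sub, ← integral_neg_eq_self]
    simp only [heatKernel_neg, ← sub_eq_add_neg]
  have e2 : ∀ y, (2 * u x - u (x + y) - u (x - y)) * heatKernel τ y =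
      2 * u x * heatKernel τ y - heatKernel τ y * u (x + y) - heatKernel τ y * u (x - y) :=
    fun y => by ring
  have h0 : Integrable fun y : EuclideanSpace ℝ (Fin n) => 2 * u x * heatKernel τ y :=
    (integrable_heatKernel hτ).const_mul _
  have h3 : Integrable fun y => 2 * u x * heatKernel τ y - heatKernel τ y * u (x + y) := h0.sub h2
  simp only [e2]
  rw [integral_sub h3 h1, integral_sub h0 h2, e1, ← heatSemigroup_eq_integral_sub,
    integral_const_mul, integral_heatKernel hτ]
  ring

/-- Integrating in y first: for τ ≤ 1 the β-moment of the Gaussian gives τ^(β/2-s-1), integrable at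
0 since β > 2s; for τ > 1 boundedness of u gives τ^(-s-1). -/
theorem integrable_second_diff_mul_rpow_mul_heatKernel {s β L A : ℝ} (hs : 0 < s)
    (hβ : 2 * s < β) {u : EuclideanSpace ℝ (Fin n) → ℝ} (hu : Continuous u)
    (hA : ∀ x, |u x| ≤ A) {x : EuclideanSpace ℝ (Fin n)}
    (hL0 : 0 ≤ L) (hL : ∀ y, |2 * u x - u (x + y) - u (x - y)| ≤ L * ‖y‖ ^ β) :
    Integrable (Function.uncurry fun (y : EuclideanSpace ℝ (Fin n)) (τ : ℝ) =>
      (2 * u x - u (x + y) - u (x - y)) * (τ ^ (-1 - s) * heatKernel τ y))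
      (volume.prod (volume.restrict (Ioi 0))) := by
  obtain ⟨C, hC, hCb⟩ := exists_integral_heatKernel_mul_rpow_le n (by linarith : 0 ≤ β)
  have hDm : Continuous fun y => 2 * u x - u (x + y) - u (x - y) := by fun_prop
  have hD4 : ∀ y, |2 * u x - u (x + y) - u (x - y)| ≤ 4 * A := fun y => by
    have h1 := abs_le.1 (hA x)
    have h2 := abs_le.1 (hA (x + y))
    have h3 := abs_le.1 (hA (x - y))
    exact abs_le.2 ⟨by linarith [h1.1, h2.2, h3.2], by linarith [h1.2, h2.1, h3.1]⟩
  have hm : Measurable (Function.uncurry fun (y : EuclideanSpace ℝ (Fin n)) (τ : ℝ) =>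
      (2 * u x - u (x + y) - u (x - y)) * (τ ^ (-1 - s) * heatKernel τ y)) := by
    refine (hDm.measurable.comp measurable_fst).mul (Measurable.mul ?_ ?_)
    · fun_prop
    · exact measurable_heatKernel_uncurry.comp (measurable_snd.prodMk measurable_fst)
  have hslice : ∀ τ, 0 < τ → Integrable fun y =>
      |2 * u x - u (x + y) - u (x - y)| * heatKernel τ y := fun τ hτ => by
    have := integrable_heatKernel_mul hτ hDm.abs.aestronglyMeasurable
      (fun y => by rw [abs_abs]; exact hD4 y)
    simpa only [mul_comm] using this
  have enorm : ∀ τ, 0 < τ → ∀ y,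
      ‖(2 * u x - u (x + y) - u (x - y)) * (τ ^ (-1 - s) * heatKernel τ y)‖ =
        τ ^ (-1 - s) * (|2 * u x - u (x + y) - u (x - y)| * heatKernel τ y) := fun τ hτ y => by
    rw [norm_mul, norm_mul, Real.norm_of_nonneg (heatKernel_nonneg hτ y),
      Real.norm_of_nonneg (by positivity : 0 ≤ τ ^ (-1 - s)), Real.norm_eq_abs]
    ring
  rw [integrable_prod_iff' hm.aestronglyMeasurable]
  constructor
  · filter_upwards [ae_restrict_mem measurableSet_Ioi] with τ hτ
    refine ((hslice τ hτ).const_mul (τ ^ (-1 - s))).mono'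
      (hm.comp (measurable_id.prodMk measurable_const)).aestronglyMeasurable
      (Eventually.of_forall fun y => (enorm τ hτ y).le)
  · refine Integrable.mono' (integrableOn_Ioi_ite_rpow (L * C) (4 * A)
      (by linarith : 0 < β / 2 - s) hs one_pos).1
      (hm.norm.stronglyMeasurable.integral_prod_left').aestronglyMeasurable ?_
    filter_upwards [ae_restrict_mem measurableSet_Ioi] with τ hτ
    have hτ : 0 < τ := hτ
    rw [Real.norm_of_nonneg (integral_nonneg fun _ => norm_nonneg _)]
    simp only [Function.uncurry, enorm τ hτ]
    rw [integral_const_mul]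
    split_ifs with h
    · have h1 : ∫ y, |2 * u x - u (x + y) - u (x - y)| * heatKernel τ y ≤ L * (C * τ ^ (β / 2)) := by
        have h2 : ∫ y, |2 * u x - u (x + y) - u (x - y)| * heatKernel τ y ≤
            ∫ y : EuclideanSpace ℝ (Fin n), L * (heatKernel τ y * ‖y‖ ^ β) := by
          refine integral_mono (hslice τ hτ) ((hCb τ hτ).1.const_mul L) fun y => ?_
          have := mul_le_mul_of_nonneg_right (hL y) (heatKernel_nonneg hτ y)
          simp only
          linarith
        rw [integral_const_mul] at h2
        exact h2.trans (mul_le_mul_of_nonneg_left (hCb τ hτ).2 hL0)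
      calc τ ^ (-1 - s) * ∫ y, |2 * u x - u (x + y) - u (x - y)| * heatKernel τ y
          ≤ τ ^ (-1 - s) * (L * (C * τ ^ (β / 2))) :=
            mul_le_mul_of_nonneg_left h1 (by positivity)
        _ = L * C * (τ ^ (-1 - s) * τ ^ (β / 2)) := by ring
        _ = L * C * τ ^ (β / 2 - s - 1) := by rw [← Real.rpow_add hτ]; congr 2; ring
    · have h1 : ∫ y, |2 * u x - u (x + y) - u (x - y)| * heatKernel τ y ≤ 4 * A := by
        have h2 : ∫ y, |2 * u x - u (x + y) - u (x - y)| * heatKernel τ y ≤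
            ∫ y : EuclideanSpace ℝ (Fin n), 4 * A * heatKernel τ y :=
          integral_mono (hslice τ hτ) ((integrable_heatKernel hτ).const_mul _) fun y =>
            mul_le_mul_of_nonneg_right (hD4 y) (heatKernel_nonneg hτ y)
        rwa [integral_const_mul, integral_heatKernel hτ, mul_one] at h2
      calc τ ^ (-1 - s) * ∫ y, |2 * u x - u (x + y) - u (x - y)| * heatKernel τ y
          ≤ τ ^ (-1 - s) * (4 * A) := mul_le_mul_of_nonneg_left h1 (by positivity)
        _ = 4 * A * τ ^ (-s - 1) := by rw [mul_comm]; congr 2; ring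

/-- Since |Γ(-s)| = Γ(1 - s)/s, the constant c_{n,s} is the subordination constant divided by the
value of the Marchaud integral on e^(-t), up to the factor Γ(s). -/
theorem fracLaplacianConst_pos {s : ℝ} (hs : 0 < s) (hs1 : s < 1) : 0 < fracLaplacianConst n s ∧
    fracLaplacianConst n s * (Real.Gamma (1 - s) / s) =
      4 ^ s * Real.Gamma ((n : ℝ) / 2 + s) / Real.pi ^ ((n : ℝ) / 2) := by
  have hpi := Real.pi_pos
  have hG : 0 < Real.Gamma (1 - s) := Real.Gamma_pos_of_pos (by linarith)
  have hG2 : 0 < Real.Gamma ((n : ℝ) / 2 + s) := Real.Gamma_pos_of_pos (by positivity)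
  have e : |Real.Gamma (-s)| = Real.Gamma (1 - s) / s := by
    have h := Real.Gamma_add_one (s := -s) (by linarith)
    rw [show -s + 1 = 1 - s by ring] at h
    rw [eq_div_iff hs.ne', h, ← abs_of_pos hs, ← abs_mul, abs_of_pos hs, abs_of_neg (by linarith)]
    ring
  rw [fracLaplacianConst, e]
  refine ⟨by positivity, ?_⟩
  field_simp

theorem integrableOn_rpow_norm {p : ℝ} (hp : (n : ℝ) < p) {ε : ℝ} (hε : 0 < ε) :
    IntegrableOn (fun y : EuclideanSpace ℝ (Fin n) => (‖y‖ ^ p)⁻¹) {y | ε < ‖y‖} := by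
  have h := integrable_one_add_norm (E := EuclideanSpace ℝ (Fin n)) (μ := volume) (r := p)
    (by rwa [finrank_euclideanSpace, Fintype.card_fin])
  have hp0 : 0 < p := lt_of_le_of_lt n.cast_nonneg hp
  refine Integrable.mono' ((h.const_mul ((1 + 1 / ε) ^ p)).integrableOn (s := {y | ε < ‖y‖}))
    (Measurable.aestronglyMeasurable (by fun_prop)) ?_
  filter_upwards [ae_restrict_mem (measurableSet_lt measurable_const measurable_norm)] with y hy
  have hy : ε < ‖y‖ := hy
  have hy0 : 0 < ‖y‖ := hε.trans hy
  have h1 : 1 + ‖y‖ ≤ (1 + 1 / ε) * ‖y‖ := by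
    have : 1 ≤ 1 / ε * ‖y‖ := by
      rw [one_div_mul_eq_div, one_le_div hε]; exact hy.le
    linarith
  have h2 : (1 + ‖y‖) ^ p ≤ (1 + 1 / ε) ^ p * ‖y‖ ^ p := by
    rw [← Real.mul_rpow (by positivity) (by positivity)]
    exact Real.rpow_le_rpow (by positivity) h1 hp0.le
  rw [Real.norm_of_nonneg (by positivity), Real.rpow_neg (by positivity), ← div_eq_mul_inv,
    inv_le_iff_one_le_mul₀ (by positivity), div_mul_eq_mul_div, one_le_div (by positivity)]
  exact h2

theorem integrableOn_truncated {p : ℝ} (hp : (n : ℝ) < p) {ε : ℝ} (hε : 0 < ε)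
    {g : EuclideanSpace ℝ (Fin n) → ℝ} (hg : Continuous g) {A : ℝ} (hA : ∀ y, |g y| ≤ A) :
    IntegrableOn (fun y => g y / ‖y‖ ^ p) {y | ε < ‖y‖} :=
  Integrable.bdd_mul (c := A) (integrableOn_rpow_norm hp hε) hg.aestronglyMeasurable
    (Eventually.of_forall hA)

theorem setIntegral_sub_div_rpow_eq (x : EuclideanSpace ℝ (Fin n))
    (v : EuclideanSpace ℝ (Fin n) → ℝ) (p ε : ℝ) :
    ∫ z in {z | ε < ‖x - z‖}, (v x - v z) / ‖x - z‖ ^ p =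
      ∫ y in {y | ε < ‖y‖}, (v x - v (x - y)) / ‖y‖ ^ p := by
  have hm : MeasurableSet {y : EuclideanSpace ℝ (Fin n) | ε < ‖y‖} :=
    measurableSet_lt measurable_const measurable_norm
  have hm' : MeasurableSet {z : EuclideanSpace ℝ (Fin n) | ε < ‖x - z‖} :=
    measurableSet_lt measurable_const (by fun_prop)
  have h := integral_sub_left_eq_self ({y : EuclideanSpace ℝ (Fin n) | ε < ‖y‖}.indicator
    fun y => (v x - v (x - y)) / ‖y‖ ^ p) volume x
  rw [integral_indicator hm] at h
  rw [← h, ← integral_indicator hm']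
  refine integral_congr_ae (Eventually.of_forall fun z => ?_)
  simp [indicator]

theorem setIntegral_neg_norm (g : EuclideanSpace ℝ (Fin n) → ℝ) (ε : ℝ) :
    ∫ y in {y | ε < ‖y‖}, g (-y) = ∫ y in {y | ε < ‖y‖}, g y := by
  have hm : MeasurableSet {y : EuclideanSpace ℝ (Fin n) | ε < ‖y‖} :=
    measurableSet_lt measurable_const measurable_norm
  rw [← integral_indicator hm, ← integral_indicator hm, ← integral_neg_eq_self]
  refine integral_congr_ae (Eventually.of_forall fun y => ?_)
  simp [indicator]

/-- Away from the origin the integrals with x + y and x - y both converge and agree under y ↦ -y.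
Averaging them replaces the principal value by truncations of an integral of second differences. -/
theorem setIntegral_sub_div_rpow_eq_second_diff {p : ℝ} (hp : (n : ℝ) < p) {ε : ℝ} (hε : 0 < ε)
    {u : EuclideanSpace ℝ (Fin n) → ℝ} (hu : Continuous u) {A : ℝ} (hA : ∀ x, |u x| ≤ A)
    (x : EuclideanSpace ℝ (Fin n)) :
    ∫ z in {z | ε < ‖x - z‖}, (u x - u z) / ‖x - z‖ ^ p =
      1 / 2 * ∫ y in {y | ε < ‖y‖}, (2 * u x - u (x + y) - u (x - y)) / ‖y‖ ^ p := by
  have hb : ∀ z, |u x - u z| ≤ A + A := fun z =>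
    (abs_sub _ _).trans (add_le_add (hA _) (hA _))
  have h1 : IntegrableOn (fun y => (u x - u (x - y)) / ‖y‖ ^ p) {y | ε < ‖y‖} :=
    integrableOn_truncated hp hε (by fun_prop) fun y => hb _
  have h2 : IntegrableOn (fun y => (u x - u (x + y)) / ‖y‖ ^ p) {y | ε < ‖y‖} :=
    integrableOn_truncated hp hε (by fun_prop) fun y => hb _
  have e1 : ∫ y in {y | ε < ‖y‖}, (u x - u (x - y)) / ‖y‖ ^ p =
      ∫ y in {y | ε < ‖y‖}, (u x - u (x + y)) / ‖y‖ ^ p := by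
    rw [← setIntegral_neg_norm]
    simp only [sub_neg_eq_add, norm_neg]
  have e2 : ∀ y : EuclideanSpace ℝ (Fin n), (2 * u x - u (x + y) - u (x - y)) / ‖y‖ ^ p =
      (u x - u (x + y)) / ‖y‖ ^ p + (u x - u (x - y)) / ‖y‖ ^ p := fun y => by ring
  rw [setIntegral_sub_div_rpow_eq]
  simp only [e2]
  rw [integral_add h2 h1, ← e1]
  ring

/-- `(-Δ)^{-s} f` solves the equation, when its second differences are controlled. -/
theorem IsCompactHolder.hasFracLaplacianAt_of_lt_two {s α H : ℝ} (hs : 0 < s) (hs1 : s < 1)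
    (hsn : s < (n : ℝ) / 2) (hα : 0 < α) (hαs : α + 2 * s < 2)
    {f : EuclideanSpace ℝ (Fin n) → ℝ} (hf : IsCompactHolder α H f)
    (x : EuclideanSpace ℝ (Fin n)) : HasFracLaplacianAt s (negPowLaplacian s f) (f x) x := by
  have hG := Real.Gamma_pos_of_pos hs
  have hk : ((0 : ℕ) : ℝ) < α + 2 * s := by simp; linarith
  set u := negPowLaplacian s f with hu
  have huc : Continuous u := (contDiff_negPowLaplacian hs hsn hα hk hf).1.continuous
  obtain ⟨A, hA⟩ := exists_norm_iteratedFDeriv_negPowLaplacian_le hs hsn hα hk hf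
  simp only [norm_iteratedFDeriv_zero, Real.norm_eq_abs] at hA
  obtain ⟨C, hC, hCb⟩ := exists_norm_iteratedFDeriv_negPowLaplacian_second_diff_le n hs hsn hα hk
    (by simpa using hαs)
  have hL : ∀ y, |2 * u x - u (x + y) - u (x - y)| ≤ C * H * ‖y‖ ^ (α + 2 * s) := fun y => by
    have h1 := (ContinuousMultilinearMap.le_opNorm _ 0).trans
      (mul_le_mul_of_nonneg_right (hCb f H hf x y) (Finset.prod_nonneg fun _ _ => norm_nonneg _))
    simp only [Finset.univ_eq_empty, Finset.prod_empty, mul_one, CharP.cast_eq_zero, sub_zero] at h1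
    rw [← abs_neg]
    refine le_trans (le_of_eq ?_) h1
    rw [Real.norm_eq_abs]
    congr 1
    change _ = u (x + y) + u (x - y) - 2 * u x
    ring
  have hH := hf.nonneg
  have hI := integrable_second_diff_mul_rpow_mul_heatKernel hs (by linarith : 2 * s < α + 2 * s)
    huc hA (x := x) (by positivity) hL
  set κ := 4 ^ s * Real.Gamma ((n : ℝ) / 2 + s) / Real.pi ^ ((n : ℝ) / 2) with hκ
  obtain ⟨hc, hcκ⟩ := fracLaplacianConst_pos (n := n) hs hs1
  have hκ0 : 0 < κ := by
    have := Real.pi_pos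
    have := Real.Gamma_pos_of_pos (by positivity : 0 < (n : ℝ) / 2 + s)
    positivity
  -- Integrating in τ first gives the fractional Laplacian kernel; at y = 0 both sides vanish.
  have e1 : ∀ y, ∫ τ in Ioi 0, (2 * u x - u (x + y) - u (x - y)) * (τ ^ (-1 - s) * heatKernel τ y) =
      κ * ((2 * u x - u (x + y) - u (x - y)) / ‖y‖ ^ ((n : ℝ) + 2 * s)) := fun y => by
    rw [integral_const_mul]
    rcases eq_or_ne y 0 with rfl | hy
    · rw [add_zero, sub_zero, show 2 * u x - u x - u x = 0 by ring]
      simp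
    · rw [integral_rpow_mul_heatKernel hs hy]
      ring
  set W : ℝ → ℝ := fun τ => (∫ t in Ioi 0, t ^ (s - 1) * heatSemigroup t f x) -
    ∫ t in Ioi 0, t ^ (s - 1) * heatSemigroup (t + τ) f x with hW
  -- Integrating in y first gives 2 (u - e^{τΔ}u)(x), which is 2/Γ(s) times the increment `W` of the
  -- Weyl integral.
  have e2 : ∀ τ ∈ Ioi (0 : ℝ), ∫ y, (2 * u x - u (x + y) - u (x - y)) *
      (τ ^ (-1 - s) * heatKernel τ y) = 2 / Real.Gamma s * (τ ^ (-1 - s) * W τ) := fun τ hτ => by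
    simp only [mul_left_comm _ (τ ^ (-1 - s))]
    rw [integral_const_mul, integral_second_diff_mul_heatKernel hτ huc hA,
      heatSemigroup_negPowLaplacian hs hsn hα hf hτ, hu, negPowLaplacian_eq]
    simp only [div_mul_eq_mul_div]
    rw [integral_div]
    ring
  have hIy : Integrable fun y => (2 * u x - u (x + y) - u (x - y)) / ‖y‖ ^ ((n : ℝ) + 2 * s) := by
    have h1 : Integrable fun y => ∫ τ in Ioi 0, (2 * u x - u (x + y) - u (x - y)) *
      (τ ^ (-1 - s) * heatKernel τ y) := hI.integral_prod_left
    simp only [e1] at h1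
    have h2 := h1.const_mul κ⁻¹
    simpa only [inv_mul_cancel_left₀ hκ0.ne'] using h2
  have hIτ : IntegrableOn (fun τ => τ ^ (-1 - s) * W τ) (Ioi 0) := by
    have h1 : IntegrableOn (fun τ => ∫ y, (2 * u x - u (x + y) - u (x - y)) *
      (τ ^ (-1 - s) * heatKernel τ y)) (Ioi 0) := hI.integral_prod_right
    have h2 : IntegrableOn (fun τ => (2 / Real.Gamma s)⁻¹ * (2 / Real.Gamma s *
      (τ ^ (-1 - s) * W τ))) (Ioi 0) := Integrable.const_mul (h1.congr_fun e2 measurableSet_Ioi) _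
    simpa only [inv_mul_cancel_left₀ (by positivity : (2 / Real.Gamma s) ≠ 0)] using h2
  obtain ⟨b, hb, hbd⟩ := hf.exists_bound_heatSemigroup_add hs hsn hα x
  have hφ : Measurable fun t => heatSemigroup t f x :=
    (stronglyMeasurable_heatSemigroup_uncurry hf.continuous).measurable.comp
      (measurable_id.prodMk measurable_const)
  have hmar := integral_marchaud_eq_mul hs hs1 hφ hb hbd
    (fun t ht => abs_heatSemigroup_le ht hf.bound x)
    (tendsto_heatSemigroup_nhdsWithin_zero hα hf x) hIτ
  have hval : κ * ∫ y, (2 * u x - u (x + y) - u (x - y)) / ‖y‖ ^ ((n : ℝ) + 2 * s) =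
      2 * f x * (Real.Gamma (1 - s) / s) := by
    rw [← integral_const_mul]
    simp only [← e1]
    rw [integral_integral_swap hI, setIntegral_congr_fun measurableSet_Ioi e2, integral_const_mul]
    rw [hmar, integral_marchaudKernel hs hs1]
    field_simp
  have hΓ : 0 < Real.Gamma (1 - s) / s := div_pos (Real.Gamma_pos_of_pos (by linarith)) hs
  have hlim := ((tendsto_setIntegral_lt measurable_norm
    (hIy.integrableOn (s := {y | 0 < ‖y‖}))).const_mul (1 / 2)).const_mul (fracLaplacianConst n s)
  have hfull : ∫ y in {y | 0 < ‖y‖}, (2 * u x - u (x + y) - u (x - y)) / ‖y‖ ^ ((n : ℝ) + 2 * s) =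
      ∫ y, (2 * u x - u (x + y) - u (x - y)) / ‖y‖ ^ ((n : ℝ) + 2 * s) := by
    refine setIntegral_eq_integral_of_forall_compl_eq_zero fun y hy => ?_
    have hy0 : y = 0 := by simpa using hy
    rw [hy0, add_zero, sub_zero, show 2 * u x - u x - u x = 0 by ring, zero_div]
  have hend : fracLaplacianConst n s * (1 / 2 * ∫ y in {y | 0 < ‖y‖},
      (2 * u x - u (x + y) - u (x - y)) / ‖y‖ ^ ((n : ℝ) + 2 * s)) = f x := by
    rw [hfull]
    rw [hκ, ← hcκ] at hval
    have h3 : Real.Gamma (1 - s) / s * (fracLaplacianConst n s *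
        (∫ y, (2 * u x - u (x + y) - u (x - y)) / ‖y‖ ^ ((n : ℝ) + 2 * s))) =
        Real.Gamma (1 - s) / s * (2 * f x) := by linarith
    have h4 := mul_left_cancel₀ hΓ.ne' h3
    linarith
  rw [hend] at hlim
  refine hlim.congr' ?_
  filter_upwards [self_mem_nhdsWithin] with ε hε
  rw [setIntegral_sub_div_rpow_eq_second_diff (by linarith) hε huc hA]

/-- Lowering α to min(α, 1 - s) loses nothing, as the claim is qualitative, and gives α + 2s ≤ 1 + s
< 2. -/
theorem IsCompactHolder.hasFracLaplacianAt {s α H : ℝ} (hs : 0 < s) (hs1 : s < 1)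
    (hsn : s < (n : ℝ) / 2) (hα : 0 < α) {f : EuclideanSpace ℝ (Fin n) → ℝ}
    (hf : IsCompactHolder α H f) (x : EuclideanSpace ℝ (Fin n)) :
    HasFracLaplacianAt s (negPowLaplacian s f) (f x) x := by
  have hβ : 0 < min α (1 - s) := lt_min hα (by linarith)
  refine (hf.mono hβ (min_le_left _ _)).hasFracLaplacianAt_of_lt_two hs hs1 hsn hβ ?_ x
  have := min_le_right α (1 - s)
  linarith

end Equation

/-! ### Maximum principle and classical solutions -/

section Uniqueness

variable {n : ℕ}

theorem HasFracLaplacianAt.sub {s : ℝ} (hs : 0 < s) {v w : EuclideanSpace ℝ (Fin n) → ℝ}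
    (hv : Continuous v) (hw : Continuous w) {A B : ℝ} (hA : ∀ x, |v x| ≤ A) (hB : ∀ x, |w x| ≤ B)
    {a b : ℝ} {x : EuclideanSpace ℝ (Fin n)} (h : HasFracLaplacianAt s v a x)
    (h' : HasFracLaplacianAt s w b x) : HasFracLaplacianAt s (fun y => v y - w y) (a - b) x := by
  refine (Tendsto.sub h h').congr' ?_
  filter_upwards [self_mem_nhdsWithin] with ε hε
  have hp : (n : ℝ) < n + 2 * s := by linarith
  have h1 : IntegrableOn (fun y => (v x - v (x - y)) / ‖y‖ ^ ((n : ℝ) + 2 * s)) {y | ε < ‖y‖} :=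
    integrableOn_truncated hp hε (by fun_prop) (A := A + A) fun y =>
      (abs_sub _ _).trans (add_le_add (hA _) (hA _))
  have h2 : IntegrableOn (fun y => (w x - w (x - y)) / ‖y‖ ^ ((n : ℝ) + 2 * s)) {y | ε < ‖y‖} :=
    integrableOn_truncated hp hε (by fun_prop) (A := B + B) fun y =>
      (abs_sub _ _).trans (add_le_add (hB _) (hB _))
  rw [setIntegral_sub_div_rpow_eq, setIntegral_sub_div_rpow_eq,
    setIntegral_sub_div_rpow_eq x (fun y => v y - w y), ← mul_sub, ← integral_sub h1 h2]
  congr 2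
  funext y
  ring

/-- The maximum principle for the fractional Laplacian. -/
theorem nonpos_of_hasFracLaplacianAt_zero {s : ℝ} (hs : 0 < s) (hs1 : s < 1) (hn : 0 < n)
    {w : EuclideanSpace ℝ (Fin n) → ℝ} (hw : Continuous w) {A : ℝ} (hA : ∀ x, |w x| ≤ A)
    (h0 : Tendsto w (cocompact (EuclideanSpace ℝ (Fin n))) (𝓝 0))
    (h : ∀ x, HasFracLaplacianAt s w 0 x) (x : EuclideanSpace ℝ (Fin n)) : w x ≤ 0 := by
  by_contra! hx
  -- A continuous function with a positive value that tends to 0 at infinity attains its maximum.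
  obtain ⟨x₀, hx₀⟩ := hw.exists_forall_ge' x
    ((h0.eventually (gt_mem_nhds hx)).mono fun y hy => hy.le)
  have hpos : 0 < w x₀ := hx.trans_le (hx₀ x)
  have hp : (n : ℝ) < n + 2 * s := by linarith
  obtain ⟨hc, _⟩ := fracLaplacianConst_pos (n := n) hs hs1
  obtain ⟨R, hR, hRw⟩ : ∃ R : ℝ, 0 < R ∧ ∀ y, R < ‖y‖ → w (x₀ - y) ≤ w x₀ / 2 := by
    have h1 : ∀ᶠ z in cocompact (EuclideanSpace ℝ (Fin n)), w z < w x₀ / 2 :=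
      h0.eventually (gt_mem_nhds (by linarith))
    rw [← Metric.cobounded_eq_cocompact, ← comap_norm_atTop] at h1
    obtain ⟨R, hR⟩ := eventually_atTop.1 (eventually_comap.1 h1)
    refine ⟨max (R + ‖x₀‖) 1, by positivity, fun y hy => (hR ‖x₀ - y‖ ?_ _ rfl).le⟩
    have h2 := norm_sub_norm_le y x₀
    rw [norm_sub_rev] at h2
    have h3 := (le_max_left (R + ‖x₀‖) 1).trans hy.le
    linarith
  set J := ∫ y : EuclideanSpace ℝ (Fin n) in {y | R < ‖y‖}, (‖y‖ ^ ((n : ℝ) + 2 * s))⁻¹ with hJ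
  have hmR : ∀ ε : ℝ, MeasurableSet {y : EuclideanSpace ℝ (Fin n) | ε < ‖y‖} := fun ε =>
    measurableSet_lt measurable_const measurable_norm
  have hJ0 : 0 < J := by
    rw [hJ, setIntegral_pos_iff_support_of_nonneg_ae
      (Eventually.of_forall fun y => by positivity) (integrableOn_rpow_norm hp hR)]
    have hsub : {y : EuclideanSpace ℝ (Fin n) | R < ‖y‖} ⊆
        (Function.support fun y : EuclideanSpace ℝ (Fin n) => (‖y‖ ^ ((n : ℝ) + 2 * s))⁻¹) ∩
          {y | R < ‖y‖} := fun y hy => by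
      refine ⟨?_, hy⟩
      have : 0 < ‖y‖ := hR.trans hy
      exact (by positivity : 0 < (‖y‖ ^ ((n : ℝ) + 2 * s))⁻¹).ne'
    -- Positive dimension makes the exterior of the ball nonempty; being open, it has positive
    -- measure.
    have : Nonempty (Fin n) := ⟨⟨0, hn⟩⟩
    obtain ⟨y, hy⟩ := NormedSpace.exists_lt_norm ℝ (EuclideanSpace ℝ (Fin n)) R
    exact ((isOpen_lt continuous_const continuous_norm).measure_pos volume ⟨y, hy⟩).trans_le
      (measure_mono hsub)
  -- At the maximum the integrand is nonnegative, so the region |y| ≤ R may be dropped; outside it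
  -- w(x₀) - w ≥ w(x₀)/2. The bound does not depend on ε.
  have hlow : ∀ᶠ ε in 𝓝[>] (0 : ℝ), fracLaplacianConst n s * (w x₀ / 2 * J) ≤
      fracLaplacianConst n s *
        ∫ z in {z | ε < ‖x₀ - z‖}, (w x₀ - w z) / ‖x₀ - z‖ ^ ((n : ℝ) + 2 * s) := by
    filter_upwards [Ioo_mem_nhdsGT hR] with ε hε
    have hi : IntegrableOn (fun y => (w x₀ - w (x₀ - y)) / ‖y‖ ^ ((n : ℝ) + 2 * s))
        {y | ε < ‖y‖} := integrableOn_truncated hp hε.1 (by fun_prop) (A := A + A) fun y =>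
      (abs_sub _ _).trans (add_le_add (hA _) (hA _))
    have hss : {y : EuclideanSpace ℝ (Fin n) | R < ‖y‖} ⊆ {y | ε < ‖y‖} := fun y hy =>
      hε.2.trans hy
    refine mul_le_mul_of_nonneg_left ?_ hc.le
    rw [setIntegral_sub_div_rpow_eq, hJ, ← integral_const_mul]
    refine (setIntegral_mono_on ((integrableOn_rpow_norm hp hR).const_mul _)
      (hi.mono_set hss) (hmR R) fun y hy => ?_).trans
      (setIntegral_mono_set hi (Eventually.of_forall fun y => ?_) hss.eventuallyLE)
    · rw [div_eq_mul_inv (w x₀ - _)]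
      have := hRw y hy
      exact mul_le_mul_of_nonneg_right (by linarith) (by positivity)
    · exact div_nonneg (sub_nonneg.2 (hx₀ _)) (by positivity)
  have hfin := ge_of_tendsto (h x₀) hlow
  have : 0 < fracLaplacianConst n s * (w x₀ / 2 * J) := by positivity
  linarith

theorem IsHolderNear.continuousAt {k : ℕ} {β : ℝ} {v : EuclideanSpace ℝ (Fin n) → ℝ}
    {x : EuclideanSpace ℝ (Fin n)} (h : IsHolderNear k β v x) : ContinuousAt v x := by
  obtain ⟨U, hU, hv, _⟩ := h
  exact hv.continuousOn.continuousAt hU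

theorem IsBddClassicalSolution.continuous {s : ℝ} {f v : EuclideanSpace ℝ (Fin n) → ℝ}
    (h : IsBddClassicalSolution s f v) : Continuous v := by
  refine continuous_iff_continuousAt.2 fun x => ?_
  obtain ⟨ε, _, h1 | h1⟩ := h.regular x
  · exact h1.2.2.continuousAt
  · exact h1.2.2.continuousAt

theorem IsBddClassicalSolution.le {s : ℝ} (hs : 0 < s) (hs1 : s < 1) (hn : 0 < n)
    {f v w : EuclideanSpace ℝ (Fin n) → ℝ} (hv : IsBddClassicalSolution s f v)
    (hw : IsBddClassicalSolution s f w) (x : EuclideanSpace ℝ (Fin n)) : v x ≤ w x := by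
  obtain ⟨A, hA⟩ := hv.bounded
  obtain ⟨B, hB⟩ := hw.bounded
  have h := nonpos_of_hasFracLaplacianAt_zero (w := fun y => v y - w y) (A := A + B) hs hs1 hn
    (hv.continuous.sub hw.continuous) (fun y => (abs_sub _ _).trans (add_le_add (hA y) (hB y)))
    (by simpa using hv.vanishes.sub hw.vanishes)
    (fun y => by
      simpa using (hv.equation y).sub hs hv.continuous hw.continuous hA hB (hw.equation y)) x
  exact sub_nonpos.1 h

theorem IsBddClassicalSolution.unique {s : ℝ} (hs : 0 < s) (hs1 : s < 1) (hn : 0 < n)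
    {f v w : EuclideanSpace ℝ (Fin n) → ℝ} (hv : IsBddClassicalSolution s f v)
    (hw : IsBddClassicalSolution s f w) : v = w :=
  funext fun x => le_antisymm (hv.le hs hs1 hn hw x) (hw.le hs hs1 hn hv x)

theorem IsCompactHolder.isHolderNear {s α H : ℝ} (hs : 0 < s) (hsn : s < (n : ℝ) / 2) (hα : 0 < α)
    {k : ℕ} (hk : (k : ℝ) < α + 2 * s) (hk' : α + 2 * s < k + 1)
    {f : EuclideanSpace ℝ (Fin n) → ℝ} (hf : IsCompactHolder α H f)
    (x : EuclideanSpace ℝ (Fin n)) :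
    IsHolderNear k (α + 2 * s - k) (negPowLaplacian s f) x := by
  obtain ⟨C, _, h⟩ := exists_norm_iteratedFDeriv_negPowLaplacian_sub_le n hs hsn hα hk hk'
  refine ⟨univ, univ_mem, (contDiff_negPowLaplacian hs hsn hα hk hf).1.contDiffOn, fun γ =>
    ⟨_, (holderWith_partialD (by linarith) (h f H hf) γ).holderOnWith univ⟩⟩

theorem IsCompactHolder.isBddClassicalSolution {s α H : ℝ} (hs : 0 < s) (hs1 : s < 1)
    (hsn : s < (n : ℝ) / 2) (hα : 0 < α) {f : EuclideanSpace ℝ (Fin n) → ℝ}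
    (hf : IsCompactHolder α H f) : IsBddClassicalSolution s f (negPowLaplacian s f) where
  bounded := by
    obtain ⟨B, hB⟩ := exists_norm_iteratedFDeriv_negPowLaplacian_le (k := 0) hs hsn hα
      (by simp; linarith) hf
    exact ⟨B, fun x => by simpa using hB x⟩
  regular x := by
    rcases lt_or_ge s (1 / 2) with h | h
    -- The exponent is lowered so that 2s + ε ≤ 1/2 + s < 1, the range of the order zero estimate.
    · have hβ : 0 < min α ((1 - 2 * s) / 2) := lt_min hα (by linarith)
      have hβ' := min_le_right α ((1 - 2 * s) / 2)
      refine ⟨min α ((1 - 2 * s) / 2), hβ, Or.inl ⟨h, by linarith, ?_⟩⟩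
      simpa [add_comm] using (hf.mono hβ (min_le_left _ _)).isHolderNear hs hsn hβ (k := 0)
        (by simp; linarith) (by simp; linarith) x
    -- Here 1 < 2s + ε ≤ 1 + s < 2, so the first order estimate applies, including at s = 1/2.
    · have hβ : 0 < min α (1 - s) := lt_min hα (by linarith)
      have hβ' := min_le_right α (1 - s)
      refine ⟨min α (1 - s), hβ, Or.inr ⟨h, by linarith, ?_⟩⟩
      rw [add_comm]
      simpa using (hf.mono hβ (min_le_left _ _)).isHolderNear hs hsn hβ (k := 1)
        (by simp; linarith) (by simp; linarith) x
  equation x := hf.hasFracLaplacianAt hs hs1 hsn hα x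
  vanishes := hf.tendsto_negPowLaplacian hs hsn hα

/-- A case that does not occur accepts any constant, so the constants of all cases can be fixed
together before f is given. -/
theorem exists_pos_of_imp {P : Prop} {Q : ℝ → Prop} (h : P → ∃ C, 0 < C ∧ Q C) :
    ∃ C, 0 < C ∧ (P → Q C) := by
  by_cases hP : P
  · obtain ⟨C, hC, hQ⟩ := h hP
    exact ⟨C, hC, fun _ => hQ⟩
  · exact ⟨1, one_pos, fun h => absurd h hP⟩

end Uniqueness

/-! ### Assembly of the theorem -/

theorem mainTheorem3 (n : ℕ) (s α : ℝ) (hs : 0 < s) (hs1 : s < 1) (hsn : s < (n : ℝ) / 2)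
    (hα : 0 < α) (hα1 : α ≤ 1) :
    ∃ C : ℝ, 0 < C ∧ ∀ f : EuclideanSpace ℝ (Fin n) → ℝ,
      MemHolderSpace 0 α f → HasCompactSupport f →
      (∀ x, IntegrableOn (fun t : ℝ => heatSemigroup t f x / t ^ (1 - s)) (Ioi 0) volume) ∧
      (α + 2 * s < 1 →
        MemHolderSpace 0 (α + 2 * s) (negPowLaplacian s f) ∧
        holderNorm 0 (α + 2 * s) (negPowLaplacian s f) ≤
          ENNReal.ofReal C * (eLpNorm (negPowLaplacian s f) ∞ volume + holderNorm 0 α f)) ∧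
      (1 < α + 2 * s → α + 2 * s < 2 →
        MemHolderSpace 1 (α + 2 * s - 1) (negPowLaplacian s f) ∧
        holderNorm 1 (α + 2 * s - 1) (negPowLaplacian s f) ≤
          ENNReal.ofReal C * (eLpNorm (negPowLaplacian s f) ∞ volume + holderNorm 0 α f)) ∧
      (2 < α + 2 * s → α + 2 * s < 3 →
        MemHolderSpace 2 (α + 2 * s - 2) (negPowLaplacian s f) ∧
        holderNorm 2 (α + 2 * s - 2) (negPowLaplacian s f) ≤
          ENNReal.ofReal C * (eLpNorm (negPowLaplacian s f) ∞ volume + holderNorm 0 α f)) ∧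
      (∀ k : ℕ, (k = 1 ∨ k = 2) → α + 2 * s = k →
        MemZygmundSpace k (negPowLaplacian s f) ∧
        zygmundNorm k (negPowLaplacian s f) ≤
          ENNReal.ofReal C * (eLpNorm (negPowLaplacian s f) ∞ volume + holderNorm 0 α f)) ∧
      IsBddClassicalSolution s f (negPowLaplacian s f) ∧
      ∀ v : EuclideanSpace ℝ (Fin n) → ℝ,
        IsBddClassicalSolution s f v → v = negPowLaplacian s f := by
  have hn : 0 < n := by
    have : (0 : ℝ) < n := by linarith
    exact_mod_cast this
  have hholder : ∀ k : ℕ, k ≤ 2 → _ := fun k hk2 =>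
    exists_pos_of_imp fun h : (k : ℝ) < α + 2 * s ∧ α + 2 * s < k + 1 =>
      exists_holderNorm_negPowLaplacian_le n hs hsn hα hk2 h.1 h.2
  have hzyg : ∀ k : ℕ, k ≤ 1 → _ := fun k hk1 =>
    exists_pos_of_imp fun h : α + 2 * s = (k + 1 : ℕ) =>
      exists_zygmundNorm_negPowLaplacian_le n hs hsn hα hk1 h
  obtain ⟨C₀, hC₀, h₀⟩ := hholder 0 (by norm_num)
  obtain ⟨C₁, hC₁, h₁⟩ := hholder 1 (by norm_num)
  obtain ⟨C₂, hC₂, h₂⟩ := hholder 2 (by norm_num)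
  -- The index is the order of the derivatives differenced, one less than that of the Zygmund space.
  obtain ⟨D₁, hD₁, z₁⟩ := hzyg 0 (by norm_num)
  obtain ⟨D₂, hD₂, z₂⟩ := hzyg 1 (by norm_num)
  have hmono : ∀ {c X : ℝ} {N Y : ℝ≥0∞}, c ≤ X → N ≤ ENNReal.ofReal c * Y →
      N ≤ ENNReal.ofReal X * Y := fun hcX hN =>
    hN.trans (mul_le_mul_left (ENNReal.ofReal_le_ofReal hcX) _)
  -- All five constants are positive, so their sum dominates each of them.
  refine ⟨C₀ + C₁ + C₂ + D₁ + D₂, by positivity, fun f hf hc => ?_⟩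
  have hfH := hf.isCompactHolder hα hc
  have hsol := hfH.isBddClassicalSolution hs hs1 hsn hα
  refine ⟨hfH.integrableOn_heatSemigroup_div hs hsn hα, fun h => ?_, fun h h' => ?_,
    fun h h' => ?_, fun k hk h => ?_, hsol, fun v hv => hv.unique hs hs1 hn hsol⟩
  · have := h₀ ⟨by simp; linarith, by simpa using h⟩ f hf hc
    rw [Nat.cast_zero, sub_zero] at this
    exact ⟨this.1, hmono (by linarith) this.2⟩
  · have := h₁ ⟨by simpa using h, by norm_num; linarith⟩ f hf hc
    rw [Nat.cast_one] at this
    exact ⟨this.1, hmono (by linarith) this.2⟩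
  · have := h₂ ⟨by simpa using h, by norm_num; linarith⟩ f hf hc
    rw [Nat.cast_ofNat] at this
    exact ⟨this.1, hmono (by linarith) this.2⟩
  · rcases hk with rfl | rfl
    · have := z₁ h f hf hc
      exact ⟨this.1, hmono (by linarith) this.2⟩
    · have := z₂ h f hf hc
      exact ⟨this.1, hmono (by linarith) this.2⟩
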